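/- Let Minkowski space have signature $(+,-,-,-)$, write $u\cdot v$ for the Minkowski product, let $\gamma^0,\dots,\gamma^3$ be Dirac matrices on $\mathbf C^4$ ($\gamma^a\gamma^b+\gamma^b\gamma^a=2g^{ab}$, $(\gamma^a)^\dagger=\gamma^0\gamma^a\gamma^0$), and write $\gamma\cdot v=\gamma^a v_a$. On the unit hyperboloid $z^2=1$, $z^0>0$, with invariant measure $d\mu(z)=2\delta(z^2-1)\theta(z^0)\,d^4z=d^3z/z^0$, let $\mathcal H$ be the Hilbert space of (classes of) measurable $\mathbf C^4$-valued functions with scalar product $(g,f)=\int \overline{g(z)}\,\gamma\cdot z\,f(z)\,d\mu(z)$, $\bar g=g^\dagger\gamma^0$, and let $C_0^\infty\subset\mathcal H$ be the smooth functions of compact support. For $\kappa>0$ and $f\in C_0^\infty$ put $$F_\kappa f(u)=\Big(\frac{\kappa}{2\pi}\Big)^{3/2}\int e^{-i\kappa\, u\cdot z\,\gamma\cdot z}\,\gamma\cdot z\, f(z)\,d\mu(z),\qquad F_\kappa^* f(u)=\Big(\frac{\kappa}{2\pi}\Big)^{3/2}\int e^{+i\kappa\, u\cdot z\,\gamma\cdot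 u}\,\gamma\cdot z\, f(z)\,d\mu(z).$$ These extend to unitary operators $F_\kappa$, $F_\kappa^*$ of $\mathcal H$ which are adjoint to each other. Fix $m>0$ and put $U_0(\lambda_2,\lambda_1)=F_{m\lambda_2}F_{m\lambda_1}^*$ for $\lambda_1,\lambda_2>0$. Let $\delta_a$ be the derivative tangent to the hyperboloid ($\delta_a z^b=h_a^b=g_a^b-z_az^b$), $\gamma_T^a=\gamma^a-z^a\,\gamma\cdot z$, $p_a=i\big(\delta_a+\tfrac12\gamma\cdot z\,\gamma_{Ta}-\tfrac32 z_a\big)$, $\Gamma f(z)=\gamma\cdot z\,f(z)$, and let $$H_\kappa=\Gamma\Big(-\frac1\kappa\,\gamma_T\cdot p+1\Big)$$ with domain $C_0^\infty$, which it maps into itself. **Proposition 4.2.** The families $F_\kappa$, $F_\kappa^*$ are strongly continuous in $\kappa>0$, and $U_0(\lambda_2,\lambda_1)$ is (jointly) strongly continuous in $\lambda_1,\lambda_2>0$. For $f\in C_0^\infty$ the vectors $F_\kappa^*f$ and $U_0(\lambda_2,\lambda_1)f$ are strongly differentiable in $\kappa$, $\lambda_2$ and $\lambda_1$, the vector $U_0(\lambda_2,\lambda_1)f$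 lies in $C_0^\infty$, and $$-i\frac{d}{d\kappa}F_\kappa^*f=F_\kappa^*H_\kappa f,$$ $$i\frac{\partial}{\partial\lambda_2}U_0(\lambda_2,\lambda_1)f=mH_{m\lambda_2}U_0(\lambda_2,\lambda_1)f,$$ $$-i\frac{\partial}{\partial\lambda_1}U_0(\lambda_2,\lambda_1)f=U_0(\lambda_2,\lambda_1)\,mH_{m\lambda_1}f.$$ Moreover $U_0$ is the free Dirac evolution in hyperbolic time: for $f\in C_0^\infty$ and $\lambda_1>0$ there is a smooth solution $\psi$ of the free Dirac equation $(i\gamma^a\partial_a-m)\psi=0$ in the open forward lightcone with $\psi(\lambda_1z)=\lambda_1^{-3/2}f(z)$ for all $z$ on the unit hyperboloid and, for every $\lambda>0$, $(U_0(\lambda,\lambda_1)f)(z)=\lambda^{3/2}\psi(\lambda z)$ for almost every such $z$. -/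

import Mathlib

open MeasureTheory Set

open scoped ContDiff Matrix

noncomputable section

namespace HypDirac

/-- Euclidean three-space; it parametrizes the unit hyperboloid. -/
abbrev E3 : Type := EuclideanSpace ℝ (Fin 3)

/-- Minkowski space, with coordinates `x⁰, x¹, x², x³`. -/
abbrev Mink : Type := Fin 4 → ℝ

/-- The space `ℂ⁴` of Dirac spinors. -/
abbrev Spinor : Type := Fin 4 → ℂ

/-- The diagonal entries `(1, -1, -1, -1)` of the Minkowski metric. -/
def sgn (a : Fin 4) : ℝ := if a = 0 then 1 else -1

/-- The Minkowski product `u · v = u⁰v⁰ - u¹v¹ - u²v² - u³v³`. -/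
def mdot (u v : Mink) : ℝ := ∑ a, sgn a * u a * v a

/-- A choice of Dirac matrices `γ⁰, …, γ³` (upper indices): the Clifford relations of the
Minkowski metric, together with the usual hermiticity `(γᵃ)† = γ⁰ γᵃ γ⁰`. -/
structure DiracMatrices where
  γ : Fin 4 → Matrix (Fin 4) (Fin 4) ℂ
  clifford : ∀ a b, γ a * γ b + γ b * γ a = (if a = b then 2 * (sgn a : ℂ) else 0) • 1
  herm : ∀ a, (γ a)ᴴ = γ 0 * γ a * γ 0

/-- The standard (Dirac) representation. -/
def DiracMatrices.standard : DiracMatrices where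
  γ := ![!![1, 0, 0, 0; 0, 1, 0, 0; 0, 0, -1, 0; 0, 0, 0, -1],
    !![0, 0, 0, 1; 0, 0, 1, 0; 0, -1, 0, 0; -1, 0, 0, 0],
    !![0, 0, 0, -Complex.I; 0, 0, Complex.I, 0; 0, Complex.I, 0, 0; -Complex.I, 0, 0, 0],
    !![0, 0, 1, 0; 0, 0, 0, -1; -1, 0, 0, 0; 0, 1, 0, 0]]
  clifford a b := by
    have h1 : (1 : Matrix (Fin 4) (Fin 4) ℂ)
        = !![1, 0, 0, 0; 0, 1, 0, 0; 0, 0, 1, 0; 0, 0, 0, 1] := by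
      ext i j; fin_cases i <;> fin_cases j <;> rfl
    have h0 : !![0, 0, 0, 0; 0, 0, 0, 0; 0, 0, 0, 0; 0, 0, 0, 0]
        = (0 : Matrix (Fin 4) (Fin 4) ℂ) := by
      ext i j; fin_cases i <;> fin_cases j <;> rfl
    rw [h1]
    fin_cases a <;> fin_cases b <;> simp [sgn, h0] <;> norm_num
  herm a := by
    ext i j
    fin_cases a <;> fin_cases i <;> fin_cases j <;>
      simp

/-- The point `z = (√(1 + |x|²), x)` of the unit hyperboloid `z² = 1`, `z⁰ > 0`. -/
def pt (x : E3) : Mink := Fin.cons (Real.sqrt (1 + ‖x‖ ^ 2)) (fun i => x i)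

/-- The invariant measure `2 δ(z² - 1) θ(z⁰) d⁴z = d³x / z⁰` on the unit hyperboloid, in the
coordinates `x`. -/
def hypMeasure : Measure E3 := volume.withDensity fun x => ENNReal.ofReal (1 / pt x 0)

namespace DiracMatrices

variable (D : DiracMatrices)

/-- `γ · v = γᵃ v_a`. -/
def slash (v : Mink) : Matrix (Fin 4) (Fin 4) ℂ := ∑ a, ((sgn a * v a : ℝ) : ℂ) • D.γ a

/-- The density `ḡ (γ · z) f`, with `ḡ = g† γ⁰` the Dirac conjugate, at the point `z = pt x`. -/
def density (x : E3) (g f : Spinor) : ℂ := star g ⬝ᵥ ((D.γ 0 * D.slash (pt x)) *ᵥ f)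

end DiracMatrices

/-! ### Algebra of the density -/

lemma pt_zero (x : E3) : pt x 0 = Real.sqrt (1 + ‖x‖ ^ 2) := rfl

lemma pt_succ (x : E3) (i : Fin 3) : pt x i.succ = x i := rfl

lemma pt_zero_pos (x : E3) : 0 < pt x 0 := by
  rw [pt_zero]; positivity

lemma mdot_pt (x : E3) : mdot (pt x) (pt x) = 1 := by
  have h : pt x 0 * pt x 0 = 1 + ‖x‖ ^ 2 := by
    rw [pt_zero]; exact Real.mul_self_sqrt (by positivity)
  have h2 : ‖x‖ ^ 2 = x 0 ^ 2 + x 1 ^ 2 + x 2 ^ 2 := by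
    rw [EuclideanSpace.norm_sq_eq, Fin.sum_univ_three]; simp
  rw [mdot, Fin.sum_univ_succ, Fin.sum_univ_three]
  simp only [pt_succ, sgn, Fin.succ_ne_zero, if_true, if_false]
  nlinarith

lemma continuous_pt : Continuous pt := by
  refine continuous_pi fun a => ?_
  refine Fin.cases ?_ (fun i => ?_) a
  · simp only [pt_zero]; fun_prop
  · simp only [pt_succ]; fun_prop

namespace DiracMatrices

variable (D : DiracMatrices)

lemma γ_zero_sq : D.γ 0 * D.γ 0 = 1 := by
  have h := D.clifford 0 0
  simp only [sgn, if_true] at h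
  have h2 : (2 : ℂ) • (D.γ 0 * D.γ 0) = (2 : ℂ) • 1 := by
    rw [two_smul, h]; simp
  exact smul_right_injective _ (two_ne_zero) h2

lemma slash_sq (v : Mink) : D.slash v * D.slash v = (mdot v v : ℂ) • 1 := by
  have h1 : D.slash v * D.slash v
      = ∑ a, ∑ b, ((sgn a * v a : ℝ) * (sgn b * v b : ℝ) : ℂ) • (D.γ a * D.γ b) := by
    simp only [slash, Finset.sum_mul_sum, smul_mul_smul_comm]
  have h2 : D.slash v * D.slash v
      = ∑ a, ∑ b, ((sgn a * v a : ℝ) * (sgn b * v b : ℝ) : ℂ) • (D.γ b * D.γ a) := by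
    rw [h1, Finset.sum_comm]
    refine Finset.sum_congr rfl fun a _ => Finset.sum_congr rfl fun b _ => ?_
    rw [mul_comm (((sgn b * v b : ℝ)) : ℂ)]
  have h3 : (2 : ℂ) • (D.slash v * D.slash v) = (2 : ℂ) • ((mdot v v : ℂ) • 1) := by
    rw [two_smul]
    nth_rewrite 1 [h1]
    rw [h2]
    simp only [← Finset.sum_add_distrib, ← smul_add, D.clifford, smul_smul, ← Finset.sum_smul]
    congr 1
    rw [mdot]
    push_cast
    rw [Finset.mul_sum]
    refine Finset.sum_congr rfl fun a _ => ?_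
    rw [Finset.sum_eq_single a]
    · have : (sgn a : ℂ) * sgn a = 1 := by
        unfold sgn; split_ifs <;> simp
      rw [if_pos rfl]
      linear_combination (2 * sgn a * v a * v a : ℂ) * this
    · intro b _ hb
      simp [Ne.symm hb]
    · simp
  exact smul_right_injective _ (two_ne_zero) h3

lemma slash_γ_zero (v : Mink) :
    D.slash v * D.γ 0 = (2 * v 0 : ℂ) • 1 - D.γ 0 * D.slash v := by
  rw [eq_sub_iff_add_eq]
  simp only [slash, Finset.sum_mul, Finset.mul_sum, smul_mul_assoc, mul_smul_comm,
    ← Finset.sum_add_distrib, ← smul_add, D.clifford, smul_smul, ← Finset.sum_smul]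
  congr 1
  rw [Finset.sum_eq_single 0]
  · simp [sgn]; ring
  · intro b _ hb
    simp [hb]
  · simp

lemma slash_conjTranspose (v : Mink) : (D.slash v)ᴴ = D.γ 0 * D.slash v * D.γ 0 := by
  simp only [slash, Matrix.conjTranspose_sum, Matrix.conjTranspose_smul, D.herm, Finset.sum_mul,
    Finset.mul_sum, smul_mul_assoc, mul_smul_comm]
  simp

/-- The matrix `γ⁰ γ·z` of the density. -/
def wt (x : E3) : Matrix (Fin 4) (Fin 4) ℂ := D.γ 0 * D.slash (pt x)

lemma wt_conjTranspose (x : E3) : (D.wt x)ᴴ = D.wt x := by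
  have h := D.γ_zero_sq
  rw [wt, Matrix.conjTranspose_mul, slash_conjTranspose, D.herm 0, h, one_mul, mul_assoc, h,
    mul_one]

lemma wt_sq (x : E3) : D.wt x * D.wt x = (2 * pt x 0 : ℂ) • D.wt x - 1 := by
  have h1 := D.slash_γ_zero (pt x)
  have h2 := D.slash_sq (pt x)
  rw [mdot_pt] at h2
  calc D.wt x * D.wt x = D.γ 0 * (D.slash (pt x) * D.γ 0) * D.slash (pt x) := by
        simp only [wt, mul_assoc]
    _ = _ := by
        rw [h1, mul_sub, sub_mul, ← mul_assoc (D.γ 0) (D.γ 0), D.γ_zero_sq, one_mul, h2, wt]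
        simp

/-- The positive square root of `γ⁰ γ·z`. -/
def wtSqrt (x : E3) : Matrix (Fin 4) (Fin 4) ℂ :=
  ((1 / Real.sqrt (2 * (1 + pt x 0)) : ℝ) : ℂ) • (1 + D.wt x)

lemma wtSqrt_conjTranspose (x : E3) : (D.wtSqrt x)ᴴ = D.wtSqrt x := by
  rw [wtSqrt, Matrix.conjTranspose_smul, Matrix.conjTranspose_add, wt_conjTranspose,
    Matrix.conjTranspose_one]
  simp

lemma wtSqrt_mul_self (x : E3) : D.wtSqrt x * D.wtSqrt x = D.wt x := by
  have hp := pt_zero_pos x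
  have hs : (1 / Real.sqrt (2 * (1 + pt x 0))) * (1 / Real.sqrt (2 * (1 + pt x 0)))
      = 1 / (2 * (1 + pt x 0)) := by
    rw [div_mul_div_comm, Real.mul_self_sqrt (by positivity), one_mul]
  have h1 : (1 + D.wt x) * (1 + D.wt x) = (2 * (1 + pt x 0) : ℂ) • D.wt x := by
    simp only [add_mul, mul_add, wt_sq, one_mul, mul_one, add_smul, two_smul, mul_smul]
    abel
  rw [wtSqrt, smul_mul_smul_comm, h1, ← Complex.ofReal_mul, hs, smul_smul]
  have : (((1 / (2 * (1 + pt x 0)) : ℝ) : ℂ)) * (2 * (1 + pt x 0) : ℂ) = 1 := by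
    rw [← Complex.ofReal_one, ← Complex.ofReal_add, ← Complex.ofReal_ofNat, ← Complex.ofReal_mul,
      ← Complex.ofReal_mul]
    congr 1
    field_simp
  rw [this, one_smul]

/-- The inverse of `wtSqrt`. -/
def wtSqrtInv (x : E3) : Matrix (Fin 4) (Fin 4) ℂ :=
  ((2 * pt x 0 : ℂ) • 1 - D.wt x) * D.wtSqrt x

lemma wtSqrtInv_mul (x : E3) : D.wtSqrtInv x * D.wtSqrt x = 1 := by
  rw [wtSqrtInv, mul_assoc, wtSqrt_mul_self, sub_mul, wt_sq]
  simp

lemma mul_wtSqrtInv (x : E3) : D.wtSqrt x * D.wtSqrtInv x = 1 :=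
  mul_eq_one_comm.mp (D.wtSqrtInv_mul x)

lemma continuous_wt : Continuous D.wt := by
  have h : Continuous fun x => D.slash (pt x) := by
    unfold slash
    refine continuous_finsetSum _ fun a _ => ?_
    have := (continuous_apply a).comp continuous_pt
    exact (Complex.continuous_ofReal.comp (continuous_const.mul this)).smul continuous_const
  exact continuous_const.mul h

lemma continuous_wtSqrt : Continuous D.wtSqrt := by
  have h0 : Continuous fun x => pt x 0 := (continuous_apply 0).comp continuous_pt
  have h1 : Continuous fun x => 1 / Real.sqrt (2 * (1 + pt x 0)) := by
    refine continuous_const.div (by fun_prop) fun x => ?_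
    have := pt_zero_pos x
    positivity
  exact (Complex.continuous_ofReal.comp h1).smul (continuous_const.add D.continuous_wt)

lemma continuous_wtSqrtInv : Continuous D.wtSqrtInv := by
  have h0 : Continuous fun x => pt x 0 := (continuous_apply 0).comp continuous_pt
  have h1 : Continuous fun x => ((2 * pt x 0 : ℂ) • 1 : Matrix (Fin 4) (Fin 4) ℂ) :=
    (continuous_const.mul (Complex.continuous_ofReal.comp h0)).smul continuous_const
  exact (h1.sub D.continuous_wt).mul D.continuous_wtSqrt

/-- Pointwise passage from `f` to `(γ⁰ γ·z)^{1/2} f`, which turns the density into the standard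
hermitian product of `ℂ⁴`. -/
def flat (f : E3 → Spinor) (x : E3) : EuclideanSpace ℂ (Fin 4) :=
  WithLp.toLp 2 (D.wtSqrt x *ᵥ f x)

lemma density_eq_inner (g f : E3 → Spinor) (x : E3) :
    D.density x (g x) (f x) = inner ℂ (D.flat g x) (D.flat f x) := by
  have h : D.γ 0 * D.slash (pt x) = (D.wtSqrt x)ᴴ * D.wtSqrt x := by
    rw [wtSqrt_conjTranspose, wtSqrt_mul_self, wt]
  rw [density, h, flat, flat, EuclideanSpace.inner_toLp_toLp, ← Matrix.mulVec_mulVec,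
    Matrix.dotProduct_mulVec, ← Matrix.star_mulVec, dotProduct_comm]

lemma density_self (f : E3 → Spinor) (x : E3) :
    D.density x (f x) (f x) = ((‖D.flat f x‖ ^ 2 : ℝ) : ℂ) := by
  rw [density_eq_inner, inner_self_eq_norm_sq_to_K]; simp

lemma flat_add (f g : E3 → Spinor) : D.flat (f + g) = D.flat f + D.flat g := by
  ext1 x; simp [flat, Matrix.mulVec_add]

lemma flat_smul (c : ℂ) (f : E3 → Spinor) : D.flat (c • f) = c • D.flat f := by
  ext1 x; simp [flat, Matrix.mulVec_smul]

lemma flat_congr {f g : E3 → Spinor} (h : f =ᵐ[hypMeasure] g) :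
    D.flat f =ᵐ[hypMeasure] D.flat g := by
  filter_upwards [h] with x hx
  simp [flat, hx]

lemma aestronglyMeasurable_flat {f : E3 → Spinor} (hf : AEStronglyMeasurable f hypMeasure) :
    AEStronglyMeasurable (D.flat f) hypMeasure := by
  have hc : Continuous fun p : Matrix (Fin 4) (Fin 4) ℂ × Spinor =>
      (WithLp.toLp 2 (p.1 *ᵥ p.2) : EuclideanSpace ℂ (Fin 4)) :=
    (PiLp.continuous_toLp 2 _).comp (continuous_fst.matrix_mulVec continuous_snd)
  have : TopologicalSpace.PseudoMetrizableSpace (Matrix (Fin 4) (Fin 4) ℂ) :=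
    inferInstanceAs (TopologicalSpace.PseudoMetrizableSpace (Fin 4 → Fin 4 → ℂ))
  exact Continuous.comp_aestronglyMeasurable₂
    (g := fun (A : Matrix (Fin 4) (Fin 4) ℂ) (v : Spinor) =>
      (WithLp.toLp 2 (A *ᵥ v) : EuclideanSpace ℂ (Fin 4))) hc
    D.continuous_wtSqrt.aestronglyMeasurable hf

lemma integrable_density_iff {f : E3 → Spinor} (hf : AEStronglyMeasurable f hypMeasure) :
    Integrable (fun x => D.density x (f x) (f x)) hypMeasure ↔
      MemLp (D.flat f) 2 hypMeasure := by
  rw [memLp_two_iff_integrable_sq_norm (D.aestronglyMeasurable_flat hf)]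
  simp only [density_self]
  constructor
  · intro h; exact h.re
  · intro h; exact h.ofReal

/-! ### The Hilbert space -/

/-- The classes (modulo equality almost everywhere) of measurable `ℂ⁴`-valued functions on the
hyperboloid for which `∫ f̄ (γ·z) f dμ(z)` is finite. -/
def sqIntegrable : Submodule ℂ (E3 →ₘ[hypMeasure] Spinor) where
  carrier := {f | Integrable (fun x => D.density x (f x) (f x)) hypMeasure}
  zero_mem' := by
    refine (D.integrable_density_iff (AEEqFun.aestronglyMeasurable _)).2 ?_
    refine MemLp.ae_eq (f := 0) ?_ MemLp.zero
    filter_upwards [AEEqFun.coeFn_zero (μ := hypMeasure) (α := E3) (β := Spinor)] with x hx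
    simp [flat, hx]
  add_mem' := by
    intro f g hf hg
    have hf := (D.integrable_density_iff (AEEqFun.aestronglyMeasurable _)).1 hf
    have hg := (D.integrable_density_iff (AEEqFun.aestronglyMeasurable _)).1 hg
    refine (D.integrable_density_iff (AEEqFun.aestronglyMeasurable _)).2 ?_
    refine MemLp.ae_eq ?_ (hf.add hg)
    rw [← flat_add]
    exact D.flat_congr (AEEqFun.coeFn_add f g).symm
  smul_mem' := by
    intro c f hf
    have hf := (D.integrable_density_iff (AEEqFun.aestronglyMeasurable _)).1 hf
    refine (D.integrable_density_iff (AEEqFun.aestronglyMeasurable _)).2 ?_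
    refine MemLp.ae_eq ?_ (hf.const_smul c)
    rw [← flat_smul]
    exact D.flat_congr (AEEqFun.coeFn_smul c f).symm

/-- The Hilbert space of the Dirac field on the unit hyperboloid. -/
def Hil : Type := D.sqIntegrable

instance : AddCommGroup D.Hil := inferInstanceAs (AddCommGroup D.sqIntegrable)

instance : Module ℂ D.Hil := inferInstanceAs (Module ℂ D.sqIntegrable)

variable {D}

/-- The class of functions underlying an element of the Hilbert space. -/
def Hil.fn (f : D.Hil) : E3 →ₘ[hypMeasure] Spinor := f.1

lemma Hil.memLp (f : D.Hil) : MemLp (D.flat f.fn) 2 hypMeasure :=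
  (D.integrable_density_iff (AEEqFun.aestronglyMeasurable _)).1 f.2

lemma Hil.fn_add (f g : D.Hil) : (f + g).fn =ᵐ[hypMeasure] f.fn + g.fn :=
  AEEqFun.coeFn_add f.fn g.fn

lemma Hil.fn_smul (c : ℂ) (f : D.Hil) : (c • f).fn =ᵐ[hypMeasure] c • f.fn :=
  AEEqFun.coeFn_smul c f.fn

lemma Hil.integrable_density (g f : D.Hil) :
    Integrable (fun x => D.density x (g.fn x) (f.fn x)) hypMeasure := by
  refine (L2.integrable_inner (𝕜 := ℂ) g.memLp.toLp f.memLp.toLp).congr ?_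
  filter_upwards [g.memLp.coeFn_toLp, f.memLp.coeFn_toLp] with x h1 h2
  rw [h1, h2, density_eq_inner]

/-- The scalar product `(g, f) = ∫ ḡ(z) (γ·z) f(z) dμ(z)`. -/
instance : Inner ℂ D.Hil where
  inner g f := ∫ x, D.density x (g.fn x) (f.fn x) ∂hypMeasure

lemma Hil.inner_def (g f : D.Hil) :
    inner ℂ g f = ∫ x, D.density x (g.fn x) (f.fn x) ∂hypMeasure := rfl

variable (D)

/-- The map `f ↦ (γ⁰ γ·z)^{1/2} f` into the standard `L²` space. -/
def Hil.toL2 : D.Hil →ₗ[ℂ] Lp (EuclideanSpace ℂ (Fin 4)) 2 hypMeasure where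
  toFun f := f.memLp.toLp
  map_add' f g := by
    rw [← MemLp.toLp_add]
    refine MemLp.toLp_congr _ _ ?_
    rw [← flat_add]
    exact D.flat_congr (Hil.fn_add f g)
  map_smul' c f := by
    rw [RingHom.id_apply, ← MemLp.toLp_const_smul]
    refine MemLp.toLp_congr _ _ ?_
    rw [← flat_smul]
    exact D.flat_congr (Hil.fn_smul c f)

lemma Hil.inner_toL2 (g f : D.Hil) : inner ℂ (Hil.toL2 D g) (Hil.toL2 D f) = inner ℂ g f := by
  rw [L2.inner_def, Hil.inner_def]
  refine integral_congr_ae ?_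
  filter_upwards [g.memLp.coeFn_toLp, f.memLp.coeFn_toLp] with x h1 h2
  rw [density_eq_inner, ← h1, ← h2]; rfl

lemma flat_inv {h : E3 → EuclideanSpace ℂ (Fin 4)} :
    D.flat (fun x => D.wtSqrtInv x *ᵥ WithLp.ofLp (h x)) = h := by
  ext1 x
  simp [flat, mul_wtSqrtInv]

lemma Hil.toL2_bijective : Function.Bijective (Hil.toL2 D) := by
  constructor
  · intro f g hfg
    have h1 : D.flat f.fn =ᵐ[hypMeasure] D.flat g.fn :=
      (f.memLp.coeFn_toLp.symm.trans (by rw [show f.memLp.toLp = g.memLp.toLp from hfg])).trans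
        g.memLp.coeFn_toLp
    refine Subtype.ext (AEEqFun.ext ?_)
    change f.fn =ᵐ[hypMeasure] g.fn
    filter_upwards [h1] with x hx
    have h2 := congrArg (fun v => D.wtSqrtInv x *ᵥ WithLp.ofLp v) hx
    simpa [flat, wtSqrtInv_mul] using h2
  · intro h
    have hc : Continuous fun p : Matrix (Fin 4) (Fin 4) ℂ × EuclideanSpace ℂ (Fin 4) =>
        (p.1 *ᵥ WithLp.ofLp p.2 : Spinor) :=
      continuous_fst.matrix_mulVec ((PiLp.continuous_ofLp 2 _).comp continuous_snd)
    have : TopologicalSpace.PseudoMetrizableSpace (Matrix (Fin 4) (Fin 4) ℂ) :=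
      inferInstanceAs (TopologicalSpace.PseudoMetrizableSpace (Fin 4 → Fin 4 → ℂ))
    have hm : AEStronglyMeasurable (fun x => D.wtSqrtInv x *ᵥ WithLp.ofLp (h x)) hypMeasure :=
      Continuous.comp_aestronglyMeasurable₂
        (g := fun (A : Matrix (Fin 4) (Fin 4) ℂ) (v : EuclideanSpace ℂ (Fin 4)) =>
          (A *ᵥ WithLp.ofLp v : Spinor)) hc
        D.continuous_wtSqrtInv.aestronglyMeasurable (Lp.aestronglyMeasurable h)
    have hf : D.flat (AEEqFun.mk _ hm) =ᵐ[hypMeasure] h := by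
      refine (D.flat_congr (AEEqFun.coeFn_mk _ hm)).trans ?_
      rw [flat_inv]
    have hL : MemLp (D.flat (AEEqFun.mk _ hm)) 2 hypMeasure := (Lp.memLp h).ae_eq hf.symm
    refine ⟨⟨AEEqFun.mk _ hm,
      (D.integrable_density_iff (AEEqFun.aestronglyMeasurable _)).2 hL⟩, ?_⟩
    refine Lp.ext ?_
    exact (MemLp.coeFn_toLp hL).trans hf

/-- The scalar product of `Hil` satisfies the axioms. -/
@[reducible] def Hil.core : InnerProductSpace.Core ℂ D.Hil where
  conj_inner_symm f g := by
    rw [← Hil.inner_toL2, ← Hil.inner_toL2]; exact inner_conj_symm _ _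
  re_inner_nonneg f := by
    rw [← Hil.inner_toL2]; exact inner_self_nonneg
  add_left f g h := by
    simp only [← Hil.inner_toL2, map_add, inner_add_left]
  smul_left f g c := by
    simp only [← Hil.inner_toL2, map_smul, inner_smul_left]
  definite f hf := by
    rw [← Hil.inner_toL2, inner_self_eq_zero] at hf
    exact (Hil.toL2_bijective D).1 (hf.trans (map_zero _).symm)

instance : NormedAddCommGroup D.Hil :=
  @InnerProductSpace.Core.toNormedAddCommGroup ℂ D.Hil _ _ _ (Hil.core D)

instance : InnerProductSpace ℂ D.Hil := InnerProductSpace.ofCore (Hil.core D).toCore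

instance : CompleteSpace D.Hil := by
  let e : D.Hil ≃ₗ[ℂ] Lp (EuclideanSpace ℂ (Fin 4)) 2 hypMeasure :=
    LinearEquiv.ofBijective (Hil.toL2 D) (Hil.toL2_bijective D)
  let e' : D.Hil ≃ₗᵢ[ℂ] Lp (EuclideanSpace ℂ (Fin 4)) 2 hypMeasure :=
    e.isometryOfInner (Hil.inner_toL2 D)
  exact e'.toIsometryEquiv.completeSpace_iff.2 inferInstance

end DiracMatrices

/-! ### Test functions -/

/-- `C₀^∞`: smooth compactly supported functions on the hyperboloid, in the coordinates `x`. -/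
def TestFun : Submodule ℂ (E3 → Spinor) where
  carrier := {f | ContDiff ℝ ∞ f ∧ HasCompactSupport f}
  zero_mem' := ⟨contDiff_const, HasCompactSupport.zero⟩
  add_mem' hf hg := ⟨hf.1.add hg.1, hf.2.add hg.2⟩
  smul_mem' c _ hf := ⟨hf.1.const_smul c, hf.2.smul_left (f := fun _ => c)⟩

/-- The entry `h_a{}^b = δ_a^b - z_a z^b` of the projection onto the tangent space of the
hyperboloid at `z = pt x`. -/
def tangProj (x : E3) (a b : Fin 4) : ℝ := (if a = b then 1 else 0) - sgn a * pt x a * pt x b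

/-- The tangential derivative `δ_a`. It is the derivation on functions on the hyperboloid with
`δ_a z^b = h_a{}^b`; hence `δ_a f = ∑ⱼ h_a{}^j ∂f/∂xʲ` in the coordinates `xʲ = zʲ`, `j = 1, 2, 3`. -/
def tderiv (a : Fin 4) (f : E3 → Spinor) (x : E3) : Spinor :=
  fderiv ℝ f x (WithLp.toLp 2 fun j : Fin 3 => tangProj x a j.succ)

namespace DiracMatrices

variable (D : DiracMatrices)

/-- `γ_T^a = γ^a - z^a γ·z` (upper index). -/
def γT (x : E3) (a : Fin 4) : Matrix (Fin 4) (Fin 4) ℂ := D.γ a - (pt x a : ℂ) • D.slash (pt x)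

/-- `p_a = i (δ_a + ½ (γ·z) γ_{T a} - (3/2) z_a)`, with lower index `a`. -/
def pOp (a : Fin 4) (f : E3 → Spinor) (x : E3) : Spinor :=
  Complex.I • (tderiv a f x
    + (1 / 2 : ℂ) • ((D.slash (pt x) * ((sgn a : ℂ) • D.γT x a)) *ᵥ f x)
    - (3 / 2 * (sgn a * pt x a) : ℂ) • f x)

/-- The differential expression `H_κ f = Γ (-κ⁻¹ γ_T · p + 1) f`, where `Γ f(z) = (γ·z) f(z)`. -/
def hamFun (κ : ℝ) (f : E3 → Spinor) (x : E3) : Spinor :=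
  D.slash (pt x) *ᵥ (-((κ : ℂ)⁻¹ • ∑ a, D.γT x a *ᵥ D.pOp a f x) + f x)

end DiracMatrices

lemma contDiff_pt : ContDiff ℝ ∞ pt := by
  refine contDiff_pi.2 fun a => ?_
  refine Fin.cases ?_ (fun i => ?_) a
  · simp only [pt_zero]
    refine ContDiff.sqrt (contDiff_const.add (contDiff_norm_sq ℝ)) fun x => ?_
    positivity
  · simp only [pt_succ]
    fun_prop

lemma contDiff_tderiv (a : Fin 4) {f : E3 → Spinor} (hf : ContDiff ℝ ∞ f) :
    ContDiff ℝ ∞ (tderiv a f) := by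
  have hp := contDiff_pi.1 contDiff_pt
  have h1 : ContDiff ℝ ∞ (fderiv ℝ f) := hf.fderiv_right (by simp)
  refine h1.clm_apply ?_
  refine (PiLp.contDiff_toLp (p := 2)).comp (contDiff_pi.2 fun j => ?_)
  exact contDiff_const.sub ((contDiff_const.mul (hp a)).mul (hp _))

/-- Matrix times vector is smooth in both arguments, entry by entry. -/
lemma contDiff_mulVec {A : E3 → Matrix (Fin 4) (Fin 4) ℂ} {f : E3 → Spinor}
    (hA : ∀ i j, ContDiff ℝ ∞ fun x => A x i j) (hf : ContDiff ℝ ∞ f) :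
    ContDiff ℝ ∞ fun x => A x *ᵥ f x := by
  refine contDiff_pi.2 fun i => ?_
  simp only [Matrix.mulVec, dotProduct]
  exact ContDiff.sum fun j _ => (hA i j).mul (contDiff_pi.1 hf j)

namespace DiracMatrices

variable (D : DiracMatrices)

lemma contDiff_slash (i j : Fin 4) : ContDiff ℝ ∞ fun x => D.slash (pt x) i j := by
  have hp := contDiff_pi.1 contDiff_pt
  simp only [slash, Matrix.sum_apply, Matrix.smul_apply, smul_eq_mul]
  exact ContDiff.sum fun a _ =>
    (Complex.ofRealCLM.contDiff.comp (contDiff_const.mul (hp a))).mul contDiff_const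

lemma contDiff_γT (a i j : Fin 4) : ContDiff ℝ ∞ fun x => D.γT x a i j := by
  have hp := contDiff_pi.1 contDiff_pt
  simp only [γT, Matrix.sub_apply, Matrix.smul_apply, smul_eq_mul]
  exact contDiff_const.sub ((Complex.ofRealCLM.contDiff.comp (hp a)).mul (D.contDiff_slash i j))

lemma contDiff_pOp (a : Fin 4) {f : E3 → Spinor} (hf : ContDiff ℝ ∞ f) :
    ContDiff ℝ ∞ (D.pOp a f) := by
  have hp := contDiff_pi.1 contDiff_pt
  unfold pOp
  refine ContDiff.const_smul Complex.I (((contDiff_tderiv a hf).add (ContDiff.const_smul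
    (1 / 2 : ℂ) (contDiff_mulVec (fun i j => ?_) hf))).sub ?_)
  · simp only [Matrix.mul_apply, Matrix.smul_apply, smul_eq_mul]
    exact ContDiff.sum fun k _ =>
      (D.contDiff_slash i k).mul (contDiff_const.mul (D.contDiff_γT a k j))
  · have h : ContDiff ℝ ∞ fun x => (3 / 2 * (sgn a * pt x a) : ℂ) :=
      contDiff_const.mul (contDiff_const.mul (Complex.ofRealCLM.contDiff.comp (hp a)))
    exact contDiff_pi.2 fun i => h.mul (contDiff_pi.1 hf i)

lemma hamFun_mem (κ : ℝ) (f : TestFun) : D.hamFun κ f ∈ TestFun := by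
  obtain ⟨hf, hs⟩ := f.2
  constructor
  · refine contDiff_mulVec D.contDiff_slash (ContDiff.add (ContDiff.neg
      (ContDiff.const_smul (κ : ℂ)⁻¹ (ContDiff.sum fun a _ => ?_))) hf)
    exact contDiff_mulVec (D.contDiff_γT a) (D.contDiff_pOp a hf)
  · refine HasCompactSupport.intro hs fun x hx => ?_
    have h1 : (f : E3 → Spinor) x = 0 := image_eq_zero_of_notMem_tsupport hx
    have h2 : fderiv ℝ (f : E3 → Spinor) x = 0 :=
      image_eq_zero_of_notMem_tsupport fun h => hx (tsupport_fderiv_subset ℝ h)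
    simp [hamFun, pOp, tderiv, h1, h2]

/-- `H_κ` as an operator on `C₀^∞`. -/
def ham (κ : ℝ) (f : TestFun) : TestFun := ⟨D.hamFun κ f, D.hamFun_mem κ f⟩

lemma aestronglyMeasurable_test (f : TestFun) :
    AEStronglyMeasurable (f : E3 → Spinor) hypMeasure :=
  f.2.1.continuous.aestronglyMeasurable

lemma isFiniteMeasureOnCompacts_hypMeasure : IsFiniteMeasureOnCompacts hypMeasure := by
  have h0 : Continuous fun x : E3 => pt x 0 := (continuous_apply 0).comp continuous_pt
  have h1 : Continuous fun x : E3 => 1 / pt x 0 :=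
    continuous_const.div h0 fun x => (pt_zero_pos x).ne'
  have h2 : IsLocallyFiniteMeasure hypMeasure :=
    IsLocallyFiniteMeasure.withDensity_ofReal h1
  infer_instance

lemma memLp_flat_test (f : TestFun) : MemLp (D.flat f) 2 hypMeasure := by
  have := isFiniteMeasureOnCompacts_hypMeasure
  have hc : Continuous (D.flat f) :=
    (PiLp.continuous_toLp 2 _).comp
      (D.continuous_wtSqrt.matrix_mulVec f.2.1.continuous)
  refine hc.memLp_of_hasCompactSupport ?_
  refine HasCompactSupport.intro f.2.2 fun x hx => ?_
  simp [flat, image_eq_zero_of_notMem_tsupport hx]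

/-- The inclusion of `C₀^∞` into the Hilbert space. -/
def emb (f : TestFun) : D.Hil :=
  ⟨AEEqFun.mk f (aestronglyMeasurable_test f),
    (D.integrable_density_iff (AEEqFun.aestronglyMeasurable _)).2
      ((D.memLp_flat_test f).ae_eq (D.flat_congr (AEEqFun.coeFn_mk _ _).symm))⟩

/-! ### The transformations and the propagator -/

/-- The integral `(κ/2π)^{3/2} ∫ e^{-iκ u·z γ·z} (γ·z) f(z) dμ(z)` at `u = pt y`. -/
def fourier (κ : ℝ) (f : E3 → Spinor) (y : E3) : Spinor :=
  ((κ / (2 * Real.pi)) ^ (3 / 2 : ℝ) : ℝ) • ∫ x,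
    (NormedSpace.exp ((-Complex.I * κ * mdot (pt y) (pt x) : ℂ) • D.slash (pt x))
      * D.slash (pt x)) *ᵥ f x ∂hypMeasure

/-- The integral `(κ/2π)^{3/2} ∫ e^{+iκ u·z γ·u} (γ·z) f(z) dμ(z)` at `u = pt y`. -/
def fourierStar (κ : ℝ) (f : E3 → Spinor) (y : E3) : Spinor :=
  ((κ / (2 * Real.pi)) ^ (3 / 2 : ℝ) : ℝ) • ∫ x,
    (NormedSpace.exp ((Complex.I * κ * mdot (pt y) (pt x) : ℂ) • D.slash (pt y))
      * D.slash (pt x)) *ᵥ f x ∂hypMeasure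

/-- The bounded operator `T` extends the transformation `K` of functions from `C₀^∞` to the
Hilbert space. -/
def Extends (K : (E3 → Spinor) → E3 → Spinor) (T : D.Hil →L[ℂ] D.Hil) : Prop :=
  ∀ f : TestFun, (T (D.emb f)).fn =ᵐ[hypMeasure] K f

open Classical in
/-- The extension of `K` to a bounded operator on the Hilbert space (unique, since `C₀^∞` is
dense), and `0` if there is none. -/
def extension (K : (E3 → Spinor) → E3 → Spinor) : D.Hil →L[ℂ] D.Hil :=
  if h : ∃ T, D.Extends K T then h.choose else 0

/-- The operator `F_κ`. -/
def F (κ : ℝ) : D.Hil →L[ℂ] D.Hil := D.extension (D.fourier κ)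

/-- The operator `F_κ^*`. -/
def Fstar (κ : ℝ) : D.Hil →L[ℂ] D.Hil := D.extension (D.fourierStar κ)

/-- The operator `U₀(l₂, l₁) = F_{m l₂} F_{m l₁}^*`. -/
def U₀ (m l₂ l₁ : ℝ) : D.Hil →L[ℂ] D.Hil := D.F (m * l₂) ∘L D.Fstar (m * l₁)

/-- `ψ` is a smooth solution of the free Dirac equation `(i γᵃ ∂_a - m) ψ = 0` in the open forward
lightcone `x² > 0`, `x⁰ > 0`. -/
def IsDiracSolution (m : ℝ) (ψ : Mink → Spinor) : Prop :=
  ContDiffOn ℝ ∞ ψ {x | 0 < mdot x x ∧ 0 < x 0} ∧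
    ∀ x, 0 < mdot x x → 0 < x 0 →
      Complex.I • (∑ a, D.γ a *ᵥ fderiv ℝ ψ x (Pi.single a 1)) - (m : ℂ) • ψ x = 0

end DiracMatrices

end HypDirac

end

/-!
The transformation `F_κ` is, up to a constant, the restriction to the hyperboloid `x² = κ²` of a
solution of the Dirac equation of mass one: since `(γ·z)² = 1`, the kernel `e^{-i x·z γ·z} γ·z` is
`cos(x·z) γ·z - i sin(x·z)`, and `field g x = ∫ e^{-i x·z γ·z} γ·z g(z) dμ(z)` is a superposition of
plane waves that solves the equation on the whole of Minkowski space. This makes all claims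
consequences of four facts about solutions.

* *Conservation of the current* (`flux_plane_eq_flux_hyperboloid`). The surfaces `x⁰ = s √(1 + |x|²)`
  interpolate between the plane `x⁰ = 0` and the hyperboloid, and for test functions `g` the field
  decays rapidly between them by the method of non-stationary phase (`oscillatory_decay`). So the
  norm of `F_κ g` equals the norm of the initial values of the field, which is that of `g` by
  Plancherel's theorem (`integral_density_fourier`): `F_κ` is isometric.
* *Duality* (`integral_pairing_field`). By Fubini's theorem the integral `F_κ^* f` gives the adjoint
  of `F_κ` (`extends_Fstar`). The same duality with the plane `x⁰ = t` in place of the hyperboloid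
  produces, by Fourier inversion, a field with prescribed values on that plane (`field_planeDual`).
* *Finite speed of propagation* (`IsGlobalSolution.eq_zero_of_initial`), from the energy inequality
  for the current. By duality, the field with amplitude `F_κ^* f` vanishes at all points spacelike to
  the support of `f` (`field_fourierStar_eq_zero`). Hence `F_κ F_κ^*` does not enlarge supports. If
  `F_κ^* h = 0`, then also `F_κ^* (1_A h) = 0` for all open `A`, so `h` is orthogonal pointwise to all
  `F_κ f`, and, since the kernel is invertible, `h = 0` (`eq_zero_of_Fstar_eq_zero`). So `F_κ` is
  unitary. Locality also gives that `F_{κ₂} F_{κ₁}^* f` has compact support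
  (`hasCompactSupport_fourier_fourierStar`).
* *Integration by parts* on the hyperboloid (`waves_tangDirac`). It turns the `κ`-derivative of the
  integral `F_κ^* f` into `i F_κ^* H_κ f`, pointwise (`hasDerivAt_fourierStar`), hence in the weak
  sense against test functions.

Since `F_κ^*` is isometric, the weak derivative bounds the increments of `F_κ^* f`, so `F_κ^*` is
strongly continuous; then the weak derivative is strongly continuous as well and is a strong
derivative (`hasDerivAt_Fstar`). The derivatives of `U₀` follow by unitarity, and the solution `ψ` is
the field with amplitude `F_{m l₁}^* f`, rescaled to mass `m`.
-/

open FourierTransform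

namespace HypDirac

/-! ### Coordinates on Minkowski space -/

/-- The point of Minkowski space with time coordinate `t` and space coordinates `x`. -/
def event (t : ℝ) (x : E3) : Mink := Fin.cons t (fun i => x i)

lemma event_zero (t : ℝ) (x : E3) : event t x 0 = t := rfl

lemma event_succ (t : ℝ) (x : E3) (i : Fin 3) : event t x i.succ = x i := rfl

lemma pt_eq_event (x : E3) : pt x = event (pt x 0) x := rfl

lemma smul_event (c t : ℝ) (x : E3) : c • event t x = event (c * t) (c • x) := by
  ext a; refine Fin.cases rfl (fun i => rfl) a

lemma event_add (s t : ℝ) (x y : E3) : event s x + event t y = event (s + t) (x + y) := by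
  ext a; refine Fin.cases rfl (fun i => rfl) a

lemma neg_event (t : ℝ) (x : E3) : -event t x = event (-t) (-x) := by
  ext a; refine Fin.cases rfl (fun i => rfl) a

lemma mdot_event (s t : ℝ) (x y : E3) :
    mdot (event s x) (event t y) = s * t - inner ℝ x y := by
  rw [mdot, Fin.sum_univ_succ, Fin.sum_univ_three]
  simp only [event_zero, event_succ, sgn, Fin.succ_ne_zero, if_true, if_false,
    PiLp.inner_apply, Fin.sum_univ_three, RCLike.inner_apply, conj_trivial]
  ring

lemma mdot_event_pt (t : ℝ) (x z : E3) :
    mdot (event t x) (pt z) = t * pt z 0 - inner ℝ x z := by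
  rw [pt_eq_event z, mdot_event]; rfl

lemma mdot_comm (u v : Mink) : mdot u v = mdot v u := by
  simp only [mdot]; exact Finset.sum_congr rfl fun a _ => by ring

lemma mdot_smul_left (c : ℝ) (u v : Mink) : mdot (c • u) v = c * mdot u v := by
  simp only [mdot, Finset.mul_sum, Pi.smul_apply, smul_eq_mul]
  exact Finset.sum_congr rfl fun a _ => by ring

lemma mdot_neg_left (u v : Mink) : mdot (-u) v = -mdot u v := by
  rw [← neg_one_smul ℝ u, mdot_smul_left]; ring

lemma pt_zero_sq (x : E3) : pt x 0 ^ 2 = 1 + ‖x‖ ^ 2 := by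
  rw [pt_zero]; exact Real.sq_sqrt (by positivity)

lemma one_le_pt_zero (x : E3) : 1 ≤ pt x 0 := by
  have := pt_zero_sq x
  nlinarith [pt_zero_pos x, sq_nonneg ‖x‖]

lemma norm_lt_pt_zero (x : E3) : ‖x‖ < pt x 0 := by
  have := pt_zero_sq x
  nlinarith [pt_zero_pos x, norm_nonneg x]

lemma pt_zero_neg (x : E3) : pt (-x) 0 = pt x 0 := by
  simp [pt_zero]

lemma contDiff_pt_zero : ContDiff ℝ ∞ fun x : E3 => pt x 0 := contDiff_pi.1 contDiff_pt 0

lemma continuous_pt_zero : Continuous fun x : E3 => pt x 0 := contDiff_pt_zero.continuous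

lemma hasFDerivAt_pt_zero (x : E3) :
    HasFDerivAt (fun x : E3 => pt x 0) ((pt x 0)⁻¹ • innerSL ℝ x) x := by
  have h1 : HasFDerivAt (fun x : E3 => 1 + ‖x‖ ^ 2) (2 • innerSL ℝ x) x :=
    (hasStrictFDerivAt_norm_sq x).hasFDerivAt.const_add 1
  have h2 := h1.sqrt (by positivity)
  refine h2.congr_fderiv ?_
  rw [← pt_zero, ← Nat.cast_smul_eq_nsmul ℝ, smul_smul]
  congr 1
  have := pt_zero_pos x
  field_simp
  norm_num

/-! ### Exponentials of involutions -/

lemma exp_smul_of_sq_eq_one {Z : Matrix (Fin 4) (Fin 4) ℂ} (hZ : Z * Z = 1) (θ : ℝ) :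
    NormedSpace.exp ((Complex.I * θ : ℂ) • Z)
      = (Real.cos θ : ℂ) • 1 + (Complex.I * Real.sin θ : ℂ) • Z := by
  have hpow : ∀ n : ℕ, Z ^ n = (1 / 2 : ℂ) • (1 + Z) + ((-1) ^ n : ℂ) • (1 / 2 : ℂ) • (1 - Z) := by
    intro n
    induction n with
    | zero => rw [pow_zero, pow_zero]; module
    | succ n ih =>
      rw [pow_succ, ih, add_mul, smul_mul_assoc, smul_mul_assoc, smul_mul_assoc, add_mul, sub_mul,
        hZ, one_mul, pow_succ, mul_smul, neg_one_smul]
      congr 1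
      · rw [add_comm]
      · rw [← smul_neg, neg_sub]
  have hs : ∀ c : ℂ, HasSum (fun n : ℕ => (n.factorial : ℂ)⁻¹ * c ^ n) (Complex.exp c) := by
    intro c
    have := NormedSpace.expSeries_div_hasSum_exp (𝔸 := ℂ) c
    rw [← Complex.exp_eq_exp_ℂ] at this
    simpa [div_eq_inv_mul] using this
  have h1 : HasSum (fun n : ℕ => ((n.factorial : ℂ)⁻¹ • ((Complex.I * θ : ℂ) • Z) ^ n))
      (Complex.exp (Complex.I * θ) • (1 / 2 : ℂ) • (1 + Z)
        + Complex.exp (-(Complex.I * θ)) • (1 / 2 : ℂ) • (1 - Z)) := by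
    refine (((hs (Complex.I * θ)).smul_const _).add ((hs (-(Complex.I * θ))).smul_const _)).congr_fun
      (fun n => ?_)
    rw [smul_pow, hpow, neg_pow (Complex.I * θ : ℂ)]
    module
  rw [NormedSpace.exp_eq_tsum ℂ]
  change (∑' n : ℕ, ((n.factorial : ℂ)⁻¹ • ((Complex.I * θ : ℂ) • Z) ^ n)) = _
  rw [h1.tsum_eq]
  have hc : Complex.exp (Complex.I * θ) = Real.cos θ + Complex.I * Real.sin θ := by
    rw [mul_comm, Complex.exp_mul_I, mul_comm]; push_cast; ring
  have hc' : Complex.exp (-(Complex.I * θ)) = Real.cos θ - Complex.I * Real.sin θ := by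
    rw [← mul_neg, mul_comm, Complex.exp_mul_I, Complex.cos_neg, Complex.sin_neg]
    push_cast; ring
  rw [hc, hc']
  module

/-! ### Non-stationary phase -/

/-- The phase `σ z⁰ - e · z` at the frequency `w = (σ, e)`. -/
noncomputable def phase (w : ℝ × E3) (z : E3) : ℝ := w.1 * pt z 0 - inner ℝ w.2 z

/-- The derivative of the phase in the direction of the spatial frequency. -/
noncomputable def phaseDeriv (w : ℝ × E3) (z : E3) : ℝ :=
  w.1 * (inner ℝ z w.2 / pt z 0) - ‖w.2‖ ^ 2

lemma hasFDerivAt_phase (w : ℝ × E3) (z : E3) :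
    HasFDerivAt (phase w) (w.1 • (pt z 0)⁻¹ • innerSL ℝ z - innerSL ℝ w.2) z :=
  ((hasFDerivAt_pt_zero z).const_mul w.1).sub (innerSL ℝ w.2).hasFDerivAt

lemma fderiv_phase_apply (w : ℝ × E3) (z : E3) : fderiv ℝ (phase w) z w.2 = phaseDeriv w z := by
  rw [(hasFDerivAt_phase w z).fderiv]
  simp [phaseDeriv, div_eq_inv_mul]

lemma contDiff_phaseDeriv : ContDiff ℝ ∞ fun p : (ℝ × E3) × E3 => phaseDeriv p.1 p.2 := by
  unfold phaseDeriv
  refine ContDiff.sub (contDiff_fst.fst.mul (ContDiff.div (contDiff_snd.inner ℝ contDiff_fst.snd)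
    (contDiff_pt_zero.comp contDiff_snd) fun p => (pt_zero_pos _).ne')) ?_
  exact contDiff_fst.snd.norm_sq ℝ

lemma hasFDerivAt_cexp_phase (r : ℝ) (w : ℝ × E3) (z : E3) :
    HasFDerivAt (fun z => Complex.exp (Complex.I * (r * phase w z : ℝ)))
      ((Complex.exp (Complex.I * (r * phase w z : ℝ)) * Complex.I * r) •
        Complex.ofRealCLM.comp (fderiv ℝ (phase w) z)) z := by
  have h := (hasFDerivAt_phase w z).differentiableAt.hasFDerivAt
  have h2 := Complex.ofRealCLM.hasFDerivAt.comp z (h.const_mul r)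
  have h3 := (h2.const_mul Complex.I).cexp
  refine (h3.congr_fderiv ?_)
  ext v
  simp
  ring

variable {E : Type*} [NormedAddCommGroup E] [NormedSpace ℂ E]

lemma norm_cexp_I_mul (θ : ℝ) : ‖Complex.exp (Complex.I * (θ : ℂ))‖ = 1 := by
  rw [mul_comm]; exact Complex.norm_exp_ofReal_mul_I θ

/-- Repeated integration by parts: an oscillatory integral whose phase is not stationary on the
support of the amplitude decays faster than any power, uniformly on compact sets of frequencies `w`.
The amplitude `A` may depend on `w`, because each integration by parts produces such an amplitude. -/
lemma oscillatory_bound {K : Set E3} (hK : IsCompact K) {Ω : Set (ℝ × E3)}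
    (hΩ : IsCompact Ω) (hq : ∀ w ∈ Ω, ∀ z ∈ K, phaseDeriv w z ≠ 0) (N : ℕ) :
    ∀ A : (ℝ × E3) × E3 → E, (∀ w ∈ Ω, ∀ z, ContDiffAt ℝ ∞ A (w, z)) →
      (∀ w, ∀ z ∉ K, A (w, z) = 0) →
      ∃ C, ∀ w ∈ Ω, ∀ r : ℝ, 0 ≤ r →
        r ^ N * ‖∫ z, Complex.exp (Complex.I * (r * phase w z : ℝ)) • A (w, z)‖ ≤ C := by
  induction N with
  | zero =>
    intro A hA hA0
    have hcont : ContinuousOn A (Ω ×ˢ K) := fun p hp =>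
      ((hA p.1 hp.1 p.2).continuousAt).continuousWithinAt
    obtain ⟨M, hM⟩ := (hΩ.prod hK).exists_bound_of_continuousOn hcont
    refine ⟨M * volume.real K, fun w hw r _ => ?_⟩
    rw [pow_zero, one_mul]
    have h1 : (∫ z, Complex.exp (Complex.I * (r * phase w z : ℝ)) • A (w, z))
        = ∫ z in K, Complex.exp (Complex.I * (r * phase w z : ℝ)) • A (w, z) := by
      refine (setIntegral_eq_integral_of_forall_compl_eq_zero fun z hz => ?_).symm
      rw [hA0 w z hz, smul_zero]
    rw [h1]
    refine norm_setIntegral_le_of_norm_le_const hK.measure_lt_top fun z hz => ?_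
    rw [norm_smul, norm_cexp_I_mul, one_mul]
    exact hM (w, z) ⟨hw, hz⟩
  | succ N ih =>
    intro A hA hA0
    -- with `q` the derivative of the phase `φ` along `w.2`, `e^{irφ} A = (ir)⁻¹ ∂(e^{irφ}) (A / q)`
    set B : (ℝ × E3) × E3 → E := fun p => (phaseDeriv p.1 p.2)⁻¹ • A p with hB
    have hB0 : ∀ w, ∀ z ∉ K, B (w, z) = 0 := fun w z hz => by simp [hB, hA0 w z hz]
    have hBz : ∀ w, ∀ z ∉ K, B =ᶠ[nhds (w, z)] fun _ => 0 := by
      intro w z hz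
      have : ∀ᶠ p : (ℝ × E3) × E3 in nhds (w, z), p.2 ∈ Kᶜ :=
        continuousAt_snd.eventually (hK.isClosed.isOpen_compl.mem_nhds hz)
      filter_upwards [this] with p hp using hB0 p.1 p.2 hp
    have hBs : ∀ w ∈ Ω, ∀ z, ContDiffAt ℝ ∞ B (w, z) := by
      intro w hw z
      by_cases hz : z ∈ K
      · exact (contDiff_phaseDeriv.contDiffAt.inv (hq w hw z hz)).smul (hA w hw z)
      · exact contDiffAt_const.congr_of_eventuallyEq (hBz w z hz)
    obtain ⟨C, hC⟩ := ih (fun p => fderiv ℝ B p ((0 : ℝ × E3), p.1.2)) (by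
      intro w hw z
      have h1 : ContDiffAt ℝ ∞ (fderiv ℝ B) (w, z) := (hBs w hw z).fderiv_right (by simp)
      exact h1.clm_apply (contDiffAt_const.prodMk contDiffAt_fst.snd)) (by
      intro w z hz
      rw [(hBz w z hz).fderiv_eq]; simp)
    refine ⟨C, fun w hw r hr => ?_⟩
    have key : r * ‖∫ z, Complex.exp (Complex.I * (r * phase w z : ℝ)) • A (w, z)‖
        = ‖∫ z, Complex.exp (Complex.I * (r * phase w z : ℝ)) •
            fderiv ℝ B (w, z) ((0 : ℝ × E3), w.2)‖ := by
      have hg : ∀ z, HasFDerivAt (fun z => B (w, z))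
          ((fderiv ℝ B (w, z)).comp (ContinuousLinearMap.inr ℝ (ℝ × E3) E3)) z := fun z =>
        HasFDerivAt.comp z (((hBs w hw z).differentiableAt (by simp)).hasFDerivAt)
          ((hasFDerivAt_const w z).prodMk (hasFDerivAt_id z))
      have hgc : Continuous fun z => B (w, z) :=
        continuous_iff_continuousAt.2 fun z => (hg z).continuousAt
      have hgs : HasCompactSupport fun z => B (w, z) :=
        HasCompactSupport.intro hK fun z hz => hB0 w z hz
      have hgd : (fun z => fderiv ℝ (fun z => B (w, z)) z w.2)
          = fun z => fderiv ℝ B (w, z) ((0 : ℝ × E3), w.2) := by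
        ext1 z; rw [(hg z).fderiv]; rfl
      have hgdc : Continuous fun z => fderiv ℝ B (w, z) ((0 : ℝ × E3), w.2) :=
        continuous_iff_continuousAt.2 fun z => by
          have h1 : ContDiffAt ℝ ∞ (fderiv ℝ B) (w, z) := (hBs w hw z).fderiv_right (by simp)
          exact (h1.continuousAt.comp (f := fun z : E3 => (w, z))
            (by fun_prop)).clm_apply continuousAt_const
      have hgds : HasCompactSupport fun z => fderiv ℝ B (w, z) ((0 : ℝ × E3), w.2) :=
        HasCompactSupport.intro hK fun z hz => by rw [(hBz w z hz).fderiv_eq]; simp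
      have hf := hasFDerivAt_cexp_phase r w
      have hfc : Continuous fun z => Complex.exp (Complex.I * (r * phase w z : ℝ)) :=
        continuous_iff_continuousAt.2 fun z => (hf z).continuousAt
      have hfd : ∀ z, fderiv ℝ (fun z => Complex.exp (Complex.I * (r * phase w z : ℝ))) z w.2
          • B (w, z)
          = (Complex.I * r) • (Complex.exp (Complex.I * (r * phase w z : ℝ)) • A (w, z)) := by
        intro z
        rw [(hf z).fderiv]
        by_cases hz : z ∈ K
        · have hne := hq w hw z hz
          simp only [smul_apply, ContinuousLinearMap.comp_apply,
            fderiv_phase_apply, hB, Complex.ofRealCLM_apply, smul_eq_mul]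
          rw [← Complex.coe_smul ((phaseDeriv w z)⁻¹), smul_smul, smul_smul]
          congr 1
          have : (phaseDeriv w z : ℂ) ≠ 0 := by exact_mod_cast hne
          push_cast
          field_simp
        · rw [hB0 w z hz, hA0 w z hz]; simp
      have hAc : Continuous fun z => A (w, z) :=
        continuous_iff_continuousAt.2 fun z =>
          (hA w hw z).continuousAt.comp (f := fun z : E3 => (w, z)) (by fun_prop)
      have hAs : HasCompactSupport fun z => A (w, z) := HasCompactSupport.intro hK (hA0 w)
      have ibp := integral_smul_fderiv_eq_neg_fderiv_smul_of_integrable (μ := volume)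
        (f := fun z => Complex.exp (Complex.I * (r * phase w z : ℝ))) (g := fun z => B (w, z))
        (v := w.2) (by
          simp only [hfd]
          exact ((hfc.smul hAc).integrable_of_hasCompactSupport hAs.smul_left).smul _) (by
          rw [show (fun z => Complex.exp (Complex.I * (r * phase w z : ℝ)) •
            fderiv ℝ (fun z => B (w, z)) z w.2) = fun z => _ • _ from
            funext fun z => congrArg _ (congrFun hgd z)]
          exact (hfc.smul hgdc).integrable_of_hasCompactSupport hgds.smul_left)
        ((hfc.smul hgc).integrable_of_hasCompactSupport hgs.smul_left)
        (fun z _ => (hf z).differentiableAt) (fun z _ => (hg z).differentiableAt)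
      simp only [hfd] at ibp
      rw [show (fun z => Complex.exp (Complex.I * (r * phase w z : ℝ)) •
            fderiv ℝ (fun z => B (w, z)) z w.2) = fun z => _ • _ from
            funext fun z => congrArg _ (congrFun hgd z)] at ibp
      rw [ibp, norm_neg, integral_smul, norm_smul]
      simp [abs_of_nonneg hr]
    calc r ^ (N + 1) * ‖∫ z, Complex.exp (Complex.I * (r * phase w z : ℝ)) • A (w, z)‖
        = r ^ N * (r * ‖∫ z, Complex.exp (Complex.I * (r * phase w z : ℝ)) • A (w, z)‖) := by ring
      _ ≤ C := by rw [key]; exact hC w hw r hr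

/-- The Fourier transform of a smooth density of compact support on the hyperboloid decays rapidly
outside the light cone and in a conical neighbourhood `|τ| ≤ β |k|` of it: the phase is not
stationary there, as the velocities on the support stay below the speed of light. -/
lemma oscillatory_decay {a : E3 → E} (ha : ContDiff ℝ ∞ a) (hc : HasCompactSupport a) :
    ∃ β : ℝ, 1 < β ∧ ∀ N : ℕ, ∃ C, ∀ (τ : ℝ) (k : E3), |τ| ≤ β * ‖k‖ →
      ‖k‖ ^ N * ‖∫ z, Complex.exp (Complex.I * (τ * pt z 0 - inner ℝ k z : ℝ)) • a z‖ ≤ C := by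
  set K := tsupport a
  have hK : IsCompact K := hc
  -- the velocities `|z| / z⁰` on the support stay below some `b < 1`
  obtain ⟨b, hb0, hb1, hb⟩ : ∃ b : ℝ, 0 < b ∧ b < 1 ∧ ∀ z ∈ K, ‖z‖ ≤ b * pt z 0 := by
    rcases K.eq_empty_or_nonempty with h | h
    · exact ⟨1 / 2, by norm_num, by norm_num, by simp [h]⟩
    · have hcont : Continuous fun z : E3 => ‖z‖ / pt z 0 :=
        continuous_norm.div continuous_pt_zero fun z => (pt_zero_pos z).ne'
      obtain ⟨z0, hz0, hmax⟩ := hK.exists_isMaxOn h hcont.continuousOn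
      have hv : ‖z0‖ / pt z0 0 < 1 := (div_lt_one (pt_zero_pos _)).2 (norm_lt_pt_zero z0)
      have hv0 : 0 ≤ ‖z0‖ / pt z0 0 := div_nonneg (norm_nonneg _) (pt_zero_pos _).le
      refine ⟨(‖z0‖ / pt z0 0 + 1) / 2, by linarith, by linarith, fun z hz => ?_⟩
      have h1 : ‖z‖ / pt z 0 ≤ (‖z0‖ / pt z0 0 + 1) / 2 := (hmax hz).trans (by linarith)
      exact (div_le_iff₀ (pt_zero_pos _)).1 h1
  -- any `β` strictly between `1` and `b⁻¹` will do
  obtain ⟨β, hβ1, hβ⟩ : ∃ β : ℝ, 1 < β ∧ β * b < 1 :=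
    ⟨(1 + b⁻¹) / 2, by have := (one_lt_inv₀ hb0).2 hb1; linarith, by
      have : b⁻¹ * b = 1 := inv_mul_cancel₀ hb0.ne'
      nlinarith⟩
  refine ⟨β, hβ1, fun N => ?_⟩
  set Ω : Set (ℝ × E3) := Icc (-β) β ×ˢ Metric.sphere 0 1
  have hq : ∀ w ∈ Ω, ∀ z ∈ K, phaseDeriv w z ≠ 0 := by
    intro w hw z hz
    have h1 : |w.1| * b < ‖w.2‖ := by
      have h1 : |w.1| ≤ β := abs_le.2 hw.1
      have h2 : ‖w.2‖ = 1 := by simpa using hw.2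
      rw [h2]
      nlinarith
    have h2 : |inner ℝ z w.2 / pt z 0| ≤ b * ‖w.2‖ := by
      rw [abs_div, abs_of_pos (pt_zero_pos z), div_le_iff₀ (pt_zero_pos z)]
      calc |inner ℝ z w.2| ≤ ‖z‖ * ‖w.2‖ := abs_real_inner_le_norm _ _
        _ ≤ (b * pt z 0) * ‖w.2‖ := by gcongr; exact hb z hz
        _ = _ := by ring
    have h3 : 0 < ‖w.2‖ := lt_of_le_of_lt (by positivity) h1
    have h4 : w.1 * (inner ℝ z w.2 / pt z 0) ≤ |w.1| * (b * ‖w.2‖) := by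
      refine (le_abs_self _).trans ?_
      rw [abs_mul]
      gcongr
    have : phaseDeriv w z < 0 := by
      unfold phaseDeriv
      nlinarith
    exact this.ne
  obtain ⟨C, hC⟩ := oscillatory_bound hK (isCompact_Icc.prod (isCompact_sphere 0 1)) hq N
    (fun p => a p.2) (fun w _ z => (ha.comp contDiff_snd).contDiffAt)
    (fun w z hz => image_eq_zero_of_notMem_tsupport hz)
  refine ⟨max C (0 ^ N * ‖∫ z, a z‖), fun τ k hk => ?_⟩
  by_cases hk0 : k = 0
  · refine le_trans (le_of_eq ?_) (le_max_right _ _)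
    have : τ = 0 := by simpa [hk0] using hk
    simp [hk0, this]
  · have hkpos : 0 < ‖k‖ := norm_pos_iff.2 hk0
    refine le_trans (le_of_eq ?_) ((hC (τ / ‖k‖, ‖k‖⁻¹ • k) ⟨?_, ?_⟩ ‖k‖ hkpos.le).trans
      (le_max_left _ _))
    · congr 3
      ext1 z
      congr 4
      simp only [phase, real_inner_smul_left]
      field_simp
    · refine abs_le.1 ?_
      rw [abs_div, abs_norm]
      exact (div_le_iff₀ hkpos).2 hk
    · simp [norm_smul, hkpos.ne']

/-! ### Superpositions of plane waves -/

section
variable {E : Type*} [NormedAddCommGroup E]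

lemma abs_pt_le (z : E3) (b : Fin 4) : |pt z b| ≤ pt z 0 := by
  refine Fin.cases ?_ (fun i => ?_) b
  · exact (abs_of_pos (pt_zero_pos z)).le
  · rw [pt_succ]
    exact (PiLp.norm_apply_le z i).trans (norm_lt_pt_zero z).le

lemma abs_sgn (b : Fin 4) : |sgn b| = 1 := by
  unfold sgn; split_ifs <;> simp

/-- Continuous functions on the hyperboloid that decay faster than any power of `z⁰`. -/
def RapidDecay (a : E3 → E) : Prop :=
  Continuous a ∧ ∀ N : ℕ, ∃ C, ∀ z, pt z 0 ^ N * ‖a z‖ ≤ C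

lemma integrable_inv_pt_zero_pow : Integrable fun z : E3 => (pt z 0 ^ 4)⁻¹ := by
  have h1 : Integrable fun z : E3 => (1 + ‖z‖) ^ (-(4 : ℝ)) :=
    integrable_one_add_norm (by simp; norm_num)
  refine (h1.const_mul 16).mono' ?_ (Filter.Eventually.of_forall fun z => ?_)
  · exact (continuous_pt_zero.pow 4).aestronglyMeasurable.inv₀
  · have h2 : 1 + ‖z‖ ≤ 2 * pt z 0 := by linarith [one_le_pt_zero z, norm_lt_pt_zero z]
    have h3 : (1 + ‖z‖) ^ 4 ≤ 16 * pt z 0 ^ 4 := by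
      calc (1 + ‖z‖) ^ 4 ≤ (2 * pt z 0) ^ 4 := by gcongr
        _ = _ := by ring
    rw [Real.norm_of_nonneg (by have := pt_zero_pos z; positivity), Real.rpow_neg (by positivity)]
    rw [show (4 : ℝ) = ((4 : ℕ) : ℝ) by norm_num, Real.rpow_natCast, ← div_eq_mul_inv,
      inv_eq_one_div, div_le_div_iff₀ (by have := pt_zero_pos z; positivity) (by positivity)]
    linarith

/-- Integrability from polynomial decay of order `4` in three dimensions. -/
lemma integrable_of_pow_four_mul_le {F : Type*} [NormedAddCommGroup F] {a : E3 → F}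
    (ha : AEStronglyMeasurable a volume) {C : ℝ} (hC : ∀ z, pt z 0 ^ 4 * ‖a z‖ ≤ C) :
    Integrable a := by
  refine (integrable_inv_pt_zero_pow.const_mul C).mono' ha (Filter.Eventually.of_forall fun z => ?_)
  have := pt_zero_pos z
  rw [← div_eq_mul_inv, le_div_iff₀ (by positivity), mul_comm]
  exact hC z

lemma RapidDecay.integrable {a : E3 → E} (ha : RapidDecay a) : Integrable a :=
  let ⟨_, hC⟩ := ha.2 4
  integrable_of_pow_four_mul_le ha.1.aestronglyMeasurable hC

lemma RapidDecay.of_norm_le {E' : Type*} [NormedAddCommGroup E']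
    {a : E3 → E} (ha : RapidDecay a) {b : E3 → E'} (hb : Continuous b) (C : ℝ) (M : ℕ)
    (h : ∀ z, ‖b z‖ ≤ C * pt z 0 ^ M * ‖a z‖) : RapidDecay b := by
  refine ⟨hb, fun N => ?_⟩
  obtain ⟨C', hC'⟩ := ha.2 (N + M)
  refine ⟨|C| * C', fun z => ?_⟩
  have := pt_zero_pos z
  calc pt z 0 ^ N * ‖b z‖ ≤ pt z 0 ^ N * (|C| * pt z 0 ^ M * ‖a z‖) := by
        gcongr
        refine (h z).trans ?_
        gcongr
        exact le_abs_self C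
    _ = |C| * (pt z 0 ^ (N + M) * ‖a z‖) := by ring
    _ ≤ |C| * C' := by gcongr; exact hC' z

lemma RapidDecay.add {a b : E3 → E} (ha : RapidDecay a) (hb : RapidDecay b) :
    RapidDecay fun z => a z + b z := by
  refine ⟨ha.1.add hb.1, fun N => ?_⟩
  obtain ⟨C, hC⟩ := ha.2 N
  obtain ⟨C', hC'⟩ := hb.2 N
  refine ⟨C + C', fun z => ?_⟩
  have := pt_zero_pos z
  calc pt z 0 ^ N * ‖a z + b z‖ ≤ pt z 0 ^ N * (‖a z‖ + ‖b z‖) := by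
        gcongr; exact norm_add_le _ _
    _ ≤ C + C' := by rw [mul_add]; exact add_le_add (hC z) (hC' z)

lemma RapidDecay.comp_neg {a : E3 → E} (ha : RapidDecay a) : RapidDecay fun z => a (-z) := by
  refine ⟨ha.1.comp continuous_neg, fun N => ?_⟩
  obtain ⟨C, hC⟩ := ha.2 N
  exact ⟨C, fun z => by simpa [pt_zero_neg] using hC (-z)⟩

variable [NormedSpace ℂ E]

lemma RapidDecay.smul {a : E3 → E} (ha : RapidDecay a) {c : E3 → ℂ} (hc : Continuous c) (C : ℝ)
    (M : ℕ) (h : ∀ z, ‖c z‖ ≤ C * pt z 0 ^ M) : RapidDecay fun z => c z • a z :=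
  ha.of_norm_le (hc.smul ha.1) C M fun z => by
    rw [norm_smul]; gcongr; exact h z

lemma RapidDecay.of_hasCompactSupport {a : E3 → E} (ha : Continuous a) (hc : HasCompactSupport a) :
    RapidDecay a := by
  refine ⟨ha, fun N => ?_⟩
  have h1 : Continuous fun z => pt z 0 ^ N • a z := (continuous_pt_zero.pow N).smul ha
  obtain ⟨C, hC⟩ := h1.bounded_above_of_compact_support hc.smul_left
  refine ⟨C, fun z => ?_⟩
  have := hC z
  rwa [norm_smul, Real.norm_of_nonneg (by have := pt_zero_pos z; positivity)] at this

/-- The superposition `∫ e^{i x·z} a(z) d³z` of plane waves with momenta on the hyperboloid. -/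
noncomputable def waves (a : E3 → E) (x : Mink) : E :=
  ∫ z, Complex.exp (Complex.I * (mdot x (pt z) : ℝ)) • a z

lemma continuous_mdot_pt (x : Mink) : Continuous fun z : E3 => mdot x (pt z) := by
  unfold mdot
  exact continuous_finsetSum _ fun a _ =>
    continuous_const.mul ((continuous_apply a).comp continuous_pt)

lemma continuous_wave (x : Mink) :
    Continuous fun z : E3 => Complex.exp (Complex.I * (mdot x (pt z) : ℝ)) := by
  have := continuous_mdot_pt x
  fun_prop

lemma waves_event (a : E3 → E) (t : ℝ) (x : E3) :
    waves a (event t x)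
      = ∫ z, Complex.exp (Complex.I * (t * pt z 0 - inner ℝ x z : ℝ)) • a z := by
  simp only [waves, mdot_event_pt]

lemma RapidDecay.wave_smul {a : E3 → E} (ha : RapidDecay a) (x : Mink) :
    RapidDecay fun z => Complex.exp (Complex.I * (mdot x (pt z) : ℝ)) • a z :=
  ha.smul (continuous_wave x) 1 0 fun z => by rw [norm_cexp_I_mul]; simp

/-- The amplitude of the derivative `∂_b` of a superposition of plane waves. -/
noncomputable def momentum (b : Fin 4) (a : E3 → E) (z : E3) : E :=
  (Complex.I * (sgn b * pt z b : ℝ) : ℂ) • a z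

lemma RapidDecay.momentum {a : E3 → E} (ha : RapidDecay a) (b : Fin 4) :
    RapidDecay (HypDirac.momentum b a) := by
  have hp : Continuous fun z => pt z b := (continuous_apply b).comp continuous_pt
  refine ha.smul (by fun_prop) 1 1 fun z => ?_
  simpa [abs_sgn] using abs_pt_le z b

variable [CompleteSpace E]

lemma RapidDecay.hasFDerivAt_waves {a : E3 → E} (ha : RapidDecay a) (x : Mink) :
    HasFDerivAt (waves a)
      (∑ b, (ContinuousLinearMap.proj (R := ℝ) b : Mink →L[ℝ] ℝ).smulRight
        (waves (HypDirac.momentum b a) x)) x := by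
  set F' : Mink → E3 → Mink →L[ℝ] E := fun x z =>
    ∑ b, (ContinuousLinearMap.proj (R := ℝ) b : Mink →L[ℝ] ℝ).smulRight
      (Complex.exp (Complex.I * (mdot x (pt z) : ℝ)) • HypDirac.momentum b a z) with hF'
  have hmd : ∀ b x, RapidDecay fun z =>
      Complex.exp (Complex.I * (mdot x (pt z) : ℝ)) • HypDirac.momentum b a z :=
    fun b x => (ha.momentum b).wave_smul x
  have hcont : ∀ x, Continuous (F' x) := fun x =>
    continuous_finsetSum _ fun b _ =>
      ((ContinuousLinearMap.smulRightL ℝ Mink E)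
        (ContinuousLinearMap.proj (R := ℝ) b : Mink →L[ℝ] ℝ)).continuous.comp (hmd b x).1
  have key := hasFDerivAt_integral_of_dominated_of_fderiv_le (μ := volume)
    (F := fun x z => Complex.exp (Complex.I * (mdot x (pt z) : ℝ)) • a z) (F' := F') (x₀ := x)
    (s := univ) (bound := fun z => ∑ b, ‖HypDirac.momentum b a z‖) Filter.univ_mem
    (Filter.Eventually.of_forall fun x => (ha.wave_smul x).1.aestronglyMeasurable)
    (ha.wave_smul x).integrable (hcont x).aestronglyMeasurable
    (Filter.Eventually.of_forall fun z x _ => by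
      refine (norm_sum_le _ _).trans (Finset.sum_le_sum fun b _ => ?_)
      rw [ContinuousLinearMap.norm_smulRight_apply, norm_smul, norm_cexp_I_mul, one_mul]
      refine mul_le_of_le_one_left (norm_nonneg _) ?_
      exact ContinuousLinearMap.opNorm_le_bound _ zero_le_one fun v => by
        rw [one_mul]; exact norm_le_pi_norm v b)
    (integrable_finsetSum _ fun b _ => (ha.momentum b).integrable.norm)
    (Filter.Eventually.of_forall fun z x _ => by
      have h1 : HasFDerivAt (fun x : Mink => mdot x (pt z))
          (∑ b, (sgn b * pt z b) • (ContinuousLinearMap.proj (R := ℝ) b : Mink →L[ℝ] ℝ)) x := by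
        have h0 : (fun x : Mink => mdot x (pt z)) = fun x =>
            (∑ b, (sgn b * pt z b) • (ContinuousLinearMap.proj (R := ℝ) b : Mink →L[ℝ] ℝ)) x := by
          ext1 x
          simp only [mdot, sum_apply, smul_apply,
            ContinuousLinearMap.proj_apply, smul_eq_mul]
          exact Finset.sum_congr rfl fun b _ => by ring
        rw [h0]
        exact ContinuousLinearMap.hasFDerivAt _
      have h2 := ((Complex.ofRealCLM.hasFDerivAt.comp x h1).const_mul Complex.I).cexp
      refine (h2.smul_const (a z)).congr_fderiv ?_
      ext v
      simp only [hF', HypDirac.momentum, ContinuousLinearMap.smulRight_apply,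
        sum_apply, smul_apply, ContinuousLinearMap.comp_apply,
        ContinuousLinearMap.proj_apply, Complex.ofRealCLM_apply, smul_eq_mul, Function.comp_def,
        Complex.ofReal_sum, Finset.mul_sum, Finset.sum_smul]
      refine Finset.sum_congr rfl fun b _ => ?_
      rw [← Complex.coe_smul, smul_smul, smul_smul]
      congr 1
      push_cast
      ring)
  refine key.congr_fderiv ?_
  rw [hF', integral_finsetSum _ fun b _ => ?_]
  · refine Finset.sum_congr rfl fun b _ => ?_
    exact ((ContinuousLinearMap.smulRightL ℝ Mink E)
      (ContinuousLinearMap.proj (R := ℝ) b : Mink →L[ℝ] ℝ)).integral_comp_comm (hmd b x).integrable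
  · exact ((ContinuousLinearMap.smulRightL ℝ Mink E)
      (ContinuousLinearMap.proj (R := ℝ) b : Mink →L[ℝ] ℝ)).integrable_comp (hmd b x).integrable

lemma RapidDecay.contDiff_waves {a : E3 → E} (ha : RapidDecay a) : ContDiff ℝ ∞ (waves a) := by
  refine contDiff_infty.2 fun n => ?_
  induction n generalizing a with
  | zero =>
    exact contDiff_zero.2 (continuous_iff_continuousAt.2 fun x => (ha.hasFDerivAt_waves x).continuousAt)
  | succ n ih =>
    push_cast
    refine contDiff_succ_iff_fderiv.2 ⟨fun x => (ha.hasFDerivAt_waves x).differentiableAt,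
      fun h => absurd h (WithTop.coe_ne_top (a := (n : ℕ∞))), ?_⟩
    rw [show fderiv ℝ (waves a) = fun x => _ from funext fun x => (ha.hasFDerivAt_waves x).fderiv]
    exact ContDiff.sum fun b _ => contDiff_const.smulRight (ih (ha.momentum b))

end

/-! ### The invariant measure -/

section
variable {E : Type*} [NormedAddCommGroup E]

lemma continuous_inv_pt_zero : Continuous fun x : E3 => 1 / pt x 0 :=
  continuous_const.div continuous_pt_zero fun x => (pt_zero_pos x).ne'

lemma integral_hypMeasure [NormedSpace ℝ E] (f : E3 → E) :
    ∫ x, f x ∂hypMeasure = ∫ x, (1 / pt x 0) • f x := by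
  rw [hypMeasure, integral_withDensity_eq_integral_toReal_smul
    continuous_inv_pt_zero.measurable.ennreal_ofReal
    (Filter.Eventually.of_forall fun x => ENNReal.ofReal_lt_top)]
  refine integral_congr_ae (Filter.Eventually.of_forall fun x => ?_)
  have : 0 ≤ 1 / pt x 0 := (div_pos one_pos (pt_zero_pos x)).le
  simp only [ENNReal.toReal_ofReal this]

lemma hypMeasure_le : hypMeasure ≤ volume := by
  refine (withDensity_mono (g := fun _ => 1)
    (Filter.Eventually.of_forall fun x => ?_)).trans (withDensity_one).le
  rw [ENNReal.ofReal_le_one]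
  exact (div_le_one (pt_zero_pos x)).2 (one_le_pt_zero x)

lemma volume_absolutelyContinuous : (volume : Measure E3) ≪ hypMeasure :=
  withDensity_absolutelyContinuous' continuous_inv_pt_zero.measurable.ennreal_ofReal.aemeasurable
    (Filter.Eventually.of_forall fun x => by
      simpa using div_pos one_pos (pt_zero_pos x))

lemma RapidDecay.integrable_hypMeasure {a : E3 → E} (ha : RapidDecay a) :
    Integrable a hypMeasure := ha.integrable.mono_measure hypMeasure_le

instance : IsFiniteMeasureOnCompacts hypMeasure :=
  DiracMatrices.isFiniteMeasureOnCompacts_hypMeasure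

instance : SFinite hypMeasure := by unfold hypMeasure; infer_instance

end

/-- Multiplication of spinors by a matrix, as a continuous linear map. -/
noncomputable def mulVecL (A : Matrix (Fin 4) (Fin 4) ℂ) : Spinor →L[ℂ] Spinor :=
  A.mulVecLin.toContinuousLinearMap

lemma mulVecL_apply (A : Matrix (Fin 4) (Fin 4) ℂ) (v : Spinor) : mulVecL A v = A *ᵥ v := rfl

lemma mulVec_integral {μ : Measure E3} (A : Matrix (Fin 4) (Fin 4) ℂ) {f : E3 → Spinor}
    (hf : Integrable f μ) : ∫ x, A *ᵥ f x ∂μ = A *ᵥ ∫ x, f x ∂μ :=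
  (mulVecL A).integral_comp_comm hf

lemma RapidDecay.mulVec {a : E3 → Spinor} (ha : RapidDecay a) (A : Matrix (Fin 4) (Fin 4) ℂ) :
    RapidDecay fun z => A *ᵥ a z :=
  ha.of_norm_le ((mulVecL A).continuous.comp ha.1) ‖mulVecL A‖ 0 fun z => by
    rw [pow_zero, mul_one]; exact (mulVecL A).le_opNorm (a z)

lemma RapidDecay.sum {ι : Type*} (s : Finset ι) {a : ι → E3 → Spinor}
    (ha : ∀ i, RapidDecay (a i)) : RapidDecay fun z => ∑ i ∈ s, a i z := by
  classical
  induction s using Finset.induction_on with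
  | empty =>
    simp only [Finset.sum_empty]
    exact ⟨continuous_const, fun N => ⟨0, fun z => by simp⟩⟩
  | insert i s hi ih =>
    simp only [Finset.sum_insert hi]
    exact (ha i).add ih

lemma waves_mulVec {a : E3 → Spinor} (ha : RapidDecay a) (A : Matrix (Fin 4) (Fin 4) ℂ) (x : Mink) :
    waves (fun z => A *ᵥ a z) x = A *ᵥ waves a x := by
  rw [waves, waves, ← mulVec_integral A (ha.wave_smul x).integrable]
  simp only [Matrix.mulVec_smul]

lemma waves_add {a b : E3 → Spinor} (ha : RapidDecay a) (hb : RapidDecay b) (x : Mink) :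
    waves (fun z => a z + b z) x = waves a x + waves b x := by
  rw [waves, waves, waves, ← integral_add (ha.wave_smul x).integrable (hb.wave_smul x).integrable]
  simp only [smul_add]

lemma waves_sum {ι : Type*} (s : Finset ι) {a : ι → E3 → Spinor}
    (ha : ∀ i, RapidDecay (a i)) (x : Mink) :
    waves (fun z => ∑ i ∈ s, a i z) x = ∑ i ∈ s, waves (a i) x := by
  simp only [waves, Finset.smul_sum]
  exact integral_finsetSum _ fun i _ => ((ha i).wave_smul x).integrable

lemma waves_smul (c : ℂ) (a : E3 → Spinor) (x : Mink) :
    waves (fun z => c • a z) x = c • waves a x := by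
  rw [waves, waves, ← integral_smul]
  simp only [smul_comm c]

namespace DiracMatrices
variable (D : DiracMatrices)

/-! ### The kernel of the transformation and Dirac fields -/

lemma slash_pt_sq (z : E3) : D.slash (pt z) * D.slash (pt z) = 1 := by
  rw [slash_sq, mdot_pt]; simp

lemma slash_mulVec (v : Mink) (w : Spinor) :
    D.slash v *ᵥ w = ∑ a, ((sgn a * v a : ℝ) : ℂ) • (D.γ a *ᵥ w) := by
  simp only [slash, Matrix.sum_mulVec, Matrix.smul_mulVec]

lemma continuous_slash_pt : Continuous fun z => D.slash (pt z) := by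
  have h : (fun z => D.slash (pt z)) = fun z => D.γ 0 * D.wt z := by
    ext1 z; rw [wt, ← mul_assoc, γ_zero_sq, one_mul]
  rw [h]
  exact continuous_const.mul D.continuous_wt

lemma _root_.HypDirac.RapidDecay.slash_mulVec {a : E3 → Spinor} (ha : RapidDecay a) :
    RapidDecay fun z => D.slash (pt z) *ᵥ a z := by
  simp only [D.slash_mulVec]
  refine RapidDecay.sum _ fun b => ?_
  have hp : Continuous fun z => pt z b := (continuous_apply b).comp continuous_pt
  refine (ha.mulVec (D.γ b)).smul (by fun_prop) 1 1 fun z => ?_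
  simpa [abs_sgn] using abs_pt_le z b

/-- The kernel `e^{-i x·z γ·z} γ·z = cos(x·z) γ·z - i sin(x·z)`. -/
noncomputable def ker (x : Mink) (z : E3) : Matrix (Fin 4) (Fin 4) ℂ :=
  (Real.cos (mdot x (pt z)) : ℂ) • D.slash (pt z)
    - (Complex.I * Real.sin (mdot x (pt z)) : ℂ) • 1

/-- The kernel `e^{i x·z γ·z} = cos(x·z) + i sin(x·z) γ·z` of the adjoint transformation. -/
noncomputable def kerAdj (x : Mink) (z : E3) : Matrix (Fin 4) (Fin 4) ℂ :=
  (Real.cos (mdot x (pt z)) : ℂ) • 1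
    + (Complex.I * Real.sin (mdot x (pt z)) : ℂ) • D.slash (pt z)

lemma continuous_ker : Continuous fun p : Mink × E3 => D.ker p.1 p.2 := by
  have h1 : Continuous fun p : Mink × E3 => mdot p.1 (pt p.2) := by
    unfold mdot
    refine continuous_finsetSum _ fun a _ => ?_
    have h2 := (continuous_apply a).comp (continuous_pt.comp (continuous_snd (X := Mink) (Y := E3)))
    have h3 := (continuous_apply a).comp (continuous_fst (X := Mink) (Y := E3))
    exact (continuous_const.mul h3).mul h2
  unfold ker
  exact (by fun_prop : Continuous fun p : Mink × E3 =>
    (Real.cos (mdot p.1 (pt p.2)) : ℂ)).smul (D.continuous_slash_pt.comp continuous_snd) |>.sub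
    ((by fun_prop : Continuous fun p : Mink × E3 =>
      (Complex.I * Real.sin (mdot p.1 (pt p.2)) : ℂ)).smul continuous_const)

lemma continuous_kerAdj : Continuous fun p : Mink × E3 => D.kerAdj p.1 p.2 := by
  have h : (fun p : Mink × E3 => D.kerAdj p.1 p.2)
      = fun p : Mink × E3 => D.ker (-p.1) p.2 * D.slash (pt p.2) := by
    ext1 p
    simp only [kerAdj, ker, sub_mul, smul_mul_assoc, slash_pt_sq, one_mul, mdot_neg_left,
      Real.cos_neg, Real.sin_neg]
    push_cast
    module
  rw [h]
  exact (D.continuous_ker.comp ((continuous_neg.comp continuous_fst).prodMk continuous_snd)).mul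
    (D.continuous_slash_pt.comp continuous_snd)

lemma kerAdj_mul_ker (x : Mink) (z : E3) :
    D.kerAdj x z * D.ker x z = D.slash (pt z) := by
  have h : ((Real.cos (mdot x (pt z)) : ℂ)) ^ 2 + (Real.sin (mdot x (pt z)) : ℂ) ^ 2 = 1 := by
    exact_mod_cast Real.cos_sq_add_sin_sq _
  simp only [kerAdj, ker, add_mul, mul_sub, slash_pt_sq, one_mul, mul_one,
    smul_mul_assoc, mul_smul_comm]
  have hI : Complex.I * Complex.I = -1 := Complex.I_mul_I
  have : ∀ (c s : ℂ), c ^ 2 + s ^ 2 = 1 → ∀ Z : Matrix (Fin 4) (Fin 4) ℂ,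
      c • c • Z - (Complex.I * s) • c • (1 : Matrix (Fin 4) (Fin 4) ℂ)
      + (c • (Complex.I * s) • (1 : Matrix (Fin 4) (Fin 4) ℂ)
        - (Complex.I * s) • (Complex.I * s) • Z) = Z := by
    intro c s hcs Z
    have h1 : (Complex.I * s) * (Complex.I * s) = -s ^ 2 := by
      linear_combination s ^ 2 * hI
    rw [smul_smul (Complex.I * s) (Complex.I * s), h1]
    have h2 : Z = (c ^ 2 + s ^ 2) • Z := by rw [hcs, one_smul]
    conv_rhs => rw [h2]
    module
  have := this _ _ h (D.slash (pt z))
  refine Eq.trans ?_ this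
  module

/-- The two kernels are adjoint to each other for the densities with weights `γ⁰ γ·n` and
`γ⁰ γ·z`. -/
lemma kerAdj_mul_conjTranspose (n x : Mink) (z : E3) :
    (D.kerAdj x z * D.slash n)ᴴ * D.wt z = D.γ 0 * D.slash n * D.ker x z := by
  have h0 := D.γ_zero_sq
  have h1 : (D.kerAdj x z)ᴴ
      = D.γ 0 * ((Real.cos (mdot x (pt z)) : ℂ) • 1
        - (Complex.I * Real.sin (mdot x (pt z)) : ℂ) • D.slash (pt z)) * D.γ 0 := by
    rw [kerAdj, Matrix.conjTranspose_add, Matrix.conjTranspose_smul, Matrix.conjTranspose_smul,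
      Matrix.conjTranspose_one, slash_conjTranspose, mul_sub, sub_mul, mul_smul_comm, mul_one,
      smul_mul_assoc, h0, mul_smul_comm, smul_mul_assoc]
    simp only [Complex.star_def, map_mul, Complex.conj_I, Complex.conj_ofReal, sub_eq_add_neg,
      neg_mul, neg_smul]
  have h2 : ((Real.cos (mdot x (pt z)) : ℂ) • 1
        - (Complex.I * Real.sin (mdot x (pt z)) : ℂ) • D.slash (pt z)) * D.slash (pt z)
      = D.ker x z := by
    rw [sub_mul, smul_mul_assoc, one_mul, smul_mul_assoc, slash_pt_sq, ker]
  rw [Matrix.conjTranspose_mul, h1, slash_conjTranspose, wt, ← h2]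
  calc _ = D.γ 0 * D.slash n * (D.γ 0 * D.γ 0) * ((Real.cos (mdot x (pt z)) : ℂ) • 1
        - (Complex.I * Real.sin (mdot x (pt z)) : ℂ) • D.slash (pt z)) * (D.γ 0 * D.γ 0)
          * D.slash (pt z) := by simp only [mul_assoc]
    _ = _ := by rw [h0]; simp only [mul_assoc, mul_one]

/-- The solution `∫ e^{-i x·z γ·z} γ·z g(z) dμ(z)` of the Dirac equation of mass one. -/
noncomputable def field (g : E3 → Spinor) (x : Mink) : Spinor :=
  ∫ z, D.ker x z *ᵥ g z ∂hypMeasure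

/-- The amplitude of the part of `field g` with positive (`s = 1`) or negative (`s = -1`)
frequency, with respect to Lebesgue measure. -/
noncomputable def part (s : ℂ) (g : E3 → Spinor) (z : E3) : Spinor :=
  ((1 / (2 * pt z 0) : ℝ) : ℂ) • (D.slash (pt z) *ᵥ g z + s • g z)

variable {D} in
lemma _root_.HypDirac.RapidDecay.part {g : E3 → Spinor} (hg : RapidDecay g) (s : ℂ) :
    RapidDecay (D.part s g) := by
  have h1 : RapidDecay fun z => s • g z := hg.smul continuous_const ‖s‖ 0 fun z => by simp
  refine ((hg.slash_mulVec D).add h1).smul ?_ 1 0 fun z => ?_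
  · refine Complex.continuous_ofReal.comp (continuous_const.div
      (continuous_const.mul continuous_pt_zero) fun z => ?_)
    have := pt_zero_pos z
    positivity
  · have := one_le_pt_zero z
    rw [Complex.norm_real, Real.norm_of_nonneg (by positivity), div_le_iff₀ (by positivity)]
    simp; linarith

lemma ker_mulVec (x : Mink) (z : E3) (v : Spinor) :
    D.ker x z *ᵥ v = Complex.exp (Complex.I * (mdot x (pt z) : ℝ))
          • (1 / 2 : ℂ) • (D.slash (pt z) *ᵥ v + (-1 : ℂ) • v)
        + Complex.exp (Complex.I * (mdot (-x) (pt z) : ℝ))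
          • (1 / 2 : ℂ) • (D.slash (pt z) *ᵥ v + (1 : ℂ) • v) := by
  have hc : ∀ θ : ℝ, Complex.exp (Complex.I * θ) = Real.cos θ + Complex.I * Real.sin θ := by
    intro θ
    rw [mul_comm, Complex.exp_mul_I, mul_comm]; push_cast; ring
  rw [hc, hc, mdot_neg_left, Real.cos_neg, Real.sin_neg, ker, Matrix.sub_mulVec,
    Matrix.smul_mulVec, Matrix.smul_mulVec, Matrix.one_mulVec]
  push_cast
  module

lemma ker_part (x : Mink) (g : E3 → Spinor) (z : E3) :
    (1 / pt z 0) • (D.ker x z *ᵥ g z)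
      = Complex.exp (Complex.I * (mdot x (pt z) : ℝ)) • D.part (-1) g z
        + Complex.exp (Complex.I * (mdot (-x) (pt z) : ℝ)) • D.part 1 g z := by
  rw [ker_mulVec, part, part, ← Complex.coe_smul (1 / pt z 0)]
  have : ((1 / (2 * pt z 0) : ℝ) : ℂ) = (1 / 2 : ℂ) * ((1 / pt z 0 : ℝ) : ℂ) := by
    push_cast; field_simp
  rw [this]
  module

lemma field_eq_waves {g : E3 → Spinor} (hg : RapidDecay g) (x : Mink) :
    D.field g x = waves (D.part (-1) g) x + waves (D.part 1 g) (-x) := by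
  rw [field, integral_hypMeasure, waves, waves,
    ← integral_add ((hg.part (-1)).wave_smul x).integrable ((hg.part 1).wave_smul (-x)).integrable]
  simp only [ker_part]

lemma contDiff_field {g : E3 → Spinor} (hg : RapidDecay g) : ContDiff ℝ ∞ (D.field g) := by
  rw [show D.field g = fun x => _ from funext fun x => D.field_eq_waves hg x]
  exact (hg.part (-1)).contDiff_waves.add ((hg.part 1).contDiff_waves.comp contDiff_neg)

lemma fderiv_field {g : E3 → Spinor} (hg : RapidDecay g) (x : Mink) (b : Fin 4) :
    fderiv ℝ (D.field g) x (Pi.single b 1)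
      = waves (momentum b (D.part (-1) g)) x - waves (momentum b (D.part 1 g)) (-x) := by
  have h1 := (hg.part (D := D) (-1)).hasFDerivAt_waves x
  have h2 := ((hg.part (D := D) 1).hasFDerivAt_waves (-x)).comp x (hasFDerivAt_id x).neg
  have h3 := (h1.add h2).congr_of_eventuallyEq
    (Filter.Eventually.of_forall fun x => D.field_eq_waves hg x)
  rw [h3.fderiv]
  simp only [_root_.add_apply, ContinuousLinearMap.comp_apply, _root_.neg_apply,
    ContinuousLinearMap.id_apply, map_neg, ← sub_eq_add_neg]
  simp [Pi.single_apply]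

lemma sum_γ_momentum (a : E3 → Spinor) (z : E3) :
    ∑ b, D.γ b *ᵥ momentum b a z = Complex.I • (D.slash (pt z) *ᵥ a z) := by
  simp only [momentum, Matrix.mulVec_smul, D.slash_mulVec, Finset.smul_sum, smul_smul]

lemma slash_mulVec_part (s : ℂ) (hs : s * s = 1) (g : E3 → Spinor) (z : E3) :
    D.slash (pt z) *ᵥ D.part s g z = s • D.part s g z := by
  rw [part, Matrix.mulVec_smul, Matrix.mulVec_add, Matrix.mulVec_mulVec, slash_pt_sq,
    Matrix.one_mulVec, Matrix.mulVec_smul, smul_comm s, smul_add s, smul_smul s s, hs, one_smul,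
    add_comm]

/-- `ψ` is smooth and solves the Dirac equation `iγᵃ∂_aψ = M ψ` on the whole of Minkowski
space. -/
def IsGlobalSolution (M : ℝ) (ψ : Mink → Spinor) : Prop :=
  ContDiff ℝ ∞ ψ ∧ ∀ x, Complex.I • (∑ a, D.γ a *ᵥ fderiv ℝ ψ x (Pi.single a 1)) = (M : ℂ) • ψ x

lemma isGlobalSolution_field {g : E3 → Spinor} (hg : RapidDecay g) :
    D.IsGlobalSolution 1 (D.field g) := by
  refine ⟨D.contDiff_field hg, fun x => ?_⟩
  have h : ∀ s : ℂ, s * s = 1 → ∀ y, ∑ b, D.γ b *ᵥ waves (momentum b (D.part s g)) y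
      = (Complex.I * s) • waves (D.part s g) y := by
    intro s hs y
    simp only [← waves_mulVec ((hg.part s).momentum _)]
    rw [← waves_sum _ fun b => ((hg.part s).momentum b).mulVec _]
    simp only [D.sum_γ_momentum, D.slash_mulVec_part s hs, smul_smul]
    exact waves_smul _ _ _
  simp only [D.fderiv_field hg, Matrix.mulVec_sub, Finset.sum_sub_distrib]
  rw [h (-1) (by norm_num), h 1 (by norm_num), D.field_eq_waves hg]
  have hI : Complex.I * Complex.I = -1 := Complex.I_mul_I
  rw [smul_sub, smul_smul, smul_smul, ← mul_assoc, ← mul_assoc, hI]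
  simp

lemma IsGlobalSolution.comp_smul {M : ℝ} {ψ : Mink → Spinor} (h : D.IsGlobalSolution M ψ) (κ : ℝ) :
    D.IsGlobalSolution (κ * M) fun x => ψ (κ • x) := by
  refine ⟨h.1.comp (contDiff_const_smul κ), fun x => ?_⟩
  have h1 : ∀ v, fderiv ℝ (fun x => ψ (κ • x)) x v = κ • fderiv ℝ ψ (κ • x) v := by
    intro v
    have := ((h.1.differentiable (by simp)) (κ • x)).hasFDerivAt.comp x
      ((hasFDerivAt_id x).const_smul κ)
    rw [show (fun x => ψ (κ • x)) = ψ ∘ HSMul.hSMul κ from rfl, this.fderiv]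
    simp
  simp only [h1, ← Complex.coe_smul κ, Matrix.mulVec_smul, ← Finset.smul_sum]
  rw [smul_comm, h.2]
  push_cast
  rw [smul_smul]

lemma fourier_eq (κ : ℝ) (f : E3 → Spinor) (y : E3) :
    D.fourier κ f y = ((κ / (2 * Real.pi)) ^ (3 / 2 : ℝ) : ℝ) • D.field f (κ • pt y) := by
  rw [fourier, field]
  congr 2
  ext1 x
  congr 1
  have h : (-Complex.I * κ * mdot (pt y) (pt x) : ℂ)
      = Complex.I * ((-mdot (κ • pt y) (pt x) : ℝ) : ℂ) := by
    rw [mdot_smul_left]; push_cast; ring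
  rw [h, exp_smul_of_sq_eq_one (D.slash_pt_sq x), Real.cos_neg, Real.sin_neg, add_mul,
    smul_mul_assoc, one_mul, smul_mul_assoc, slash_pt_sq, ker]
  push_cast
  module

lemma fourierStar_eq (κ : ℝ) (f : E3 → Spinor) (y : E3) :
    D.fourierStar κ f y = ((κ / (2 * Real.pi)) ^ (3 / 2 : ℝ) : ℝ) •
      ∫ x, D.kerAdj (κ • pt x) y *ᵥ (D.slash (pt x) *ᵥ f x) ∂hypMeasure := by
  rw [fourierStar]
  congr 2
  ext1 x
  rw [Matrix.mulVec_mulVec]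
  congr 2
  have h : (Complex.I * κ * mdot (pt y) (pt x) : ℂ)
      = Complex.I * ((mdot (κ • pt x) (pt y) : ℝ) : ℂ) := by
    rw [mdot_smul_left, mdot_comm]; push_cast; ring
  rw [h, exp_smul_of_sq_eq_one (D.slash_pt_sq y), kerAdj]

end DiracMatrices

/-! ### Conserved currents -/

/-- The `j`-th unit vector of Euclidean space. -/
noncomputable abbrev unitVec (j : Fin 3) : E3 := EuclideanSpace.single j 1

lemma integral_hasLineDerivAt_eq_zero {f f' : E3 → ℝ} {v : E3} (hf : Integrable f)
    (hf' : Integrable f') (h : ∀ x, HasLineDerivAt ℝ f (f' x) x v) : ∫ x, f' x = 0 := by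
  have := integral_bilinear_hasLineDerivAt_right_eq_neg_left_of_integrable (μ := volume)
    (B := ContinuousLinearMap.mul ℝ ℝ) (f := fun _ : E3 => (1 : ℝ)) (f' := fun _ => (0 : ℝ))
    (g := f) (g' := f') (v := v) (by simp) (by simpa using hf')
    (by simpa using hf) (fun x _ => by
      simpa using (hasFDerivAt_const (1 : ℝ) x).hasLineDerivAt v) (fun x _ => h x)
  simpa using this

/-- The divergence theorem on a slab `[s₀, s₁] × ℝ³`, as an inequality: if the density `B` and
the flux `J` decay and `∂ₛB + div J ≤ 0`, the integral of `B` does not increase. -/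
lemma integral_le_of_div_nonpos {B B' : ℝ → E3 → ℝ} {J J' : Fin 3 → ℝ → E3 → ℝ} {s₀ s₁ : ℝ}
    (hs : s₀ ≤ s₁) (hB : ∀ s x, HasDerivAt (fun s => B s x) (B' s x) s)
    (hJ : ∀ j s x, HasLineDerivAt ℝ (J j s) (J' j s x) x (unitVec j))
    (hBc : ∀ s, Continuous (B s)) (hBc' : Continuous fun p : ℝ × E3 => B' p.1 p.2)
    (hJc : ∀ j s, Continuous (J j s)) (hJc' : ∀ j s, Continuous (J' j s)) {C : ℝ}
    (hBb : ∀ s ∈ Icc s₀ s₁, ∀ x, pt x 0 ^ 4 * ‖B s x‖ ≤ C)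
    (hBb' : ∀ s ∈ Icc s₀ s₁, ∀ x, pt x 0 ^ 4 * ‖B' s x‖ ≤ C)
    (hJb : ∀ j, ∀ s ∈ Icc s₀ s₁, ∀ x, pt x 0 ^ 4 * ‖J j s x‖ ≤ C)
    (hJb' : ∀ j, ∀ s ∈ Icc s₀ s₁, ∀ x, pt x 0 ^ 4 * ‖J' j s x‖ ≤ C)
    (hdiv : ∀ s ∈ Icc s₀ s₁, ∀ x, B' s x + ∑ j, J' j s x ≤ 0) :
    ∫ x, B s₁ x ≤ ∫ x, B s₀ x := by
  have hBi : ∀ s ∈ Icc s₀ s₁, Integrable (B s) := fun s h =>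
    integrable_of_pow_four_mul_le (hBc s).aestronglyMeasurable (hBb s h)
  have hBi' : ∀ s ∈ Icc s₀ s₁, Integrable (B' s) := fun s h =>
    integrable_of_pow_four_mul_le (hBc'.comp (by fun_prop : Continuous fun x : E3 => (s, x))
      ).aestronglyMeasurable (hBb' s h)
  have hprod : Integrable (fun p : E3 × ℝ => B' p.2 p.1)
      (volume.prod (volume.restrict (Ioc s₀ s₁))) := by
    have h1 : Integrable (fun p : E3 × ℝ => (C * (pt p.1 0 ^ 4)⁻¹) * (1 : ℝ))
        (volume.prod (volume.restrict (Ioc s₀ s₁))) :=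
      (integrable_inv_pt_zero_pow.const_mul C).mul_prod (integrable_const (1 : ℝ))
    refine h1.mono' (hBc'.comp continuous_swap).aestronglyMeasurable ?_
    have h2 : ∀ᵐ p : E3 × ℝ ∂(volume.prod (volume.restrict (Ioc s₀ s₁))), p.2 ∈ Ioc s₀ s₁ :=
      Measure.ae_prod_mem_iff_ae_ae_mem (measurableSet_Ioc.preimage measurable_snd) |>.2
        (Filter.Eventually.of_forall fun x => ae_restrict_mem measurableSet_Ioc)
    filter_upwards [h2] with p hp
    have := pt_zero_pos p.1
    rw [mul_one, ← div_eq_mul_inv, le_div_iff₀ (by positivity), mul_comm]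
    exact hBb' _ (Ioc_subset_Icc_self hp) _
  have h1 : ∫ x, B s₁ x - B s₀ x = ∫ x, ∫ s in Ioc s₀ s₁, B' s x := by
    congr 1; ext1 x
    rw [← intervalIntegral.integral_of_le hs]
    refine (intervalIntegral.integral_eq_sub_of_hasDerivAt (fun s _ => hB s x) ?_).symm
    exact (hBc'.comp (by fun_prop : Continuous fun s : ℝ => (s, x))).intervalIntegrable _ _
  have h2 : ∫ x, B s₁ x - B s₀ x ≤ 0 := by
    rw [h1, integral_integral_swap hprod]
    refine setIntegral_nonpos measurableSet_Ioc fun s hs' => ?_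
    have hs' := Ioc_subset_Icc_self hs'
    have hJi : ∀ j, Integrable (J' j s) := fun j =>
      integrable_of_pow_four_mul_le (hJc' j s).aestronglyMeasurable (hJb' j s hs')
    have h3 : ∫ x, ∑ j, J' j s x = 0 := by
      rw [integral_finsetSum _ fun j _ => hJi j]
      exact Finset.sum_eq_zero fun j _ => integral_hasLineDerivAt_eq_zero
        (integrable_of_pow_four_mul_le (hJc j s).aestronglyMeasurable (hJb j s hs'))
        (hJi j) (hJ j s)
    have h4 := integral_add (hBi' s hs') (integrable_finsetSum Finset.univ fun j _ => hJi j)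
    rw [h3, add_zero] at h4
    rw [← h4]
    exact integral_nonpos fun x => hdiv s hs' x
  rw [integral_sub (hBi s₁ (right_mem_Icc.2 hs)) (hBi s₀ (left_mem_Icc.2 hs))] at h2
  linarith

lemma hasFDerivAt_event {F : Type*} [NormedAddCommGroup F] [NormedSpace ℝ F] {τ : F → ℝ}
    {ξ : F → E3} {τ' : F →L[ℝ] ℝ} {ξ' : F →L[ℝ] E3} {y : F} (hτ : HasFDerivAt τ τ' y)
    (hξ : HasFDerivAt ξ ξ' y) :
    ∃ L : F →L[ℝ] Mink, HasFDerivAt (fun y => event (τ y) (ξ y)) L y ∧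
      ∀ v, L v = event (τ' v) (ξ' v) := by
  refine ⟨ContinuousLinearMap.pi fun a => Fin.cases τ' (fun i =>
    (EuclideanSpace.proj (𝕜 := ℝ) i).comp ξ') a, ?_, fun v => ?_⟩
  · refine hasFDerivAt_pi.2 fun a => ?_
    refine Fin.cases hτ (fun i => ?_) a
    exact (EuclideanSpace.proj (𝕜 := ℝ) i).hasFDerivAt.comp y hξ
  · ext a
    refine Fin.cases rfl (fun i => rfl) a

lemma event_one_zero : event 1 0 = Pi.single 0 1 := by
  ext a; refine Fin.cases rfl (fun i => by simp [event_succ]) a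

lemma event_zero_unitVec (j : Fin 3) : event 0 (unitVec j) = Pi.single j.succ 1 := by
  ext a
  refine Fin.cases (by simp [event_zero]) (fun i => ?_) a
  rw [event_succ]
  simp [Pi.single_apply, Fin.succ_inj]

lemma event_eq_add (t : ℝ) (j : Fin 3) :
    event t (unitVec j) = t • Pi.single 0 1 + Pi.single j.succ 1 := by
  rw [← event_one_zero, ← event_zero_unitVec, smul_event, event_add]; simp

lemma continuous_event : Continuous fun p : ℝ × E3 => event p.1 p.2 :=
  continuous_pi fun a => Fin.cases continuous_fst
    (fun i => (EuclideanSpace.proj (𝕜 := ℝ) i).continuous.comp continuous_snd) a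

/-- The partial derivatives of a function of the event `(t, x)`. -/
lemma hasDerivAt_event_time {c : Mink → ℝ} (hc : ContDiff ℝ ∞ c) {τ : ℝ → ℝ} {τ' s : ℝ} (x : E3)
    (hτ : HasDerivAt τ τ' s) :
    HasDerivAt (fun s => c (event (τ s) x))
      (τ' * fderiv ℝ c (event (τ s) x) (Pi.single 0 1)) s := by
  obtain ⟨L, hL, hLv⟩ := hasFDerivAt_event (y := s) hτ.hasFDerivAt (hasFDerivAt_const x s)
  have h := ((hc.differentiable (by simp)) (event (τ s) x)).hasFDerivAt.comp s hL
  refine h.hasDerivAt.congr_deriv ?_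
  have h1 : L 1 = τ' • Pi.single 0 1 := by
    rw [hLv, ← event_one_zero, smul_event]; simp
  simp [h1]

lemma hasLineDerivAt_event {c : Mink → ℝ} (hc : ContDiff ℝ ∞ c) {τ : E3 → ℝ} {τ' : E3 →L[ℝ] ℝ}
    {x : E3} (hτ : HasFDerivAt τ τ' x) (j : Fin 3) :
    HasLineDerivAt ℝ (fun x => c (event (τ x) x))
      (τ' (unitVec j) * fderiv ℝ c (event (τ x) x) (Pi.single 0 1)
        + fderiv ℝ c (event (τ x) x) (Pi.single j.succ 1)) x (unitVec j) := by
  obtain ⟨L, hL, hLv⟩ := hasFDerivAt_event (y := x) (ξ := fun x => x) hτ (hasFDerivAt_id x)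
  have h := HasFDerivAt.comp (f := fun x => event (τ x) x) x
    ((hc.differentiable (by simp)) (event (τ x) x)).hasFDerivAt hL
  have h1 := h.hasLineDerivAt (unitVec j)
  have h2 : L (unitVec j) = τ' (unitVec j) • Pi.single 0 1 + Pi.single j.succ 1 := by
    rw [hLv, ← event_eq_add]; rfl
  rw [ContinuousLinearMap.comp_apply, h2, map_add, map_smul, smul_eq_mul] at h1
  exact h1

/-- A conserved current that decays between the plane `x⁰ = 0` and the hyperboloid has the same
flux through both. -/
lemma flux_plane_eq_flux_hyperboloid {c : Fin 4 → Mink → ℝ} (hc : ∀ a, ContDiff ℝ ∞ (c a))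
    (hdiv : ∀ y, ∑ a, fderiv ℝ (c a) y (Pi.single a 1) = 0) {C : ℝ}
    (hb : ∀ a, ∀ s ∈ Icc (0 : ℝ) 1, ∀ x, pt x 0 ^ 5 * ‖c a (event (s * pt x 0) x)‖ ≤ C)
    (hb' : ∀ a b, ∀ s ∈ Icc (0 : ℝ) 1, ∀ x,
      pt x 0 ^ 5 * ‖fderiv ℝ (c a) (event (s * pt x 0) x) (Pi.single b 1)‖ ≤ C) :
    ∫ x, (c 0 (pt x) - ∑ j : Fin 3, x j / pt x 0 * c j.succ (pt x)) = ∫ x, c 0 (event 0 x) := by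
  -- `B s` is the flux density through the surface `x⁰ = s √(1 + |x|²)`, `J` the flux of the current in
  -- the coordinates `(s, x)`, and `B'` and `J' j` are their derivatives by `s` and `x j`
  set B : ℝ → E3 → ℝ := fun s x => c 0 (event (s * pt x 0) x)
    - s * ∑ j : Fin 3, x j / pt x 0 * c j.succ (event (s * pt x 0) x) with hBdef
  set d : Fin 4 → Fin 4 → ℝ → E3 → ℝ := fun a b s x =>
    fderiv ℝ (c a) (event (s * pt x 0) x) (Pi.single b 1) with hddef
  set B' : ℝ → E3 → ℝ := fun s x => pt x 0 * d 0 0 s x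
    - (1 * (∑ j : Fin 3, x j / pt x 0 * c j.succ (event (s * pt x 0) x))
      + s * ∑ j : Fin 3, x j / pt x 0 * (pt x 0 * d j.succ 0 s x)) with hBdef'
  set J : Fin 3 → ℝ → E3 → ℝ := fun j s x => pt x 0 * c j.succ (event (s * pt x 0) x) with hJdef
  set J' : Fin 3 → ℝ → E3 → ℝ := fun j s x => x j / pt x 0 * c j.succ (event (s * pt x 0) x)
    + pt x 0 * (s * (x j / pt x 0) * d j.succ 0 s x + d j.succ j.succ s x) with hJdef'
  have hev : Continuous fun p : ℝ × E3 => event (p.1 * pt p.2 0) p.2 :=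
    continuous_event.comp ((continuous_fst.mul (continuous_pt_zero.comp continuous_snd)).prodMk
      continuous_snd)
  have hp0 : Continuous fun p : ℝ × E3 => pt p.2 0 := continuous_pt_zero.comp continuous_snd
  have hcc : ∀ a, Continuous fun p : ℝ × E3 => c a (event (p.1 * pt p.2 0) p.2) := fun a =>
    (hc a).continuous.comp hev
  have hdc : ∀ a b, Continuous fun p : ℝ × E3 => d a b p.1 p.2 := fun a b =>
    (((hc a).continuous_fderiv (by simp)).comp hev).clm_apply continuous_const
  have hvc : ∀ j : Fin 3, Continuous fun p : ℝ × E3 => p.2 j / pt p.2 0 := fun j =>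
    Continuous.div (by fun_prop) hp0 fun p => (pt_zero_pos _).ne'
  have hBc : Continuous fun p : ℝ × E3 => B p.1 p.2 :=
    (hcc 0).sub (continuous_fst.mul (continuous_finsetSum _ fun j _ => (hvc j).mul (hcc _)))
  have hBc' : Continuous fun p : ℝ × E3 => B' p.1 p.2 :=
    (hp0.mul (hdc 0 0)).sub ((continuous_const.mul
      (continuous_finsetSum _ fun j _ => (hvc j).mul (hcc _))).add
      (continuous_fst.mul (continuous_finsetSum _ fun j _ => (hvc j).mul (hp0.mul (hdc _ 0)))))
  have hJc : ∀ j, Continuous fun p : ℝ × E3 => J j p.1 p.2 := fun j => hp0.mul (hcc _)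
  have hJc' : ∀ j, Continuous fun p : ℝ × E3 => J' j p.1 p.2 := fun j =>
    ((hvc j).mul (hcc _)).add (hp0.mul (((continuous_fst.mul (hvc j)).mul (hdc _ _)).add (hdc _ _)))
  have hs : ∀ s : ℝ, Continuous fun x : E3 => (s, x) := fun s => by fun_prop
  have hv : ∀ (x : E3) (j : Fin 3), |x j / pt x 0| ≤ 1 := by
    intro x j
    rw [abs_div, abs_of_pos (pt_zero_pos x), div_le_one (pt_zero_pos x), ← pt_succ]
    exact abs_pt_le x _
  have hB : ∀ s x, HasDerivAt (fun s => B s x) (B' s x) s := by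
    intro s x
    have ht : HasDerivAt (fun s : ℝ => s * pt x 0) (pt x 0) s := by
      simpa using (hasDerivAt_id s).mul_const (pt x 0)
    have h1 : ∀ a, HasDerivAt (fun s => c a (event (s * pt x 0) x)) (pt x 0 * d a 0 s x) s :=
      fun a => hasDerivAt_event_time (hc a) x ht
    exact (h1 0).sub ((hasDerivAt_id s).mul (HasDerivAt.fun_sum fun j _ => (h1 _).const_mul _))
  have hJ : ∀ j s x, HasLineDerivAt ℝ (J j s) (J' j s x) x (unitVec j) := by
    intro j s x
    have h0 : ((pt x 0)⁻¹ • innerSL ℝ x) (unitVec j) = x j / pt x 0 := by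
      simp [div_eq_inv_mul, EuclideanSpace.inner_single_right]
    have h1 : HasLineDerivAt ℝ (fun x : E3 => pt x 0) (x j / pt x 0) x (unitVec j) := by
      rw [← h0]; exact (hasFDerivAt_pt_zero x).hasLineDerivAt _
    have h2 := hasLineDerivAt_event (hc j.succ) ((hasFDerivAt_pt_zero x).const_mul s) j
    rw [smul_apply, h0, smul_eq_mul] at h2
    have h3 := HasDerivAt.mul h1 h2
    simp only [zero_smul, add_zero] at h3
    exact h3
  have hC0 : 0 ≤ C := by
    refine le_trans ?_ (hb 0 0 (by simp) 0)
    have := pt_zero_pos 0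
    positivity
  -- every term of the densities is bounded by a term of the following form
  have hterm : ∀ (x : E3) (q : ℝ), pt x 0 ^ 5 * ‖q‖ ≤ C →
      pt x 0 ^ 4 * ‖q‖ ≤ C ∧ pt x 0 ^ 4 * ‖pt x 0 * q‖ ≤ C := by
    intro x q hq
    have h1 := one_le_pt_zero x
    refine ⟨le_trans ?_ hq, le_trans (le_of_eq ?_) hq⟩
    · gcongr
      norm_num
    · rw [norm_mul, Real.norm_of_nonneg (pt_zero_pos x).le]; ring
  have hmul : ∀ (x : E3) (k q : ℝ), |k| ≤ 1 → pt x 0 ^ 4 * ‖q‖ ≤ C → pt x 0 ^ 4 * ‖k * q‖ ≤ C := by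
    intro x k q hk hq
    refine le_trans ?_ hq
    have := pt_zero_pos x
    gcongr
    rw [norm_mul]
    exact mul_le_of_le_one_left (norm_nonneg _) hk
  have hadd : ∀ (x : E3) (q r : ℝ) (M N : ℝ), pt x 0 ^ 4 * ‖q‖ ≤ M → pt x 0 ^ 4 * ‖r‖ ≤ N →
      pt x 0 ^ 4 * ‖q + r‖ ≤ M + N := by
    intro x q r M N hq hr
    refine le_trans ?_ (add_le_add hq hr)
    rw [← mul_add]
    have := pt_zero_pos x
    gcongr
    exact norm_add_le _ _
  have hsum : ∀ (x : E3) (q : Fin 3 → ℝ), (∀ j, pt x 0 ^ 4 * ‖q j‖ ≤ C) →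
      pt x 0 ^ 4 * ‖∑ j, q j‖ ≤ 3 * C := by
    intro x q hq
    rw [Fin.sum_univ_three]
    linarith [hadd x _ _ _ _ (hadd x _ _ _ _ (hq 0) (hq 1)) (hq 2)]
  have hsabs : ∀ s ∈ Icc (0 : ℝ) 1, |s| ≤ 1 := fun s hs => by
    rw [abs_of_nonneg hs.1]; exact hs.2
  have hsv : ∀ s ∈ Icc (0 : ℝ) 1, ∀ (x : E3) (j : Fin 3), |s * (x j / pt x 0)| ≤ 1 :=
    fun s hs x j => by
      rw [abs_mul]; exact mul_le_one₀ (hsabs s hs) (abs_nonneg _) (hv x j)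
  have hBb : ∀ s ∈ Icc (0 : ℝ) 1, ∀ x, pt x 0 ^ 4 * ‖B s x‖ ≤ 7 * C := by
    intro s hs x
    have h1 := (hterm x _ (hb 0 s hs x)).1
    have h2 := hsum x (fun j => -(s * (x j / pt x 0)) * c j.succ (event (s * pt x 0) x))
      fun j => hmul x _ _ (by rw [abs_neg]; exact hsv s hs x j) (hterm x _ (hb _ s hs x)).1
    have h3 := hadd x _ _ _ _ h1 h2
    have h4 : B s x = c 0 (event (s * pt x 0) x)
        + ∑ j : Fin 3, -(s * (x j / pt x 0)) * c j.succ (event (s * pt x 0) x) := by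
      simp only [hBdef, Finset.mul_sum, sub_eq_add_neg, ← Finset.sum_neg_distrib]
      congr 1
      exact Finset.sum_congr rfl fun j _ => by ring
    rw [h4]; linarith
  have hBb' : ∀ s ∈ Icc (0 : ℝ) 1, ∀ x, pt x 0 ^ 4 * ‖B' s x‖ ≤ 7 * C := by
    intro s hs x
    have h1 := (hterm x _ (hb' 0 0 s hs x)).2
    have h2 := hsum x (fun j => -(x j / pt x 0) * c j.succ (event (s * pt x 0) x))
      fun j => hmul x _ _ (by rw [abs_neg]; exact hv x j) (hterm x _ (hb _ s hs x)).1
    have h2' := hsum x (fun j => -(s * (x j / pt x 0)) * (pt x 0 * d j.succ 0 s x))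
      fun j => hmul x _ _ (by rw [abs_neg]; exact hsv s hs x j) (hterm x _ (hb' _ _ s hs x)).2
    have h3 := hadd x _ _ _ _ (hadd x _ _ _ _ h1 h2) h2'
    have h4 : B' s x = pt x 0 * d 0 0 s x
        + ∑ j : Fin 3, -(x j / pt x 0) * c j.succ (event (s * pt x 0) x)
        + ∑ j : Fin 3, -(s * (x j / pt x 0)) * (pt x 0 * d j.succ 0 s x) := by
      simp only [hBdef', Finset.mul_sum, sub_eq_add_neg, ← Finset.sum_neg_distrib, neg_add,
        ← add_assoc]
      congr 1
      · congr 1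
        exact Finset.sum_congr rfl fun j _ => by ring
      · exact Finset.sum_congr rfl fun j _ => by ring
    rw [h4]
    linarith
  have hJb : ∀ j, ∀ s ∈ Icc (0 : ℝ) 1, ∀ x, pt x 0 ^ 4 * ‖J j s x‖ ≤ 7 * C := fun j s hs x => by
    linarith [(hterm x _ (hb j.succ s hs x)).2]
  have hJb' : ∀ j, ∀ s ∈ Icc (0 : ℝ) 1, ∀ x, pt x 0 ^ 4 * ‖J' j s x‖ ≤ 7 * C := by
    intro j s hs x
    have h1 := hmul x (x j / pt x 0) _ (hv x j) (hterm x _ (hb j.succ s hs x)).1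
    have h2 := hmul x _ _ (hsv s hs x j) (hterm x _ (hb' j.succ 0 s hs x)).2
    have h3 := (hterm x _ (hb' j.succ j.succ s hs x)).2
    have h4 := hadd x _ _ _ _ (hadd x _ _ _ _ h1 h2) h3
    have h5 : J' j s x = x j / pt x 0 * c j.succ (event (s * pt x 0) x)
        + s * (x j / pt x 0) * (pt x 0 * d j.succ 0 s x) + pt x 0 * d j.succ j.succ s x := by
      simp only [hJdef']; ring
    rw [h5]
    linarith
  have hdiv' : ∀ s x, B' s x + ∑ j, J' j s x = 0 := by
    intro s x
    have h1 := hdiv (event (s * pt x 0) x)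
    rw [Fin.sum_univ_succ] at h1
    simp only [hBdef', hJdef', hddef, Fin.sum_univ_three] at h1 ⊢
    linear_combination pt x 0 * h1
  have h0 : ∀ x, B 0 x = c 0 (event 0 x) := fun x => by simp [hBdef]
  have h1 : ∀ x, B 1 x = c 0 (pt x) - ∑ j : Fin 3, x j / pt x 0 * c j.succ (pt x) := fun x => by
    simp only [hBdef, one_mul, ← pt_eq_event]
  clear_value B B' J J'
  -- the inequality for the current and for its negative gives the equality
  have hle := integral_le_of_div_nonpos (B := B) (B' := B') (J := J) (J' := J') zero_le_one hB hJ
    (fun s => hBc.comp (hs s)) hBc'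
    (fun j s => (hJc j).comp (hs s)) (fun j s => (hJc' j).comp (hs s)) hBb hBb' hJb hJb'
    (fun s _ x => (hdiv' s x).le)
  have hge := integral_le_of_div_nonpos (B := fun s x => -B s x) (B' := fun s x => -B' s x)
    (J := fun j s x => -J j s x) (J' := fun j s x => -J' j s x) zero_le_one
    (fun s x => (hB s x).neg) (fun j s x => HasDerivAt.neg (hJ j s x))
    (fun s => (hBc.comp (hs s)).neg) hBc'.neg
    (fun j s => ((hJc j).comp (hs s)).neg) (fun j s => ((hJc' j).comp (hs s)).neg)
    (by simpa using hBb) (by simpa using hBb') (by simpa using hJb) (by simpa using hJb')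
    (fun s _ x => by
      rw [Finset.sum_neg_distrib]; linarith [hdiv' s x])
  simp only [integral_neg, neg_le_neg_iff] at hge
  have := le_antisymm hle hge
  simpa only [h0, h1] using this

/-! ### Finite speed of propagation -/

lemma exists_bound_of_vanishing {f : ℝ × E3 → ℝ} (hf : Continuous f) {s₁ R : ℝ} {x₁ : E3}
    (h : ∀ s ∈ Icc (0 : ℝ) s₁, ∀ x ∉ Metric.closedBall x₁ R, f (s, x) = 0) :
    ∃ C, 0 ≤ C ∧ ∀ s ∈ Icc (0 : ℝ) s₁, ∀ x, pt x 0 ^ 4 * ‖f (s, x)‖ ≤ C := by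
  have hg : Continuous fun p : ℝ × E3 => pt p.2 0 ^ 4 * ‖f p‖ :=
    ((continuous_pt_zero.comp continuous_snd).pow 4).mul hf.norm
  obtain ⟨C, hC⟩ := ((isCompact_Icc (a := (0 : ℝ)) (b := s₁)).prod
    (isCompact_closedBall x₁ R)).exists_bound_of_continuousOn hg.continuousOn
  refine ⟨max C 0, le_max_right _ _, fun s hs x => ?_⟩
  by_cases hx : x ∈ Metric.closedBall x₁ R
  · exact ((le_abs_self _).trans (hC (s, x) ⟨hs, hx⟩)).trans (le_max_left _ _)
  · rw [h s hs x hx]; simp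

lemma deriv_expNegInvGlue_nonneg (r : ℝ) : 0 ≤ deriv expNegInvGlue r := by
  exact expNegInvGlue.monotone.deriv_nonneg

lemma deriv_expNegInvGlue_of_neg {r : ℝ} (hr : r < 0) : deriv expNegInvGlue r = 0 := by
  have : expNegInvGlue =ᶠ[nhds r] fun _ => 0 := by
    filter_upwards [gt_mem_nhds hr] with y hy using expNegInvGlue.zero_of_nonpos hy.le
  rw [this.deriv_eq]; simp

/-- A conserved current whose density dominates the flux propagates with at most the speed of
light: if its density vanishes at time `t₀` on the ball of radius `R` about `x₁`, it vanishes at `x₁`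
for times up to `R` later or earlier. The sign `σ` is the direction of time. -/
lemma current_eq_zero_of_initial {c : Fin 4 → Mink → ℝ} (hc : ∀ a, ContDiff ℝ ∞ (c a))
    (hdiv : ∀ y, ∑ a, fderiv ℝ (c a) y (Pi.single a 1) = 0)
    (hpos : ∀ y (w : E3), 0 ≤ pt w 0 * c 0 y + ∑ j : Fin 3, w j * c j.succ y)
    {σ : ℝ} (hσ : σ = 1 ∨ σ = -1) {t₀ s₁ R : ℝ} {x₁ : E3} (hs₁ : 0 ≤ s₁) (hR : s₁ < R)
    (h0 : ∀ x ∈ Metric.ball x₁ R, c 0 (event t₀ x) = 0) : c 0 (event (t₀ + σ * s₁) x₁) = 0 := by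
  have hσ2 : σ * σ = 1 := by rcases hσ with h | h <;> rw [h] <;> norm_num
  obtain ⟨δ, hδ, hδR⟩ : ∃ δ : ℝ, 0 < δ ∧ δ < R - s₁ :=
    ⟨(R - s₁) / 2, by linarith, by linarith⟩
  -- `ρ x = √(δ² + |x - x₁|²)` is a smooth substitute of the distance from `x₁`
  obtain ⟨y, hy⟩ : ∃ y : E3 → E3, y = fun x => δ⁻¹ • (x - x₁) := ⟨_, rfl⟩
  obtain ⟨ρ, hρ⟩ : ∃ ρ : E3 → ℝ, ρ = fun x => δ * pt (y x) 0 := ⟨_, rfl⟩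
  have hyd : ∀ x, HasFDerivAt y (δ⁻¹ • ContinuousLinearMap.id ℝ E3) x := fun x => by
    rw [hy]; exact ((hasFDerivAt_id x).sub_const x₁).const_smul δ⁻¹
  have hyc : Continuous y := continuous_iff_continuousAt.2 fun x => (hyd x).continuousAt
  have hρd : ∀ x (j : Fin 3), HasLineDerivAt ℝ ρ (y x j / pt (y x) 0) x (unitVec j) := by
    intro x j
    have h1 := (((hasFDerivAt_pt_zero (y x)).comp x (hyd x)).const_mul δ).hasLineDerivAt (unitVec j)
    rw [hρ]
    refine HasDerivAt.congr_deriv h1 ?_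
    simp [EuclideanSpace.inner_single_right]
    field_simp
  have hρc : Continuous ρ := by rw [hρ]; exact continuous_const.mul (continuous_pt_zero.comp hyc)
  have hρx : ∀ x, ‖x - x₁‖ < ρ x := by
    intro x
    have h1 := norm_lt_pt_zero (y x)
    rw [hy] at h1
    rw [hρ, hy]
    simp only [norm_smul, norm_inv, Real.norm_of_nonneg hδ.le] at h1 ⊢
    rwa [inv_mul_lt_iff₀ hδ] at h1
  have hρ0 : ρ x₁ = δ := by rw [hρ, hy]; simp [pt_zero]
  -- the cutoff `θ s` is supported in the ball of radius `R - s`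
  obtain ⟨θ, hθ⟩ : ∃ θ : ℝ → E3 → ℝ, θ = fun s x => expNegInvGlue (R - s - ρ x) := ⟨_, rfl⟩
  obtain ⟨θ', hθ'⟩ : ∃ θ' : ℝ → E3 → ℝ, θ' = fun s x => deriv expNegInvGlue (R - s - ρ x) :=
    ⟨_, rfl⟩
  have hcd : ContDiff ℝ 1 expNegInvGlue := expNegInvGlue.contDiff
  have harg : Continuous fun p : ℝ × E3 => R - p.1 - ρ p.2 :=
    (continuous_const.sub continuous_fst).sub (hρc.comp continuous_snd)
  have hθc : Continuous fun p : ℝ × E3 => θ p.1 p.2 := by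
    rw [hθ]; exact hcd.continuous.comp harg
  have hθc' : Continuous fun p : ℝ × E3 => θ' p.1 p.2 := by
    rw [hθ']; exact (hcd.continuous_deriv le_rfl).comp harg
  have hE : ∀ r, HasDerivAt expNegInvGlue (deriv expNegInvGlue r) r := fun r =>
    (hcd.differentiable (by simp) r).hasDerivAt
  have hθs : ∀ s x, HasDerivAt (fun s => θ s x) (-θ' s x) s := by
    intro s x
    have h1 : HasDerivAt (fun s : ℝ => R - s - ρ x) (-1) s := by
      simpa using ((hasDerivAt_id s).const_sub R).sub_const (ρ x)
    have h2 := (hE (R - s - ρ x)).comp s h1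
    rw [hθ, hθ']
    refine HasDerivAt.congr_deriv h2 ?_
    ring
  have hθx : ∀ s x (j : Fin 3), HasLineDerivAt ℝ (θ s) (-θ' s x * (y x j / pt (y x) 0)) x
      (unitVec j) := by
    intro s x j
    have h1 : HasDerivAt (fun t : ℝ => R - s - ρ (x + t • unitVec j))
        (-(y x j / pt (y x) 0)) 0 := HasDerivAt.const_sub (R - s) (hρd x j)
    have h2 := HasDerivAt.comp (h₂ := expNegInvGlue) (h₂' := deriv expNegInvGlue (R - s - ρ x))
      0 (by simpa using hE (R - s - ρ x)) h1
    rw [hθ, hθ']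
    refine HasDerivAt.congr_deriv h2 ?_
    ring
  have hθ0 : ∀ s, 0 ≤ s → ∀ x ∉ Metric.ball x₁ R, θ s x = 0 := by
    intro s hs x hx
    rw [Metric.mem_ball, dist_eq_norm, not_lt] at hx
    rw [hθ]
    exact expNegInvGlue.zero_of_nonpos (by linarith [hρx x])
  have hθ0' : ∀ s, 0 ≤ s → ∀ x ∉ Metric.ball x₁ R, θ' s x = 0 := by
    intro s hs x hx
    rw [Metric.mem_ball, dist_eq_norm, not_lt] at hx
    rw [hθ']
    exact deriv_expNegInvGlue_of_neg (by linarith [hρx x])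
  have hballs : ∀ x ∉ Metric.closedBall x₁ R, x ∉ Metric.ball x₁ R := fun x hx h =>
    hx (Metric.ball_subset_closedBall h)
  obtain ⟨d, hd⟩ : ∃ d : Fin 4 → Fin 4 → ℝ → E3 → ℝ, d = fun a b s x =>
    fderiv ℝ (c a) (event (t₀ + σ * s) x) (Pi.single b 1) := ⟨_, rfl⟩
  obtain ⟨e, he⟩ : ∃ e : Fin 4 → ℝ → E3 → ℝ, e = fun a s x => c a (event (t₀ + σ * s) x) :=
    ⟨_, rfl⟩
  have hev : Continuous fun p : ℝ × E3 => event (t₀ + σ * p.1) p.2 :=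
    continuous_event.comp ((by fun_prop : Continuous fun p : ℝ × E3 => t₀ + σ * p.1).prodMk
      continuous_snd)
  have hec : ∀ a, Continuous fun p : ℝ × E3 => e a p.1 p.2 := fun a => by
    rw [he]; exact (hc a).continuous.comp hev
  have hdc : ∀ a b, Continuous fun p : ℝ × E3 => d a b p.1 p.2 := fun a b => by
    rw [hd]; exact (((hc a).continuous_fderiv (by simp)).comp hev).clm_apply continuous_const
  have hs : ∀ s : ℝ, Continuous fun x : E3 => (s, x) := fun s => by fun_prop
  have hes : ∀ a s x, HasDerivAt (fun s => e a s x) (σ * d a 0 s x) s := by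
    intro a s x
    have h1 : HasDerivAt (fun s : ℝ => t₀ + σ * s) σ s := by
      simpa using ((hasDerivAt_id s).const_mul σ).const_add t₀
    rw [he, hd]
    exact hasDerivAt_event_time (hc a) x h1
  have hex : ∀ a s x (j : Fin 3), HasLineDerivAt ℝ (e a s) (d a j.succ s x) x (unitVec j) := by
    intro a s x j
    have h1 := hasLineDerivAt_event (hc a) (hasFDerivAt_const (t₀ + σ * s) x) j
    rw [he, hd]
    simpa using h1
  have hB : ∀ s x, HasDerivAt (fun s => θ s x * e 0 s x)
      (-θ' s x * e 0 s x + θ s x * (σ * d 0 0 s x)) s := fun s x => (hθs s x).mul (hes 0 s x)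
  have hJ : ∀ (j : Fin 3) s x, HasLineDerivAt ℝ (fun x => σ * (θ s x * e j.succ s x))
      (σ * (-θ' s x * (y x j / pt (y x) 0) * e j.succ s x + θ s x * d j.succ j.succ s x)) x
        (unitVec j) := by
    intro j s x
    have h1 := (HasDerivAt.mul (hθx s x j) (hex j.succ s x j)).const_mul σ
    simp only [zero_smul, add_zero] at h1
    exact h1
  have hBc' : Continuous fun p : ℝ × E3 =>
      -θ' p.1 p.2 * e 0 p.1 p.2 + θ p.1 p.2 * (σ * d 0 0 p.1 p.2) :=
    (hθc'.neg.mul (hec 0)).add (hθc.mul (continuous_const.mul (hdc 0 0)))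
  have hJc : ∀ j : Fin 3, Continuous fun p : ℝ × E3 => σ * (θ p.1 p.2 * e j.succ p.1 p.2) :=
    fun j => continuous_const.mul (hθc.mul (hec _))
  have hJc' : ∀ j : Fin 3, Continuous fun p : ℝ × E3 =>
      σ * (-θ' p.1 p.2 * (y p.2 j / pt (y p.2) 0) * e j.succ p.1 p.2
        + θ p.1 p.2 * d j.succ j.succ p.1 p.2) := fun j =>
    continuous_const.mul (((hθc'.neg.mul (Continuous.div
      ((EuclideanSpace.proj (𝕜 := ℝ) j).continuous.comp (hyc.comp continuous_snd))
      (continuous_pt_zero.comp (hyc.comp continuous_snd)) fun p => (pt_zero_pos _).ne')).mul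
        (hec _)).add (hθc.mul (hdc _ _)))
  have hBc := hθc.mul (hec 0)
  obtain ⟨C₁, hC₁, hb₁⟩ := exists_bound_of_vanishing (s₁ := s₁) (R := R) (x₁ := x₁) hBc
    fun s hs x hx => by simp [hθ0 s hs.1 x (hballs x hx)]
  obtain ⟨C₂, hC₂, hb₂⟩ := exists_bound_of_vanishing (s₁ := s₁) (R := R) (x₁ := x₁) hBc'
    fun s hs x hx => by simp [hθ0 s hs.1 x (hballs x hx), hθ0' s hs.1 x (hballs x hx)]
  choose C₃ hC₃ hb₃ using fun j => exists_bound_of_vanishing (s₁ := s₁) (R := R) (x₁ := x₁) (hJc j)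
    fun s hs x hx => by simp [hθ0 s hs.1 x (hballs x hx)]
  choose C₄ hC₄ hb₄ using fun j => exists_bound_of_vanishing (s₁ := s₁) (R := R) (x₁ := x₁) (hJc' j)
    fun s hs x hx => by simp [hθ0 s hs.1 x (hballs x hx), hθ0' s hs.1 x (hballs x hx)]
  have hC : ∀ j, C₃ j ≤ ∑ j, C₃ j ∧ C₄ j ≤ ∑ j, C₄ j := fun j =>
    ⟨Finset.single_le_sum (fun j _ => hC₃ j) (Finset.mem_univ j),
      Finset.single_le_sum (fun j _ => hC₄ j) (Finset.mem_univ j)⟩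
  have hC₃' : 0 ≤ ∑ j, C₃ j := Finset.sum_nonneg fun j _ => hC₃ j
  have hC₄' : 0 ≤ ∑ j, C₄ j := Finset.sum_nonneg fun j _ => hC₄ j
  have hle := integral_le_of_div_nonpos (B := fun s x => θ s x * e 0 s x)
    (B' := fun s x => -θ' s x * e 0 s x + θ s x * (σ * d 0 0 s x))
    (J := fun (j : Fin 3) s x => σ * (θ s x * e j.succ s x))
    (J' := fun (j : Fin 3) s x =>
      σ * (-θ' s x * (y x j / pt (y x) 0) * e j.succ s x + θ s x * d j.succ j.succ s x))
    (C := C₁ + C₂ + ∑ j, C₃ j + ∑ j, C₄ j) hs₁ hB hJ (fun s => hBc.comp (hs s)) hBc'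
    (fun j s => (hJc j).comp (hs s)) (fun j s => (hJc' j).comp (hs s))
    (fun s h x => (hb₁ s h x).trans (by linarith)) (fun s h x => (hb₂ s h x).trans (by linarith))
    (fun j s h x => (hb₃ j s h x).trans (by linarith [(hC j).1]))
    (fun j s h x => (hb₄ j s h x).trans (by linarith [(hC j).2]))
    (fun s _ x => by
      have h1 := hdiv (event (t₀ + σ * s) x)
      have h1' : d 0 0 s x + ∑ j : Fin 3, d j.succ j.succ s x = 0 := by
        rw [hd, ← h1]
        exact (Fin.sum_univ_succ fun a => fderiv ℝ (c a) (event (t₀ + σ * s) x)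
          (Pi.single a 1)).symm
      -- the gradient of `ρ` is the velocity of the point `pt (y x)`, so `hpos` makes the flux through
      -- the shrinking level sets of `θ` point outwards
      have h2 := hpos (event (t₀ + σ * s) x) (σ • y x)
      have h3 : pt (σ • y x) 0 = pt (y x) 0 := by
        rcases hσ with h | h <;> simp [h, pt_zero_neg]
      have h4 : 0 ≤ e 0 s x + ∑ j : Fin 3, σ * (y x j / pt (y x) 0) * e j.succ s x := by
        have hp := pt_zero_pos (y x)
        have : e 0 s x + ∑ j : Fin 3, σ * (y x j / pt (y x) 0) * e j.succ s x
            = (pt (y x) 0 * e 0 s x + ∑ j : Fin 3, (σ • y x) j * e j.succ s x) / pt (y x) 0 := by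
          simp only [Fin.sum_univ_three, PiLp.smul_apply, smul_eq_mul]
          field_simp
        rw [this]
        refine div_nonneg ?_ hp.le
        rw [he, ← h3]
        exact h2
      have h5 : 0 ≤ θ' s x := by rw [hθ']; exact deriv_expNegInvGlue_nonneg _
      have h6 := mul_nonneg h5 h4
      simp only [Fin.sum_univ_three] at h1' h6 ⊢
      linear_combination h6 + θ s x * σ * h1')
  have hz : ∫ x, θ 0 x * e 0 0 x = 0 := by
    refine integral_eq_zero_of_ae (Filter.Eventually.of_forall fun x => ?_)
    by_cases hx : x ∈ Metric.ball x₁ R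
    · have := h0 x hx
      simp [he, this]
    · simp [hθ0 0 le_rfl x hx]
  have hc0 : ∀ y, 0 ≤ c 0 y := fun y => by simpa [pt_zero] using hpos y 0
  have hnn : ∀ x, 0 ≤ θ s₁ x * e 0 s₁ x := fun x => by
    rw [hθ, he]; exact mul_nonneg (expNegInvGlue.nonneg _) (hc0 _)
  have hcont : Continuous fun x => θ s₁ x * e 0 s₁ x := hBc.comp (hs s₁)
  have hint : Integrable fun x => θ s₁ x * e 0 s₁ x :=
    integrable_of_pow_four_mul_le hcont.aestronglyMeasurable
      (hb₁ s₁ (right_mem_Icc.2 hs₁))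
  have h7 : ∫ x, θ s₁ x * e 0 s₁ x = 0 :=
    le_antisymm (hle.trans hz.le) (integral_nonneg hnn)
  have h8 := (integral_eq_zero_iff_of_nonneg hnn hint).1 h7
  have h9 := congrFun ((hcont.ae_eq_iff_eq volume continuous_const).1 h8) x₁
  have h10 : 0 < θ s₁ x₁ := by
    rw [hθ]; exact expNegInvGlue.pos_of_pos (by rw [hρ0]; linarith)
  have h11 := (mul_eq_zero.1 h9).resolve_left h10.ne'
  rw [he] at h11
  exact h11

/-! ### Test functions and decay of their plane wave superpositions -/

lemma mulVec_mem_testFun {A : E3 → Matrix (Fin 4) (Fin 4) ℂ} (hA : ∀ i j, ContDiff ℝ ∞ fun x => A x i j)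
    {f : E3 → Spinor} (hf : f ∈ TestFun) : (fun x => A x *ᵥ f x) ∈ TestFun := by
  refine ⟨contDiff_mulVec hA hf.1, HasCompactSupport.intro hf.2 fun x hx => ?_⟩
  rw [image_eq_zero_of_notMem_tsupport hx, Matrix.mulVec_zero]

lemma smul_mem_testFun {c : E3 → ℂ} (hc : ContDiff ℝ ∞ c) {f : E3 → Spinor} (hf : f ∈ TestFun) :
    (fun x => c x • f x) ∈ TestFun := by
  refine ⟨contDiff_pi.2 fun i => hc.mul (contDiff_pi.1 hf.1 i),
    HasCompactSupport.intro hf.2 fun x hx => ?_⟩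
  rw [image_eq_zero_of_notMem_tsupport hx, smul_zero]

lemma momentum_mem_testFun {f : E3 → Spinor} (hf : f ∈ TestFun) (b : Fin 4) :
    momentum b f ∈ TestFun :=
  smul_mem_testFun (contDiff_const.mul (Complex.ofRealCLM.contDiff.comp
    (contDiff_const.mul (contDiff_pi.1 contDiff_pt b)))) hf

lemma rapidDecay_of_mem_testFun {f : E3 → Spinor} (hf : f ∈ TestFun) : RapidDecay f :=
  RapidDecay.of_hasCompactSupport hf.1.continuous hf.2

lemma contDiff_inv_pt_zero : ContDiff ℝ ∞ fun z : E3 => ((1 / pt z 0 : ℝ) : ℂ) :=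
  Complex.ofRealCLM.contDiff.comp
    (contDiff_const.div contDiff_pt_zero fun z => (pt_zero_pos z).ne')

lemma norm_waves_le (a : E3 → Spinor) (x : Mink) : ‖waves a x‖ ≤ ∫ z, ‖a z‖ := by
  refine (norm_integral_le_integral_norm _).trans (le_of_eq ?_)
  simp only [norm_smul, norm_cexp_I_mul, one_mul]

/-- Between the plane `x⁰ = 0` and a hyperboloid, superpositions of plane waves with compactly
supported smooth amplitudes decay faster than any power. -/
lemma waves_decay {a : E3 → Spinor} (ha : a ∈ TestFun) {c : ℝ} (hc : c ≠ 0) (N : ℕ) :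
    ∃ C, ∀ s ∈ Icc (0 : ℝ) 1, ∀ x : E3,
      pt x 0 ^ N * ‖waves a (c • event (s * pt x 0) x)‖ ≤ C := by
  obtain ⟨β, hβ, h⟩ := oscillatory_decay ha.1 ha.2
  obtain ⟨C, hC⟩ := h N
  have hβ0 : 0 < β := by linarith
  have hβ2 : 0 < β ^ 2 - 1 := by nlinarith
  have hc' : 0 < |c| := abs_pos.2 hc
  have hC0 : 0 ≤ C := le_trans (by positivity) (hC 0 0 (by simp))
  have hI : 0 ≤ ∫ z, ‖a z‖ := integral_nonneg fun z => norm_nonneg _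
  refine ⟨(β / |c|) ^ N * C + (β ^ 2 / (β ^ 2 - 1)) ^ N * ∫ z, ‖a z‖, fun s hs x => ?_⟩
  have hp := pt_zero_pos x
  -- the part of the region that the oscillatory estimate does not cover is bounded
  by_cases hx : pt x 0 ≤ β * ‖x‖
  · have h1 : |c * (s * pt x 0)| ≤ β * ‖c • x‖ := by
      rw [abs_mul, norm_smul, Real.norm_eq_abs, abs_mul, abs_of_nonneg hs.1, abs_of_pos hp]
      calc |c| * (s * pt x 0) ≤ |c| * (1 * (β * ‖x‖)) := by gcongr; exact hs.2
        _ = _ := by ring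
    have h2 := hC _ _ h1
    rw [← waves_event, ← smul_event] at h2
    have h3 : pt x 0 ≤ β / |c| * ‖c • x‖ := by
      rw [norm_smul, Real.norm_eq_abs]
      calc pt x 0 ≤ β * ‖x‖ := hx
        _ = _ := by field_simp
    calc pt x 0 ^ N * ‖waves a (c • event (s * pt x 0) x)‖
        ≤ (β / |c| * ‖c • x‖) ^ N * ‖waves a (c • event (s * pt x 0) x)‖ := by gcongr
      _ = (β / |c|) ^ N * (‖c • x‖ ^ N * ‖waves a (c • event (s * pt x 0) x)‖) := by
          rw [mul_pow]; ring
      _ ≤ (β / |c|) ^ N * C := by gcongr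
      _ ≤ _ := le_add_of_nonneg_right (by positivity)
  · have h1 : pt x 0 ≤ β ^ 2 / (β ^ 2 - 1) := by
      rw [le_div_iff₀ hβ2]
      have h2 := pt_zero_sq x
      have h3 := one_le_pt_zero x
      have h4 : (β * ‖x‖) ^ 2 ≤ pt x 0 ^ 2 := by
        have : 0 ≤ β * ‖x‖ := by positivity
        exact pow_le_pow_left₀ this (not_le.1 hx).le 2
      have h5 : pt x 0 ^ 2 * (β ^ 2 - 1) ≤ β ^ 2 := by nlinarith
      nlinarith
    calc pt x 0 ^ N * ‖waves a (c • event (s * pt x 0) x)‖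
        ≤ (β ^ 2 / (β ^ 2 - 1)) ^ N * ∫ z, ‖a z‖ := by
          gcongr; exact norm_waves_le _ _
      _ ≤ _ := le_add_of_nonneg_left (by positivity)

/-! ### The Dirac current -/

/-- The real bilinear form `Re v†Aw` on spinors. -/
noncomputable def hermForm (A : Matrix (Fin 4) (Fin 4) ℂ) : Spinor →L[ℝ] Spinor →L[ℝ] ℝ :=
  LinearMap.toContinuousBilinearMap (LinearMap.mk₂ ℝ (fun v w => (star v ⬝ᵥ (A *ᵥ w)).re)
    (fun v v' w => by simp [add_dotProduct])
    (fun c v w => by simp)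
    (fun v w w' => by simp [Matrix.mulVec_add, dotProduct_add])
    (fun c v w => by simp [Matrix.mulVec_smul]))

lemma hermForm_apply (A : Matrix (Fin 4) (Fin 4) ℂ) (v w : Spinor) :
    hermForm A v w = (star v ⬝ᵥ (A *ᵥ w)).re := rfl

lemma star_dotProduct_mulVec_comm {A : Matrix (Fin 4) (Fin 4) ℂ} (hA : Aᴴ = A) (v w : Spinor) :
    star w ⬝ᵥ (A *ᵥ v) = star (star v ⬝ᵥ (A *ᵥ w)) := by
  rw [Matrix.star_dotProduct, Matrix.star_mulVec, hA, ← Matrix.dotProduct_mulVec]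

lemma hermForm_comm {A : Matrix (Fin 4) (Fin 4) ℂ} (hA : Aᴴ = A) (v w : Spinor) :
    hermForm A v w = hermForm A w v := by
  rw [hermForm_apply, hermForm_apply, star_dotProduct_mulVec_comm hA v w]; simp

lemma hermForm_one_self (v : Spinor) :
    hermForm 1 v v = ‖(WithLp.toLp 2 v : EuclideanSpace ℂ (Fin 4))‖ ^ 2 := by
  rw [hermForm_apply, Matrix.one_mulVec, EuclideanSpace.norm_sq_eq,
    dotProduct, Complex.re_sum]
  refine Finset.sum_congr rfl fun i _ => ?_
  simp only [Pi.star_apply, Complex.star_def]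
  rw [← Complex.normSq_eq_conj_mul_self, Complex.ofReal_re, Complex.normSq_eq_norm_sq]

namespace DiracMatrices
variable (D : DiracMatrices)

lemma γ_zero_mul_conjTranspose (a : Fin 4) : (D.γ 0 * D.γ a)ᴴ = D.γ 0 * D.γ a := by
  have h := D.γ_zero_sq
  rw [Matrix.conjTranspose_mul, D.herm, D.herm, h, one_mul, mul_assoc, h, mul_one]

/-- The current `ψ̄ γᵃ ψ`. -/
noncomputable def current (ψ : Mink → Spinor) (a : Fin 4) (x : Mink) : ℝ :=
  hermForm (D.γ 0 * D.γ a) (ψ x) (ψ x)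

lemma contDiff_current {ψ : Mink → Spinor} (hψ : ContDiff ℝ ∞ ψ) (a : Fin 4) :
    ContDiff ℝ ∞ (D.current ψ a) :=
  ((hermForm (D.γ 0 * D.γ a)).contDiff.comp hψ).clm_apply hψ

lemma fderiv_current {ψ : Mink → Spinor} (hψ : ContDiff ℝ ∞ ψ) (a : Fin 4) (x v : Mink) :
    fderiv ℝ (D.current ψ a) x v = 2 * hermForm (D.γ 0 * D.γ a) (ψ x) (fderiv ℝ ψ x v) := by
  have h := (hψ.differentiable (by simp) x).hasFDerivAt
  have h1 := (hermForm (D.γ 0 * D.γ a)).hasFDerivAt_of_bilinear h h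
  rw [show D.current ψ a = fun x => hermForm (D.γ 0 * D.γ a) (ψ x) (ψ x) from rfl, h1.fderiv]
  have h2 := hermForm_comm (D.γ_zero_mul_conjTranspose a) (fderiv ℝ ψ x v) (ψ x)
  change hermForm (D.γ 0 * D.γ a) (ψ x) (fderiv ℝ ψ x v)
    + hermForm (D.γ 0 * D.γ a) (fderiv ℝ ψ x v) (ψ x) = _
  rw [h2]
  ring

lemma IsGlobalSolution.div_current {M : ℝ} {ψ : Mink → Spinor} (h : D.IsGlobalSolution M ψ)
    (x : Mink) : ∑ a, fderiv ℝ (D.current ψ a) x (Pi.single a 1) = 0 := by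
  have h1 : ∑ a, fderiv ℝ (D.current ψ a) x (Pi.single a 1)
      = 2 * (star (ψ x) ⬝ᵥ (D.γ 0 *ᵥ ∑ a, D.γ a *ᵥ fderiv ℝ ψ x (Pi.single a 1))).re := by
    simp only [D.fderiv_current h.1, ← Finset.mul_sum, hermForm_apply, Matrix.mulVec_sum,
      dotProduct_sum, Complex.re_sum, Matrix.mulVec_mulVec]
  have h2 : ∑ a, D.γ a *ᵥ fderiv ℝ ψ x (Pi.single a 1) = (-Complex.I * M) • ψ x := by
    have h3 := congrArg (fun v => -Complex.I • v) (h.2 x)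
    simp only [smul_smul] at h3
    simpa using h3
  have h4 : (star (ψ x) ⬝ᵥ (D.γ 0 *ᵥ ψ x)).im = 0 := by
    have h5 := congrArg Complex.im (star_dotProduct_mulVec_comm (A := D.γ 0)
      (by rw [D.herm 0, D.γ_zero_sq, one_mul]) (ψ x) (ψ x))
    rw [Complex.star_def, Complex.conj_im] at h5
    linarith
  rw [h1, h2, Matrix.mulVec_smul, dotProduct_smul, smul_eq_mul]
  simp [Complex.mul_re, h4]

lemma density_eq_sum (y : E3) (v w : Spinor) :
    (D.density y v w).re = pt y 0 * hermForm (D.γ 0 * D.γ 0) v w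
      - ∑ j : Fin 3, y j * hermForm (D.γ 0 * D.γ j.succ) v w := by
  rw [density, ← Matrix.mulVec_mulVec, D.slash_mulVec, Matrix.mulVec_sum, dotProduct_sum,
    Complex.re_sum, Fin.sum_univ_succ, sub_eq_add_neg, ← Finset.sum_neg_distrib]
  simp only [Matrix.mulVec_smul, dotProduct_smul, smul_eq_mul, Complex.re_ofReal_mul,
    hermForm_apply, Matrix.mulVec_mulVec, pt_succ, sgn, Fin.succ_ne_zero, if_true, if_false]
  congr 1
  · ring
  · exact Finset.sum_congr rfl fun j _ => by ring

lemma current_pos (ψ : Mink → Spinor) (y : Mink) (w : E3) :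
    0 ≤ pt w 0 * D.current ψ 0 y + ∑ j : Fin 3, w j * D.current ψ j.succ y := by
  have h1 := D.density_eq_sum (-w) (ψ y) (ψ y)
  have h2 : 0 ≤ (D.density (-w) (ψ y) (ψ y)).re := by
    rw [D.density_self (fun _ => ψ y) (-w), Complex.ofReal_re]
    positivity
  rw [h1, pt_zero_neg] at h2
  simpa [current] using h2

lemma flux_density (ψ : Mink → Spinor) (x : E3) (y : Mink) :
    D.current ψ 0 y - ∑ j : Fin 3, x j / pt x 0 * D.current ψ j.succ y
      = 1 / pt x 0 * (D.density x (ψ y) (ψ y)).re := by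
  have := pt_zero_pos x
  rw [density_eq_sum, mul_sub, Finset.mul_sum, ← mul_assoc, one_div_mul_cancel this.ne', one_mul]
  congr 1
  exact Finset.sum_congr rfl fun j _ => by simp only [current]; ring

lemma current_zero (ψ : Mink → Spinor) (y : Mink) :
    D.current ψ 0 y = ‖(WithLp.toLp 2 (ψ y) : EuclideanSpace ℂ (Fin 4))‖ ^ 2 := by
  rw [current, D.γ_zero_sq, hermForm_one_self]

/-- Solutions of the Dirac equation propagate with at most the speed of light. -/
lemma IsGlobalSolution.eq_zero_of_initial {M : ℝ} {ψ : Mink → Spinor} (h : D.IsGlobalSolution M ψ)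
    {t₀ t₁ R : ℝ} {x₁ : E3} (hR : |t₁ - t₀| < R)
    (h0 : ∀ x ∈ Metric.ball x₁ R, ψ (event t₀ x) = 0) : ψ (event t₁ x₁) = 0 := by
  have h1 : ∀ y, D.current ψ 0 y = 0 ↔ ψ y = 0 := by
    intro y
    rw [current_zero, sq_eq_zero_iff, norm_eq_zero, WithLp.toLp_eq_zero]
  obtain ⟨σ, hσ, hσt⟩ : ∃ σ : ℝ, (σ = 1 ∨ σ = -1) ∧ t₀ + σ * |t₁ - t₀| = t₁ := by
    rcases le_total 0 (t₁ - t₀) with h2 | h2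
    · exact ⟨1, Or.inl rfl, by rw [abs_of_nonneg h2]; ring⟩
    · exact ⟨-1, Or.inr rfl, by rw [abs_of_nonpos h2]; ring⟩
  rw [← h1, ← hσt]
  exact current_eq_zero_of_initial (D.contDiff_current h.1) h.div_current (D.current_pos ψ) hσ
    (abs_nonneg _) hR fun x hx => (h1 _).2 (h0 x hx)

lemma part_mem_testFun {g : E3 → Spinor} (hg : g ∈ TestFun) (s : ℂ) : D.part s g ∈ TestFun := by
  have h1 : (fun z => D.slash (pt z) *ᵥ g z) + s • g ∈ TestFun :=
    TestFun.add_mem (mulVec_mem_testFun D.contDiff_slash hg) (TestFun.smul_mem s hg)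
  have h2 := smul_mem_testFun (contDiff_const (c := (1 / 2 : ℂ)) |>.mul contDiff_inv_pt_zero) h1
  convert h2 using 1
  ext1 z
  simp only [part, Pi.add_apply, Pi.smul_apply]
  congr 1
  push_cast
  field_simp

lemma field_decay {g : E3 → Spinor} (hg : g ∈ TestFun) {κ : ℝ} (hκ : κ ≠ 0) (N : ℕ) :
    ∃ C, ∀ s ∈ Icc (0 : ℝ) 1, ∀ x : E3,
      pt x 0 ^ N * ‖D.field g (κ • event (s * pt x 0) x)‖ ≤ C := by
  obtain ⟨C, hC⟩ := waves_decay (D.part_mem_testFun hg (-1)) hκ N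
  obtain ⟨C', hC'⟩ := waves_decay (D.part_mem_testFun hg 1) (neg_ne_zero.2 hκ) N
  refine ⟨C + C', fun s hs x => ?_⟩
  have := pt_zero_pos x
  rw [D.field_eq_waves (rapidDecay_of_mem_testFun hg), ← neg_smul]
  calc _ ≤ pt x 0 ^ N * (‖waves (D.part (-1) g) (κ • event (s * pt x 0) x)‖
        + ‖waves (D.part 1 g) ((-κ) • event (s * pt x 0) x)‖) := by
        gcongr; exact norm_add_le _ _
    _ ≤ C + C' := by rw [mul_add]; exact add_le_add (hC s hs x) (hC' s hs x)

lemma fderiv_field_decay {g : E3 → Spinor} (hg : g ∈ TestFun) {κ : ℝ} (hκ : κ ≠ 0) (N : ℕ)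
    (b : Fin 4) : ∃ C, ∀ s ∈ Icc (0 : ℝ) 1, ∀ x : E3,
      pt x 0 ^ N * ‖fderiv ℝ (D.field g) (κ • event (s * pt x 0) x) (Pi.single b 1)‖ ≤ C := by
  obtain ⟨C, hC⟩ := waves_decay (momentum_mem_testFun (D.part_mem_testFun hg (-1)) b) hκ N
  obtain ⟨C', hC'⟩ := waves_decay (momentum_mem_testFun (D.part_mem_testFun hg 1) b)
    (neg_ne_zero.2 hκ) N
  refine ⟨C + C', fun s hs x => ?_⟩
  have := pt_zero_pos x
  rw [D.fderiv_field (rapidDecay_of_mem_testFun hg), ← neg_smul]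
  calc _ ≤ pt x 0 ^ N * (‖waves (momentum b (D.part (-1) g)) (κ • event (s * pt x 0) x)‖
        + ‖waves (momentum b (D.part 1 g)) ((-κ) • event (s * pt x 0) x)‖) := by
        gcongr; exact norm_sub_le _ _
    _ ≤ C + C' := by rw [mul_add]; exact add_le_add (hC s hs x) (hC' s hs x)

end DiracMatrices

/-! ### The isometry property on test functions -/

section
variable {E : Type*} [NormedAddCommGroup E] [NormedSpace ℂ E]

/-- The Fourier integral of a function of the space coordinates. -/
noncomputable def spaceFourier (a : E3 → E) (x : E3) : E :=
  ∫ z, Complex.exp (Complex.I * (-inner ℝ x z : ℝ)) • a z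

lemma fourier_eq_spaceFourier (a : E3 → E) (x : E3) : 𝓕 a x = spaceFourier a ((2 * Real.pi) • x) := by
  rw [Real.fourier_eq', spaceFourier]
  congr 1
  ext1 z
  congr 2
  rw [real_inner_smul_left, real_inner_comm]
  push_cast
  ring

lemma waves_event_zero (a : E3 → E) (x : E3) : waves a (event 0 x) = spaceFourier a x := by
  rw [waves_event, spaceFourier]
  simp

lemma spaceFourier_neg (a : E3 → E) (x : E3) :
    spaceFourier a (-x) = spaceFourier (fun z => a (-z)) x := by
  rw [spaceFourier, spaceFourier, ← integral_neg_eq_self]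
  simp

end

lemma integral_comp_smul_E3 (f : E3 → ℝ) {R : ℝ} (hR : 0 < R) :
    ∫ x, f x = R ^ 3 * ∫ x, f (R • x) := by
  rw [Measure.integral_comp_smul_of_nonneg volume f R (hR := hR.le)]
  simp only [finrank_euclideanSpace, Fintype.card_fin, smul_eq_mul]
  field_simp

/-- Plancherel's theorem for smooth functions of compact support. -/
lemma integral_norm_sq_spaceFourier {G : E3 → Spinor} (hG : G ∈ TestFun) {κ : ℝ} (hκ : 0 < κ) :
    ∫ x, ‖(WithLp.toLp 2 (spaceFourier G (κ • x)) : EuclideanSpace ℂ (Fin 4))‖ ^ 2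
      = (2 * Real.pi / κ) ^ 3 * ∫ z, ‖(WithLp.toLp 2 (G z) : EuclideanSpace ℂ (Fin 4))‖ ^ 2 := by
  set e : Spinor →L[ℂ] EuclideanSpace ℂ (Fin 4) :=
    (PiLp.continuousLinearEquiv 2 ℂ fun _ : Fin 4 => ℂ).symm.toContinuousLinearMap
  have hGs : ContDiff ℝ ∞ fun z => e (G z) := e.restrictScalars ℝ |>.contDiff.comp hG.1
  have hGc : HasCompactSupport fun z => e (G z) := HasCompactSupport.intro hG.2 fun z hz => by
    rw [image_eq_zero_of_notMem_tsupport hz, map_zero]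
  have hP := SchwartzMap.integral_norm_sq_fourier (hGc.toSchwartzMap hGs)
  have h1 : ∀ w, (𝓕 (hGc.toSchwartzMap hGs)) w
      = e (spaceFourier G ((2 * Real.pi) • w)) := by
    intro w
    rw [SchwartzMap.fourier_coe]
    change 𝓕 (fun z => e (G z)) w = _
    rw [fourier_eq_spaceFourier, spaceFourier, spaceFourier, ← e.integral_comp_comm]
    · simp only [map_smul]
    · have := (rapidDecay_of_mem_testFun hG).wave_smul (event 0 ((2 * Real.pi) • w))
      simp only [mdot_event_pt, zero_mul, zero_sub] at this
      exact this.integrable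
  simp only [h1] at hP
  have hpi := Real.pi_pos
  rw [integral_comp_smul_E3 _ (show 0 < 2 * Real.pi / κ by positivity)]
  congr 1
  simp only [smul_smul, mul_div_cancel₀ _ hκ.ne']
  exact hP

namespace DiracMatrices
variable (D : DiracMatrices)

lemma slash_pt_add_neg (z : E3) :
    D.slash (pt z) + D.slash (pt (-z)) = (2 * pt z 0 : ℂ) • D.γ 0 := by
  simp only [slash, ← Finset.sum_add_distrib, ← add_smul]
  rw [Fin.sum_univ_succ]
  simp only [pt_succ, PiLp.neg_apply, sgn, if_true, pt_zero_neg]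
  rw [Finset.sum_eq_zero]
  · rw [add_zero]; congr 1; push_cast; ring
  · intro j _
    rw [← Complex.ofReal_add]
    simp

/-- Space reflection turns `γ·z` into its hermitian conjugate. -/
lemma slash_pt_neg (z : E3) : D.slash (pt (-z)) = (D.slash (pt z))ᴴ := by
  have h1 := D.slash_pt_add_neg z
  have h2 := D.slash_γ_zero (pt z)
  rw [slash_conjTranspose, mul_assoc, h2, mul_sub, ← mul_assoc, γ_zero_sq, one_mul,
    mul_smul_comm, mul_one]
  rw [← h1]; abel

lemma hermForm_one_mulVec (A B : Matrix (Fin 4) (Fin 4) ℂ) (v w : Spinor) :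
    hermForm 1 (A *ᵥ v) (B *ᵥ w) = hermForm (Aᴴ * B) v w := by
  rw [hermForm_apply, hermForm_apply, Matrix.one_mulVec, Matrix.star_mulVec,
    ← Matrix.dotProduct_mulVec, Matrix.mulVec_mulVec]

/-- The amplitudes of positive and negative frequency at opposite momenta are orthogonal. -/
lemma hermForm_part_part_neg (g h : E3 → Spinor) (z : E3) :
    hermForm 1 (D.part (-1) g z) (D.part 1 h (-z)) = 0 := by
  have h1 : D.part (-1) g z
      = (((1 / (2 * pt z 0) : ℝ) : ℂ) • (D.slash (pt z) - 1)) *ᵥ g z := by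
    rw [part, Matrix.smul_mulVec, Matrix.sub_mulVec, Matrix.one_mulVec, neg_one_smul,
      sub_eq_add_neg]
  have h2 : D.part 1 h (-z)
      = (((1 / (2 * pt (-z) 0) : ℝ) : ℂ) • ((D.slash (pt z))ᴴ + 1)) *ᵥ h (-z) := by
    rw [part, Matrix.smul_mulVec, Matrix.add_mulVec, Matrix.one_mulVec, one_smul, slash_pt_neg]
  have h3 : (D.slash (pt z))ᴴ * (D.slash (pt z))ᴴ = 1 := by
    rw [← slash_pt_neg, slash_pt_sq]
  rw [h1, h2, hermForm_one_mulVec, Matrix.conjTranspose_smul, smul_mul_smul_comm,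
    Matrix.conjTranspose_sub, Matrix.conjTranspose_one]
  have h4 : ((D.slash (pt z))ᴴ - 1) * ((D.slash (pt z))ᴴ + 1) = 0 := by
    rw [sub_mul, mul_add, h3, mul_one, one_mul]; abel
  rw [h4, smul_zero, hermForm_apply, Matrix.zero_mulVec]
  simp

/-- The charge densities of the parts of positive and negative frequency add up to the density of `g`
with respect to Lebesgue measure. -/
lemma hermForm_part_add (g : E3 → Spinor) (z : E3) :
    hermForm 1 (D.part (-1) g z) (D.part (-1) g z) + hermForm 1 (D.part 1 g z) (D.part 1 g z)
      = 1 / pt z 0 * (D.density z (g z) (g z)).re := by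
  have hp := pt_zero_pos z
  have h0 : ∀ (r : ℝ) (v : Spinor), hermForm 1 ((r : ℂ) • v) ((r : ℂ) • v)
      = r ^ 2 * hermForm 1 v v := by
    intro r v
    rw [Complex.coe_smul, map_smul, map_smul]
    simp only [smul_apply, smul_eq_mul]
    ring
  have h1 : ∀ v w : Spinor, hermForm 1 (v + (-1 : ℂ) • w) (v + (-1 : ℂ) • w)
      + hermForm 1 (v + (1 : ℂ) • w) (v + (1 : ℂ) • w)
      = 2 * (hermForm 1 v v + hermForm 1 w w) := by
    intro v w
    rw [neg_one_smul, one_smul]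
    simp only [map_add, map_neg, _root_.add_apply, _root_.neg_apply]
    ring
  have h2 : (D.slash (pt z))ᴴ * D.slash (pt z) = (2 * pt z 0 : ℂ) • D.wt z - 1 := by
    rw [← wt_sq, slash_conjTranspose, wt]; simp only [mul_assoc]
  have h3 : hermForm 1 (D.slash (pt z) *ᵥ g z) (D.slash (pt z) *ᵥ g z) + hermForm 1 (g z) (g z)
      = 2 * pt z 0 * (D.density z (g z) (g z)).re := by
    rw [hermForm_one_mulVec, h2]
    simp only [hermForm_apply, Matrix.sub_mulVec, Matrix.smul_mulVec, dotProduct_sub,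
      dotProduct_smul, smul_eq_mul, Complex.sub_re, sub_add_cancel]
    rw [density, ← wt, ← Complex.ofReal_ofNat, ← Complex.ofReal_mul, Complex.re_ofReal_mul]
  rw [part, part, h0, h0, ← mul_add, h1, h3]
  field_simp

/-- The spatial Fourier amplitude at time zero of the field with amplitude `g`. -/
noncomputable def initialAmplitude (g : E3 → Spinor) (z : E3) : Spinor :=
  D.part (-1) g z + D.part 1 g (-z)

lemma comp_neg_mem_testFun {f : E3 → Spinor} (hf : f ∈ TestFun) : (fun z => f (-z)) ∈ TestFun :=
  ⟨hf.1.comp contDiff_neg, hf.2.comp_homeomorph (Homeomorph.neg E3)⟩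

lemma field_event_zero {g : E3 → Spinor} (hg : g ∈ TestFun) (x : E3) :
    D.field g (event 0 x) = spaceFourier (D.initialAmplitude g) x := by
  have h1 := rapidDecay_of_mem_testFun (D.part_mem_testFun hg (-1))
  have h2 := rapidDecay_of_mem_testFun (comp_neg_mem_testFun (D.part_mem_testFun hg 1))
  rw [D.field_eq_waves (rapidDecay_of_mem_testFun hg), neg_event, neg_zero, waves_event_zero,
    waves_event_zero, spaceFourier_neg, ← waves_event_zero, ← waves_event_zero,
    ← waves_event_zero]
  exact (waves_add h1 h2 _).symm

/-- The charge of the field with amplitude `g`, as an integral over spatial momenta, is the squared norm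
of `g`. -/
lemma integral_norm_sq_initialAmplitude {g : E3 → Spinor} (hg : g ∈ TestFun) :
    ∫ z, ‖(WithLp.toLp 2 (D.initialAmplitude g z) : EuclideanSpace ℂ (Fin 4))‖ ^ 2
      = ∫ z, (D.density z (g z) (g z)).re ∂hypMeasure := by
  have hint : ∀ {a : E3 → Spinor}, a ∈ TestFun → Integrable fun z => hermForm 1 (a z) (a z) := by
    intro a ha
    refine Continuous.integrable_of_hasCompactSupport
      (((hermForm 1).continuous.comp ha.1.continuous).clm_apply ha.1.continuous)
      (HasCompactSupport.intro ha.2 fun z hz => ?_)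
    rw [image_eq_zero_of_notMem_tsupport hz]; simp
  have h1 := D.part_mem_testFun hg (-1)
  have h2 := D.part_mem_testFun hg 1
  have h3 : ∀ z, ‖(WithLp.toLp 2 (D.initialAmplitude g z) : EuclideanSpace ℂ (Fin 4))‖ ^ 2
      = hermForm 1 (D.part (-1) g z) (D.part (-1) g z)
        + hermForm 1 (D.part 1 g (-z)) (D.part 1 g (-z)) := by
    intro z
    have h4 := D.hermForm_part_part_neg g g z
    have h5 := hermForm_comm (A := 1) Matrix.conjTranspose_one (D.part (-1) g z)
      (D.part 1 g (-z))
    rw [← hermForm_one_self, initialAmplitude]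
    simp only [map_add, _root_.add_apply]
    linarith
  simp only [h3]
  rw [integral_add (hint h1) (hint (comp_neg_mem_testFun h2)),
    integral_neg_eq_self (fun z => hermForm 1 (D.part 1 g z) (D.part 1 g z)),
    ← integral_add (hint h1) (hint h2), integral_hypMeasure]
  simp only [D.hermForm_part_add, smul_eq_mul]

/-- The transformation `F_κ` is isometric on test functions: by conservation of the current, the
flux through the hyperboloid equals the charge on the plane `x⁰ = 0`, which Plancherel's theorem
gives. -/
lemma integral_density_fourier {g : E3 → Spinor} (hg : g ∈ TestFun) {κ : ℝ} (hκ : 0 < κ) :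
    ∫ y, (D.density y (D.fourier κ g y) (D.fourier κ g y)).re ∂hypMeasure
      = ∫ z, (D.density z (g z) (g z)).re ∂hypMeasure := by
  have hr := rapidDecay_of_mem_testFun hg
  obtain ⟨ψ, hψ⟩ : ∃ ψ : Mink → Spinor, ψ = fun x => D.field g (κ • x) := ⟨_, rfl⟩
  have hsol : D.IsGlobalSolution (κ * 1) ψ := by
    rw [hψ]; exact (D.isGlobalSolution_field hr).comp_smul D κ
  -- the current is quadratic in `ψ`, so cubic decay of `ψ` and its derivatives gives enough decay
  obtain ⟨C, hC⟩ := D.field_decay hg hκ.ne' 3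
  have hder : ∀ b, ∃ C, ∀ s ∈ Icc (0 : ℝ) 1, ∀ x : E3,
      pt x 0 ^ 3 * ‖fderiv ℝ ψ (event (s * pt x 0) x) (Pi.single b 1)‖ ≤ C := by
    intro b
    obtain ⟨C, hC⟩ := D.fderiv_field_decay hg hκ.ne' 3 b
    refine ⟨κ * C, fun s hs x => ?_⟩
    have h1 : fderiv ℝ ψ (event (s * pt x 0) x) (Pi.single b 1)
        = κ • fderiv ℝ (D.field g) (κ • event (s * pt x 0) x) (Pi.single b 1) := by
      have := (((D.contDiff_field hr).differentiable (by simp)) (κ • event (s * pt x 0) x)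
        ).hasFDerivAt.comp (event (s * pt x 0) x) ((hasFDerivAt_id _).const_smul κ)
      rw [hψ, show (fun x => D.field g (κ • x)) = D.field g ∘ HSMul.hSMul κ from rfl, this.fderiv]
      simp
    rw [h1, norm_smul, Real.norm_of_nonneg hκ.le]
    calc _ = κ * (pt x 0 ^ 3 *
          ‖fderiv ℝ (D.field g) (κ • event (s * pt x 0) x) (Pi.single b 1)‖) := by ring
      _ ≤ κ * C := by gcongr; exact hC s hs x
  choose C' hC' using hder
  have hflux := flux_plane_eq_flux_hyperboloid (c := D.current ψ)
    (fun a => D.contDiff_current hsol.1 a) hsol.div_current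
    (C := (∑ a, ‖hermForm (D.γ 0 * D.γ a)‖) * (|C| * |C| + ∑ b, 2 * (|C| * |C' b|)))
    (fun a s hs x => by
      have hp := one_le_pt_zero x
      have h1 : pt x 0 ^ 3 * ‖ψ (event (s * pt x 0) x)‖ ≤ |C| := by
        rw [hψ]; exact (hC s hs x).trans (le_abs_self _)
      calc pt x 0 ^ 5 * ‖D.current ψ a (event (s * pt x 0) x)‖
          ≤ pt x 0 ^ 6 * (‖hermForm (D.γ 0 * D.γ a)‖ * ‖ψ (event (s * pt x 0) x)‖
            * ‖ψ (event (s * pt x 0) x)‖) := by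
            gcongr
            · norm_num
            · exact (hermForm (D.γ 0 * D.γ a)).le_opNorm₂ _ _
        _ = ‖hermForm (D.γ 0 * D.γ a)‖ * ((pt x 0 ^ 3 * ‖ψ (event (s * pt x 0) x)‖)
            * (pt x 0 ^ 3 * ‖ψ (event (s * pt x 0) x)‖)) := by ring
        _ ≤ (∑ a, ‖hermForm (D.γ 0 * D.γ a)‖) * (|C| * |C|) := by
            gcongr
            exact Finset.single_le_sum (f := fun a => ‖hermForm (D.γ 0 * D.γ a)‖)
              (fun _ _ => ContinuousLinearMap.opNorm_nonneg _) (Finset.mem_univ a)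
        _ ≤ _ := by
            gcongr
            exact le_add_of_nonneg_right (Finset.sum_nonneg fun _ _ => by positivity))
    (fun a b s hs x => by
      have hp := one_le_pt_zero x
      have h1 : pt x 0 ^ 3 * ‖ψ (event (s * pt x 0) x)‖ ≤ |C| := by
        rw [hψ]; exact (hC s hs x).trans (le_abs_self _)
      have h2 := (hC' b s hs x).trans (le_abs_self _)
      rw [D.fderiv_current hsol.1, norm_mul, Real.norm_ofNat]
      calc pt x 0 ^ 5 * (2 * ‖hermForm (D.γ 0 * D.γ a) (ψ (event (s * pt x 0) x))
              (fderiv ℝ ψ (event (s * pt x 0) x) (Pi.single b 1))‖)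
          ≤ pt x 0 ^ 6 * (2 * (‖hermForm (D.γ 0 * D.γ a)‖ * ‖ψ (event (s * pt x 0) x)‖
            * ‖fderiv ℝ ψ (event (s * pt x 0) x) (Pi.single b 1)‖)) := by
            gcongr
            · norm_num
            · exact (hermForm (D.γ 0 * D.γ a)).le_opNorm₂ _ _
        _ = ‖hermForm (D.γ 0 * D.γ a)‖ * (2 * ((pt x 0 ^ 3 * ‖ψ (event (s * pt x 0) x)‖)
            * (pt x 0 ^ 3 * ‖fderiv ℝ ψ (event (s * pt x 0) x) (Pi.single b 1)‖))) := by ring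
        _ ≤ (∑ a, ‖hermForm (D.γ 0 * D.γ a)‖) * (2 * (|C| * |C' b|)) := by
            gcongr
            exact Finset.single_le_sum (f := fun a => ‖hermForm (D.γ 0 * D.γ a)‖)
              (fun _ _ => ContinuousLinearMap.opNorm_nonneg _) (Finset.mem_univ a)
        _ ≤ (∑ a, ‖hermForm (D.γ 0 * D.γ a)‖) * ∑ b, 2 * (|C| * |C' b|) := by
            gcongr
            exact Finset.single_le_sum (f := fun b => 2 * (|C| * |C' b|))
              (fun _ _ => by positivity) (Finset.mem_univ b)
        _ ≤ _ := by
            gcongr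
            exact le_add_of_nonneg_left (by positivity))
  simp only [D.flux_density] at hflux
  simp only [D.current_zero] at hflux
  have h3 : ∀ x, ψ (event 0 x) = spaceFourier (D.initialAmplitude g) (κ • x) := by
    intro x
    rw [hψ, ← D.field_event_zero hg]
    simp only [smul_event, mul_zero]
  have hG : D.initialAmplitude g ∈ TestFun :=
    TestFun.add_mem (D.part_mem_testFun hg (-1)) (comp_neg_mem_testFun (D.part_mem_testFun hg 1))
  simp only [h3] at hflux
  rw [integral_norm_sq_spaceFourier hG hκ, D.integral_norm_sq_initialAmplitude hg] at hflux
  have hpi := Real.pi_pos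
  have h4 : ∀ y, (D.density y (D.fourier κ g y) (D.fourier κ g y)).re
      = (κ / (2 * Real.pi)) ^ 3 * (D.density y (ψ (pt y)) (ψ (pt y))).re := by
    intro y
    have h5 : ((κ / (2 * Real.pi)) ^ (3 / 2 : ℝ)) ^ 2 = (κ / (2 * Real.pi)) ^ 3 := by
      rw [← Real.rpow_natCast, ← Real.rpow_mul (by positivity), ← Real.rpow_natCast]
      norm_num
    have h6 : D.fourier κ g y = ((κ / (2 * Real.pi)) ^ (3 / 2 : ℝ) : ℝ) • ψ (pt y) := by
      rw [D.fourier_eq, hψ]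
    rw [h6, ← h5]
    simp only [density_eq_sum, map_smul, smul_apply, smul_eq_mul, Fin.sum_univ_three]
    ring
  simp only [h4]
  rw [integral_const_mul, integral_hypMeasure]
  simp only [smul_eq_mul]
  rw [hflux, ← mul_assoc, ← mul_pow]
  field_simp

lemma fourier_decay {g : E3 → Spinor} (hg : g ∈ TestFun) {κ : ℝ} (hκ : 0 < κ) :
    RapidDecay (D.fourier κ g) := by
  refine ⟨?_, fun N => ?_⟩
  · rw [show D.fourier κ g = fun y => _ from funext fun y => D.fourier_eq κ g y]
    exact ((D.contDiff_field (rapidDecay_of_mem_testFun hg)).continuous.comp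
      (continuous_pt.const_smul κ)).const_smul ((κ / (2 * Real.pi)) ^ (3 / 2 : ℝ) : ℝ)
  · obtain ⟨C, hC⟩ := D.field_decay hg hκ.ne' N
    refine ⟨‖(κ / (2 * Real.pi)) ^ (3 / 2 : ℝ)‖ * C, fun z => ?_⟩
    have h1 := hC 1 (by simp) z
    rw [one_mul, ← pt_eq_event] at h1
    rw [D.fourier_eq, norm_smul]
    calc _ = ‖(κ / (2 * Real.pi)) ^ (3 / 2 : ℝ)‖ * (pt z 0 ^ N * ‖D.field g (κ • pt z)‖) := by
          ring
      _ ≤ _ := by gcongr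

/-! ### Elements of the Hilbert space -/

lemma norm_mulVec_le (A : Matrix (Fin 4) (Fin 4) ℂ) (v : Spinor) :
    ‖A *ᵥ v‖ ≤ ‖mulVecL A‖ * ‖v‖ := (mulVecL A).le_opNorm v

lemma norm_slash_pt_mulVec_le (z : E3) (v : Spinor) :
    ‖D.slash (pt z) *ᵥ v‖ ≤ (∑ a, ‖mulVecL (D.γ a)‖) * pt z 0 * ‖v‖ := by
  rw [D.slash_mulVec, Finset.sum_mul, Finset.sum_mul]
  refine (norm_sum_le _ _).trans (Finset.sum_le_sum fun a _ => ?_)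
  rw [norm_smul, Complex.norm_real, Real.norm_eq_abs, abs_mul, abs_sgn, one_mul]
  calc |pt z a| * ‖D.γ a *ᵥ v‖ ≤ pt z 0 * (‖mulVecL (D.γ a)‖ * ‖v‖) := by
        gcongr
        · exact (pt_zero_pos z).le
        · exact abs_pt_le z a
        · exact norm_mulVec_le _ _
    _ = _ := by ring

lemma norm_star_dotProduct_le (v w : Spinor) : ‖star v ⬝ᵥ w‖ ≤ 4 * ‖v‖ * ‖w‖ := by
  rw [dotProduct]
  refine (norm_sum_le _ _).trans ?_
  calc ∑ i, ‖star v i * w i‖ ≤ ∑ _i : Fin 4, ‖v‖ * ‖w‖ := by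
        refine Finset.sum_le_sum fun i _ => ?_
        rw [norm_mul, Pi.star_apply, norm_star]
        gcongr
        · exact norm_le_pi_norm v i
        · exact norm_le_pi_norm w i
    _ = _ := by simp; ring

/-- A constant bounding the density. -/
noncomputable def densityConst : ℝ := 4 * ‖mulVecL (D.γ 0)‖ * ∑ a, ‖mulVecL (D.γ a)‖

lemma densityConst_nonneg : 0 ≤ D.densityConst := by
  unfold densityConst; positivity

lemma norm_density_le (z : E3) (v w : Spinor) :
    ‖D.density z v w‖ ≤ D.densityConst * pt z 0 * ‖v‖ * ‖w‖ := by
  have hp := pt_zero_pos z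
  rw [density, ← Matrix.mulVec_mulVec]
  calc _ ≤ 4 * ‖v‖ * ‖D.γ 0 *ᵥ (D.slash (pt z) *ᵥ w)‖ := norm_star_dotProduct_le _ _
    _ ≤ 4 * ‖v‖ * (‖mulVecL (D.γ 0)‖ * ((∑ a, ‖mulVecL (D.γ a)‖) * pt z 0 * ‖w‖)) := by
        gcongr
        exact (norm_mulVec_le _ _).trans (by gcongr; exact D.norm_slash_pt_mulVec_le _ _)
    _ = _ := by unfold densityConst; ring

lemma continuous_density {v w : E3 → Spinor} (hv : Continuous v) (hw : Continuous w) :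
    Continuous fun z => D.density z (v z) (w z) := by
  unfold density
  have h1 : Continuous fun z => (D.γ 0 * D.slash (pt z)) *ᵥ w z :=
    D.continuous_wt.matrix_mulVec hw
  exact hv.star.dotProduct h1

/-- The element of the Hilbert space defined by a rapidly decaying function. -/
noncomputable def ofRapidDecay {f : E3 → Spinor} (hf : RapidDecay f) : D.Hil :=
  ⟨AEEqFun.mk f hf.1.aestronglyMeasurable, by
    have h1 : RapidDecay fun z => D.density z (f z) (f z) := by
      obtain ⟨C, hC⟩ := hf.2 0
      refine hf.of_norm_le (D.continuous_density hf.1 hf.1) (D.densityConst * C) 1 fun z => ?_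
      have h2 := hC z
      rw [pow_zero, one_mul] at h2
      have := pt_zero_pos z
      have := D.densityConst_nonneg
      calc _ ≤ D.densityConst * pt z 0 * ‖f z‖ * ‖f z‖ := D.norm_density_le z _ _
        _ ≤ D.densityConst * pt z 0 * C * ‖f z‖ := by gcongr
        _ = _ := by ring
    refine (h1.integrable_hypMeasure).congr ?_
    filter_upwards [AEEqFun.coeFn_mk f (μ := hypMeasure) hf.1.aestronglyMeasurable] with x hx
    rw [hx]⟩

lemma fn_ofRapidDecay {f : E3 → Spinor} (hf : RapidDecay f) :
    (D.ofRapidDecay hf).fn =ᵐ[hypMeasure] f := AEEqFun.coeFn_mk _ _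

lemma fn_emb (f : TestFun) : (D.emb f).fn =ᵐ[hypMeasure] f.1 := AEEqFun.coeFn_mk _ _

variable {D} in
lemma Hil.ext_fn {f g : D.Hil} (h : f.fn =ᵐ[hypMeasure] g.fn) : f = g :=
  Subtype.ext (AEEqFun.ext h)

variable {D} in
lemma Hil.inner_eq {f g : D.Hil} {f' g' : E3 → Spinor} (hf : f.fn =ᵐ[hypMeasure] f')
    (hg : g.fn =ᵐ[hypMeasure] g') :
    inner ℂ f g = ∫ x, D.density x (f' x) (g' x) ∂hypMeasure := by
  rw [Hil.inner_def]
  refine integral_congr_ae ?_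
  filter_upwards [hf, hg] with x h1 h2
  rw [h1, h2]

lemma emb_add (f g : TestFun) : D.emb (f + g) = D.emb f + D.emb g := by
  refine Hil.ext_fn ?_
  filter_upwards [D.fn_emb (f + g), D.fn_emb f, D.fn_emb g, Hil.fn_add (D.emb f) (D.emb g)]
    with x h1 h2 h3 h4
  rw [h1, h4, Pi.add_apply, h2, h3]; rfl

lemma emb_smul (c : ℂ) (f : TestFun) : D.emb (c • f) = c • D.emb f := by
  refine Hil.ext_fn ?_
  filter_upwards [D.fn_emb (c • f), D.fn_emb f, Hil.fn_smul c (D.emb f)] with x h1 h2 h4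
  rw [h1, h4, Pi.smul_apply, h2]; rfl

/-- The inclusion of the test functions as a linear map. -/
noncomputable def embL : TestFun →ₗ[ℂ] D.Hil where
  toFun := D.emb
  map_add' := D.emb_add
  map_smul' := D.emb_smul

lemma eq_zero_of_wt_mulVec {x : E3} {v : Spinor} (h : D.wt x *ᵥ v = 0) : v = 0 := by
  have h1 : D.slash (pt x) * D.γ 0 * D.wt x = 1 := by
    rw [wt, mul_assoc, ← mul_assoc (D.γ 0), γ_zero_sq, one_mul, slash_pt_sq]
  have h2 := congrArg (fun v => (D.slash (pt x) * D.γ 0) *ᵥ v) h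
  simpa [Matrix.mulVec_mulVec, h1] using h2

/-- A function that is orthogonal to the test functions with support in an open set vanishes
there. -/
lemma ae_eq_zero_on {O : Set E3} (hO : IsOpen O) {h : E3 → Spinor}
    (hi : ∀ f : TestFun, Integrable (fun x => D.density x (f.1 x) (h x)) hypMeasure)
    (H : ∀ f : TestFun, tsupport f.1 ⊆ O → ∫ x, D.density x (f.1 x) (h x) ∂hypMeasure = 0) :
    ∀ᵐ x ∂hypMeasure, x ∈ O → h x = 0 := by
  have htest : ∀ (g : E3 → ℝ) (i : Fin 4), ContDiff ℝ ∞ g → HasCompactSupport g →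
      (fun x => (g x : ℂ) • (Pi.single i 1 : Spinor)) ∈ TestFun := fun g i hg hc =>
    ⟨ContDiff.smul (Complex.ofRealCLM.contDiff.comp hg) contDiff_const,
      HasCompactSupport.intro hc fun x hx => by
        simp [image_eq_zero_of_notMem_tsupport hx]⟩
  have hden : ∀ (g : E3 → ℝ) (i : Fin 4) (x : E3) (v : Spinor),
      D.density x ((g x : ℂ) • (Pi.single i 1 : Spinor)) v = g x • (D.wt x *ᵥ v) i := by
    intro g i x v
    rw [density, ← wt, star_smul, smul_dotProduct, ← Pi.single_star]
    simp
  have hint : ∀ (g : E3 → ℝ) (i : Fin 4), ContDiff ℝ ∞ g → HasCompactSupport g →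
      Integrable (fun x => g x • (D.wt x *ᵥ h x) i) hypMeasure := fun g i hg hc => by
    simpa only [hden] using hi ⟨_, htest g i hg hc⟩
  have hloc : ∀ i : Fin 4, LocallyIntegrable (fun x => (D.wt x *ᵥ h x) i) hypMeasure := by
    intro i x
    let φ : ContDiffBump x := default
    refine ⟨Metric.closedBall x φ.rIn, Metric.closedBall_mem_nhds x φ.rIn_pos, ?_⟩
    refine ((hint φ i φ.contDiff φ.hasCompactSupport).integrableOn).congr_fun
      (fun y hy => ?_) Metric.isClosed_closedBall.measurableSet
    simp [φ.one_of_mem_closedBall hy]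
  have hz : ∀ i : Fin 4, ∀ᵐ x ∂hypMeasure, x ∈ O → (D.wt x *ᵥ h x) i = 0 := by
    intro i
    refine hO.ae_eq_zero_of_integral_contDiff_smul_eq_zero ((hloc i).locallyIntegrableOn O)
      fun g hg hc hs => ?_
    have h1 := H ⟨_, htest g i hg hc⟩ ((closure_mono fun x hx => by
      contrapose! hx
      simp [Function.notMem_support.1 hx]).trans hs)
    simpa only [hden] using h1
  filter_upwards [hz 0, hz 1, hz 2, hz 3] with x h0 h1 h2 h3 hx
  refine D.eq_zero_of_wt_mulVec (x := x) ?_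
  ext i; fin_cases i
  exacts [h0 hx, h1 hx, h2 hx, h3 hx]

variable {D} in
lemma Hil.ae_eq_zero_on {O : Set E3} (hO : IsOpen O) (h : D.Hil)
    (H : ∀ f : TestFun, tsupport f.1 ⊆ O → inner ℂ (D.emb f) h = 0) :
    ∀ᵐ x ∂hypMeasure, x ∈ O → h.fn x = 0 := by
  refine D.ae_eq_zero_on hO (fun f => ?_) fun f hf => ?_
  · refine (Hil.integrable_density (D.emb f) h).congr ?_
    filter_upwards [D.fn_emb f] with x hx
    rw [hx]
  · rw [← H f hf, Hil.inner_eq (D.fn_emb f) Filter.EventuallyEq.rfl]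

variable {D} in
lemma Hil.eq_zero_of_inner_emb (h : D.Hil) (H : ∀ f : TestFun, inner ℂ (D.emb f) h = 0) :
    h = 0 := by
  refine Hil.ext_fn ?_
  have h0 : (0 : D.Hil).fn =ᵐ[hypMeasure] 0 := AEEqFun.coeFn_zero
  filter_upwards [Hil.ae_eq_zero_on isOpen_univ h fun f _ => H f, h0] with x h1 h2
  rw [h1 (mem_univ x), h2]; rfl

variable {D} in
lemma Hil.ext_inner_emb {h h' : D.Hil} (H : ∀ f : TestFun, inner ℂ (D.emb f) h = inner ℂ (D.emb f) h') :
    h = h' := by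
  rw [← sub_eq_zero]
  exact Hil.eq_zero_of_inner_emb _ fun f => by rw [inner_sub_right, H, sub_self]

lemma denseRange_emb : DenseRange D.emb := by
  have h1 : (LinearMap.range D.embL).topologicalClosure = ⊤ := by
    rw [Submodule.topologicalClosure_eq_top_iff, Submodule.eq_bot_iff]
    intro h hh
    exact Hil.eq_zero_of_inner_emb h fun f => hh _ ⟨f, rfl⟩
  have h2 := Submodule.dense_iff_topologicalClosure_eq_top.2 h1
  have h3 : ((LinearMap.range D.embL : Submodule ℂ D.Hil) : Set D.Hil) = range D.emb := by
    ext x; simp [embL]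
  rw [h3] at h2
  exact h2

variable {D} in
lemma Hil.norm_sq_eq {f : D.Hil} {f' : E3 → Spinor} (hf : f.fn =ᵐ[hypMeasure] f') :
    ‖f‖ ^ 2 = ∫ x, (D.density x (f' x) (f' x)).re ∂hypMeasure := by
  have h1 := inner_self_eq_norm_sq_to_K (𝕜 := ℂ) f
  rw [Hil.inner_eq hf hf] at h1
  simp only [density_self] at h1 ⊢
  rw [integral_complex_ofReal] at h1
  have h2 := congrArg Complex.re h1
  simp only [Complex.ofReal_re]
  rw [Complex.ofReal_re] at h2
  rw [h2]
  simp [← Complex.ofReal_pow]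

lemma Extends.unique {K : (E3 → Spinor) → E3 → Spinor} {T T' : D.Hil →L[ℂ] D.Hil}
    (h : D.Extends K T) (h' : D.Extends K T') : T = T' :=
  DFunLike.coe_injective (D.denseRange_emb.equalizer T.continuous T'.continuous
    (funext fun f => Hil.ext_fn ((h f).trans (h' f).symm)))

lemma extends_extension {K : (E3 → Spinor) → E3 → Spinor} {T : D.Hil →L[ℂ] D.Hil}
    (h : D.Extends K T) : D.Extends K (D.extension K) := by
  have h1 : ∃ T, D.Extends K T := ⟨T, h⟩
  rw [extension, dif_pos h1]
  exact h1.choose_spec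

lemma integrable_ker_mulVec {g : E3 → Spinor} (hg : RapidDecay g) (x : Mink) :
    Integrable (fun z => D.ker x z *ᵥ g z) hypMeasure := by
  simp only [D.ker_mulVec]
  have h1 : ∀ s : ℂ, RapidDecay fun z => (1 / 2 : ℂ) • (D.slash (pt z) *ᵥ g z + s • g z) :=
    fun s => ((hg.slash_mulVec D).add (hg.smul (c := fun _ => s) continuous_const ‖s‖ 0
      fun z => by simp)).smul continuous_const 1 0 fun z => by simp; norm_num
  exact (((h1 (-1)).wave_smul x).add ((h1 1).wave_smul (-x))).integrable_hypMeasure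

lemma field_add {f g : E3 → Spinor} (hf : RapidDecay f) (hg : RapidDecay g) (x : Mink) :
    D.field (f + g) x = D.field f x + D.field g x := by
  rw [field, field, field, ← integral_add (D.integrable_ker_mulVec hf x)
    (D.integrable_ker_mulVec hg x)]
  simp only [Pi.add_apply, Matrix.mulVec_add]

lemma field_smul (c : ℂ) (f : E3 → Spinor) (x : Mink) :
    D.field (c • f) x = c • D.field f x := by
  rw [field, field, ← integral_smul]
  simp only [Pi.smul_apply, Matrix.mulVec_smul]

/-- The transformation `F_κ` on test functions. -/
noncomputable def fourierL {κ : ℝ} (hκ : 0 < κ) : TestFun →ₗ[ℂ] D.Hil where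
  toFun f := D.ofRapidDecay (D.fourier_decay f.2 hκ)
  map_add' f g := by
    refine Hil.ext_fn ?_
    filter_upwards [D.fn_ofRapidDecay (D.fourier_decay (f + g).2 hκ),
      D.fn_ofRapidDecay (D.fourier_decay f.2 hκ), D.fn_ofRapidDecay (D.fourier_decay g.2 hκ),
      Hil.fn_add (D.ofRapidDecay (D.fourier_decay f.2 hκ))
        (D.ofRapidDecay (D.fourier_decay g.2 hκ))] with x h1 h2 h3 h4
    rw [h1, h4, Pi.add_apply, h2, h3]
    simp only [D.fourier_eq]
    rw [← smul_add, ← D.field_add (rapidDecay_of_mem_testFun f.2) (rapidDecay_of_mem_testFun g.2)]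
    rfl
  map_smul' c f := by
    refine Hil.ext_fn ?_
    filter_upwards [D.fn_ofRapidDecay (D.fourier_decay (c • f).2 hκ),
      D.fn_ofRapidDecay (D.fourier_decay f.2 hκ),
      Hil.fn_smul c (D.ofRapidDecay (D.fourier_decay f.2 hκ))] with x h1 h2 h4
    rw [h1, RingHom.id_apply, h4, Pi.smul_apply, h2]
    simp only [D.fourier_eq]
    rw [smul_comm c, ← D.field_smul]
    rfl

lemma norm_fourierL {κ : ℝ} (hκ : 0 < κ) (f : TestFun) : ‖D.fourierL hκ f‖ = ‖D.emb f‖ := by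
  have h1 : ‖D.fourierL hκ f‖ ^ 2 = ‖D.emb f‖ ^ 2 := by
    change ‖D.ofRapidDecay (D.fourier_decay f.2 hκ)‖ ^ 2 = _
    rw [Hil.norm_sq_eq (D.fn_ofRapidDecay (D.fourier_decay f.2 hκ)), Hil.norm_sq_eq (D.fn_emb f)]
    exact D.integral_density_fourier f.2 hκ
  exact (sq_eq_sq₀ (norm_nonneg _) (norm_nonneg _)).1 h1

lemma extends_F {κ : ℝ} (hκ : 0 < κ) : D.Extends (D.fourier κ) (D.F κ) := by
  refine D.extends_extension (T := (D.fourierL hκ).extendOfNorm D.embL) fun f => ?_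
  have h1 := LinearMap.extendOfNorm_eq (f := D.fourierL hκ) (e := D.embL) D.denseRange_emb
    ⟨1, fun f => by rw [one_mul]; exact (D.norm_fourierL hκ f).le⟩ f
  have h2 : (D.fourierL hκ).extendOfNorm D.embL (D.emb f) = D.fourierL hκ f := h1
  rw [h2]
  exact D.fn_ofRapidDecay (D.fourier_decay f.2 hκ)

lemma F_emb {κ : ℝ} (hκ : 0 < κ) (f : TestFun) :
    D.F κ (D.emb f) = D.ofRapidDecay (D.fourier_decay f.2 hκ) :=
  Hil.ext_fn ((D.extends_F hκ f).trans (D.fn_ofRapidDecay _).symm)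

lemma norm_F {κ : ℝ} (hκ : 0 < κ) (f : D.Hil) : ‖D.F κ f‖ = ‖f‖ := by
  refine D.denseRange_emb.induction_on (p := fun f => ‖D.F κ f‖ = ‖f‖) f
    (isClosed_eq (by fun_prop) (by fun_prop)) fun f => ?_
  rw [D.F_emb hκ]
  exact D.norm_fourierL hκ f

lemma adjoint_F_comp_F {κ : ℝ} (hκ : 0 < κ) :
    ContinuousLinearMap.adjoint (D.F κ) ∘L D.F κ = ContinuousLinearMap.id ℂ D.Hil :=
  (ContinuousLinearMap.norm_map_iff_adjoint_comp_self (D.F κ)).1 (D.norm_F hκ)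

end DiracMatrices

/-! ### Duality of the two integral transformations -/

/-- The sesquilinear form `v†w` on spinors as a real bilinear map. -/
noncomputable def pairing : Spinor →L[ℝ] Spinor →L[ℝ] ℂ :=
  LinearMap.toContinuousBilinearMap (LinearMap.mk₂ ℝ (fun v w => star v ⬝ᵥ w)
    (fun v v' w => by simp [add_dotProduct])
    (fun c v w => by simp)
    (fun v w w' => by simp [dotProduct_add])
    (fun c v w => by simp))

lemma pairing_apply (v w : Spinor) : pairing v w = star v ⬝ᵥ w := rfl

lemma continuous_pairing {X : Type*} [TopologicalSpace X] {v w : X → Spinor} (hv : Continuous v)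
    (hw : Continuous w) : Continuous fun x => pairing (v x) (w x) :=
  (pairing.continuous.comp hv).clm_apply hw

namespace DiracMatrices
variable (D : DiracMatrices)

lemma continuous_slash : Continuous D.slash := by
  unfold slash
  exact continuous_finsetSum _ fun a _ => (Complex.continuous_ofReal.comp
    (continuous_const.mul (continuous_apply a))).smul continuous_const

lemma norm_ker_mulVec_le (x : Mink) (z : E3) (v : Spinor) :
    ‖D.ker x z *ᵥ v‖ ≤ ‖D.slash (pt z) *ᵥ v‖ + ‖v‖ := by
  rw [ker, Matrix.sub_mulVec, Matrix.smul_mulVec, Matrix.smul_mulVec, Matrix.one_mulVec]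
  refine (norm_sub_le _ _).trans (add_le_add ?_ ?_)
  · rw [norm_smul, Complex.norm_real]
    exact mul_le_of_le_one_left (norm_nonneg _) (Real.abs_cos_le_one _)
  · rw [norm_smul, norm_mul, Complex.norm_I, one_mul, Complex.norm_real]
    exact mul_le_of_le_one_left (norm_nonneg _) (Real.abs_sin_le_one _)

/-- The dual of the restriction of fields to the family of points `p x`, with respect to the weight
`γ⁰ γ·n` and the measure `ν`: the integral `∫ e^{i p·z γ·z} γ·n χ dν`. -/
noncomputable def dual (ν : Measure E3) (p n : E3 → Mink) (χ : E3 → Spinor) (z : E3) : Spinor :=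
  ∫ x, D.kerAdj (p x) z *ᵥ (D.slash (n x) *ᵥ χ x) ∂ν

lemma density_kerAdj (z : E3) (n x : Mink) (v w : Spinor) :
    D.density z (D.kerAdj x z *ᵥ (D.slash n *ᵥ v)) w
      = pairing v ((D.γ 0 * D.slash n) *ᵥ (D.ker x z *ᵥ w)) := by
  rw [density, pairing_apply, Matrix.mulVec_mulVec, Matrix.star_mulVec, ← Matrix.dotProduct_mulVec,
    Matrix.mulVec_mulVec, ← wt, kerAdj_mul_conjTranspose, Matrix.mulVec_mulVec]

/-- Fubini's theorem: `dual` is dual to the restriction of `field`. -/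
lemma integral_pairing_field {ν : Measure E3} [SFinite ν] [IsFiniteMeasureOnCompacts ν]
    {p n : E3 → Mink} (hp : Continuous p) (hn : Continuous n) {χ : E3 → Spinor}
    (hχ : Continuous χ) (hχc : HasCompactSupport χ) {g : E3 → Spinor} (hg : RapidDecay g) :
    ∫ x, pairing (χ x) ((D.γ 0 * D.slash (n x)) *ᵥ D.field g (p x)) ∂ν
      = ∫ z, D.density z (D.dual ν p n χ z) (g z) ∂hypMeasure := by
  have hN : Continuous fun x => D.γ 0 * D.slash (n x) :=
    continuous_const.mul (D.continuous_slash.comp hn)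
  have h1 : ∀ x, pairing (χ x) ((D.γ 0 * D.slash (n x)) *ᵥ D.field g (p x))
      = ∫ z, pairing (χ x) ((D.γ 0 * D.slash (n x)) *ᵥ (D.ker (p x) z *ᵥ g z)) ∂hypMeasure := by
    intro x
    have hi := D.integrable_ker_mulVec hg (p x)
    rw [field, ← mulVec_integral _ hi]
    exact ((pairing (χ x)).integral_comp_comm
      ((mulVecL (D.γ 0 * D.slash (n x))).integrable_comp hi)).symm
  have h2 : ∀ z, D.density z (D.dual ν p n χ z) (g z)
      = ∫ x, pairing (χ x) ((D.γ 0 * D.slash (n x)) *ᵥ (D.ker (p x) z *ᵥ g z)) ∂ν := by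
    intro z
    have hc : Continuous fun x => D.kerAdj (p x) z *ᵥ (D.slash (n x) *ᵥ χ x) :=
      (D.continuous_kerAdj.comp (hp.prodMk continuous_const)).matrix_mulVec
        ((D.continuous_slash.comp hn).matrix_mulVec hχ)
    have hi : Integrable (fun x => D.kerAdj (p x) z *ᵥ (D.slash (n x) *ᵥ χ x)) ν :=
      hc.integrable_of_hasCompactSupport (HasCompactSupport.intro hχc fun x hx => by
        rw [image_eq_zero_of_notMem_tsupport hx, Matrix.mulVec_zero, Matrix.mulVec_zero])
    have h3 := (pairing.flip (D.wt z *ᵥ g z)).integral_comp_comm hi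
    have h4 : D.density z (D.dual ν p n χ z) (g z)
        = pairing.flip (D.wt z *ᵥ g z) (D.dual ν p n χ z) := rfl
    rw [h4, dual, ← h3]
    refine integral_congr_ae (Filter.Eventually.of_forall fun x => ?_)
    exact D.density_kerAdj z (n x) (p x) (χ x) (g z)
  simp only [h1, h2]
  refine integral_integral_swap ?_
  -- the integrand is bounded by the product of two integrable functions
  have hw : Continuous fun x => (D.γ 0 * D.slash (n x))ᴴ *ᵥ χ x :=
    hN.matrix_conjTranspose.matrix_mulVec hχ
  have hwi : Integrable (fun x => ‖(D.γ 0 * D.slash (n x))ᴴ *ᵥ χ x‖) ν :=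
    (hw.integrable_of_hasCompactSupport (HasCompactSupport.intro hχc fun x hx => by
        rw [image_eq_zero_of_notMem_tsupport hx, Matrix.mulVec_zero])).norm
  have hgi : Integrable (fun z => ‖D.slash (pt z) *ᵥ g z‖ + ‖g z‖) hypMeasure :=
    (hg.slash_mulVec D).integrable_hypMeasure.norm.add hg.integrable_hypMeasure.norm
  refine ((hwi.mul_prod hgi).const_mul 4).mono' ?_ (Filter.Eventually.of_forall fun q => ?_)
  · refine Continuous.aestronglyMeasurable (continuous_pairing (hχ.comp continuous_fst)
      ((hN.comp continuous_fst).matrix_mulVec ((D.continuous_ker.comp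
        ((hp.comp continuous_fst).prodMk continuous_snd)).matrix_mulVec
        (hg.1.comp continuous_snd))))
  · have h5 : pairing (χ q.1) ((D.γ 0 * D.slash (n q.1)) *ᵥ (D.ker (p q.1) q.2 *ᵥ g q.2))
        = star ((D.γ 0 * D.slash (n q.1))ᴴ *ᵥ χ q.1) ⬝ᵥ (D.ker (p q.1) q.2 *ᵥ g q.2) := by
      rw [pairing_apply, Matrix.star_mulVec, Matrix.conjTranspose_conjTranspose,
        ← Matrix.dotProduct_mulVec]
    change ‖pairing (χ q.1) ((D.γ 0 * D.slash (n q.1)) *ᵥ (D.ker (p q.1) q.2 *ᵥ g q.2))‖ ≤ _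
    rw [h5]
    refine (norm_star_dotProduct_le _ _).trans ?_
    rw [← mul_assoc]
    gcongr
    exact D.norm_ker_mulVec_le _ _ _

lemma kerAdj_mulVec (x : Mink) (z : E3) (v : Spinor) :
    D.kerAdj x z *ᵥ v = (1 / 2 : ℂ) • (Complex.exp (Complex.I * (mdot x (pt z) : ℝ)) • v
          + Complex.exp (Complex.I * (mdot (-x) (pt z) : ℝ)) • v)
        + D.slash (pt z) *ᵥ ((1 / 2 : ℂ) • (Complex.exp (Complex.I * (mdot x (pt z) : ℝ)) • v
          - Complex.exp (Complex.I * (mdot (-x) (pt z) : ℝ)) • v)) := by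
  have hc : ∀ θ : ℝ, Complex.exp (Complex.I * θ) = Real.cos θ + Complex.I * Real.sin θ := by
    intro θ
    rw [mul_comm, Complex.exp_mul_I, mul_comm]; push_cast; ring
  rw [hc, hc, mdot_neg_left, Real.cos_neg, Real.sin_neg, kerAdj, Matrix.add_mulVec,
    Matrix.smul_mulVec, Matrix.smul_mulVec, Matrix.one_mulVec, ← sub_smul, Matrix.mulVec_smul,
    Matrix.mulVec_smul]
  push_cast
  module

lemma continuous_exp_mdot {p : E3 → Mink} (hp : Continuous p) (z : E3) :
    Continuous fun x => Complex.exp (Complex.I * (mdot (p x) (pt z) : ℝ)) := by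
  have h1 : Continuous fun x => mdot (p x) (pt z) := by
    unfold mdot
    exact continuous_finsetSum _ fun a _ =>
      (continuous_const.mul ((continuous_apply a).comp hp)).mul continuous_const
  fun_prop

lemma dual_eq {ν : Measure E3} [IsFiniteMeasureOnCompacts ν] {p n : E3 → Mink}
    (hp : Continuous p) (hn : Continuous n) {χ : E3 → Spinor}
    (hχ : Continuous χ) (hχc : HasCompactSupport χ) (z : E3) :
    D.dual ν p n χ z
      = (1 / 2 : ℂ) • (∫ x, Complex.exp (Complex.I * (mdot (p x) (pt z) : ℝ))
            • (D.slash (n x) *ᵥ χ x) ∂ν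
          + ∫ x, Complex.exp (Complex.I * (mdot (-p x) (pt z) : ℝ)) • (D.slash (n x) *ᵥ χ x) ∂ν)
        + D.slash (pt z) *ᵥ ((1 / 2 : ℂ) •
          (∫ x, Complex.exp (Complex.I * (mdot (p x) (pt z) : ℝ)) • (D.slash (n x) *ᵥ χ x) ∂ν
          - ∫ x, Complex.exp (Complex.I * (mdot (-p x) (pt z) : ℝ))
            • (D.slash (n x) *ᵥ χ x) ∂ν)) := by
  have hb : Continuous fun x => D.slash (n x) *ᵥ χ x :=
    (D.continuous_slash.comp hn).matrix_mulVec hχ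
  have hi : ∀ {q : E3 → Mink}, Continuous q → Integrable (fun x =>
      Complex.exp (Complex.I * (mdot (q x) (pt z) : ℝ)) • (D.slash (n x) *ᵥ χ x)) ν := fun hq =>
    ((continuous_exp_mdot hq z).smul hb).integrable_of_hasCompactSupport
      (HasCompactSupport.intro hχc fun x hx => by
        simp [image_eq_zero_of_notMem_tsupport hx])
  have h1 := hi hp
  have h2 := hi (q := fun x => -p x) hp.neg
  have h3 : ∀ {a b : E3 → Spinor}, Integrable a ν → Integrable b ν →
      ∫ x, ((1 / 2 : ℂ) • (a x + b x) + D.slash (pt z) *ᵥ ((1 / 2 : ℂ) • (a x - b x))) ∂ν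
        = (1 / 2 : ℂ) • (∫ x, a x ∂ν + ∫ x, b x ∂ν)
          + D.slash (pt z) *ᵥ ((1 / 2 : ℂ) • (∫ x, a x ∂ν - ∫ x, b x ∂ν)) := by
    intro a b ha hb
    have hs : Integrable (fun x => (1 / 2 : ℂ) • (a x - b x)) ν := (ha.sub hb).smul (1 / 2 : ℂ)
    have ht : Integrable (fun x => (1 / 2 : ℂ) • (a x + b x)) ν := (ha.add hb).smul (1 / 2 : ℂ)
    rw [← integral_add ha hb, ← integral_sub ha hb, ← integral_smul, ← integral_smul,
      ← mulVec_integral _ hs]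
    exact integral_add ht ((mulVecL (D.slash (pt z))).integrable_comp hs)
  rw [← h3 h1 h2, dual]
  simp only [D.kerAdj_mulVec]

lemma _root_.HypDirac.RapidDecay.const_smul {a : E3 → Spinor} (ha : RapidDecay a) (c : ℂ) :
    RapidDecay fun z => c • a z :=
  ha.smul continuous_const ‖c‖ 0 fun z => by simp

lemma _root_.HypDirac.RapidDecay.sub {a b : E3 → Spinor} (ha : RapidDecay a) (hb : RapidDecay b) :
    RapidDecay fun z => a z - b z := by
  simpa [sub_eq_add_neg] using ha.add (hb.const_smul (-1))

/-- Dual functions decay rapidly if the plane wave integrals in them do. -/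
lemma rapidDecay_dual {ν : Measure E3} [IsFiniteMeasureOnCompacts ν] {p n : E3 → Mink}
    (hp : Continuous p) (hn : Continuous n) {χ : E3 → Spinor}
    (hχ : Continuous χ) (hχc : HasCompactSupport χ)
    (h1 : RapidDecay fun z => ∫ x, Complex.exp (Complex.I * (mdot (p x) (pt z) : ℝ))
            • (D.slash (n x) *ᵥ χ x) ∂ν)
    (h2 : RapidDecay fun z => ∫ x, Complex.exp (Complex.I * (mdot (-p x) (pt z) : ℝ))
            • (D.slash (n x) *ᵥ χ x) ∂ν) :
    RapidDecay (D.dual ν p n χ) := by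
  rw [show D.dual ν p n χ = fun z => _ from funext fun z => D.dual_eq hp hn hχ hχc z]
  exact ((h1.add h2).const_smul _).add (((h1.sub h2).const_smul _).slash_mulVec D)

lemma _root_.HypDirac.rapidDecay_waves {a : E3 → Spinor} (ha : a ∈ TestFun) {c : ℝ} (hc : c ≠ 0)
    {s : ℝ} (hs : s ∈ Icc (0 : ℝ) 1) :
    RapidDecay fun z => waves a (c • event (s * pt z 0) z) := by
  refine ⟨?_, fun N => ?_⟩
  · have h1 := (rapidDecay_of_mem_testFun ha).contDiff_waves.continuous
    have h2 : Continuous fun z => event (s * pt z 0) z :=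
      continuous_event.comp ((continuous_const.mul continuous_pt_zero).prodMk continuous_id)
    exact h1.comp (h2.const_smul c)
  · obtain ⟨C, hC⟩ := waves_decay ha hc N
    exact ⟨C, fun z => hC s hs z⟩

lemma fourierStar_eq_dual (κ : ℝ) (f : E3 → Spinor) (y : E3) :
    D.fourierStar κ f y = ((κ / (2 * Real.pi)) ^ (3 / 2 : ℝ) : ℝ)
      • D.dual hypMeasure (fun x => κ • pt x) pt f y := D.fourierStar_eq κ f y

/-- The amplitude of the plane waves in `F_κ^* f` with respect to Lebesgue measure. -/
noncomputable def source (f : E3 → Spinor) (z : E3) : Spinor :=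
  ((1 / pt z 0 : ℝ) : ℂ) • (D.slash (pt z) *ᵥ f z)

lemma source_mem_testFun {f : E3 → Spinor} (hf : f ∈ TestFun) : D.source f ∈ TestFun :=
  smul_mem_testFun contDiff_inv_pt_zero (mulVec_mem_testFun D.contDiff_slash hf)

lemma integral_exp_source (κ : ℝ) (f : E3 → Spinor) (z : E3) :
    ∫ x, Complex.exp (Complex.I * (mdot (κ • pt x) (pt z) : ℝ)) • (D.slash (pt x) *ᵥ f x) ∂hypMeasure
      = waves (D.source f) (κ • pt z) := by
  rw [integral_hypMeasure, waves]
  refine integral_congr_ae (Filter.Eventually.of_forall fun x => ?_)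
  simp only
  rw [mdot_smul_left, mdot_comm, ← mdot_smul_left, source, ← Complex.coe_smul, smul_comm]

lemma rapidDecay_dual_hyperboloid {f : E3 → Spinor} (hf : f ∈ TestFun) {κ : ℝ} (hκ : κ ≠ 0) :
    RapidDecay (D.dual hypMeasure (fun x => κ • pt x) pt f) := by
  have h := D.source_mem_testFun hf
  have h3 : ∀ c : ℝ, c ≠ 0 → RapidDecay fun z => waves (D.source f) (c • pt z) := by
    intro c hc
    have := rapidDecay_waves h hc (s := 1) (by simp)
    simpa only [one_mul, ← pt_eq_event] using this
  refine D.rapidDecay_dual (continuous_pt.const_smul κ) continuous_pt hf.1.continuous hf.2 ?_ ?_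
  · convert h3 κ hκ using 2 with z
    exact D.integral_exp_source κ f z
  · convert h3 (-κ) (neg_ne_zero.2 hκ) using 2 with z
    rw [← D.integral_exp_source]
    simp only [neg_smul]
    rfl

lemma rapidDecay_fourierStar {f : E3 → Spinor} (hf : f ∈ TestFun) {κ : ℝ} (hκ : κ ≠ 0) :
    RapidDecay (D.fourierStar κ f) := by
  rw [show D.fourierStar κ f = fun y => _ from funext fun y => D.fourierStar_eq_dual κ f y]
  simpa only [Complex.coe_smul] using (D.rapidDecay_dual_hyperboloid hf hκ).const_smul
    (((κ / (2 * Real.pi)) ^ (3 / 2 : ℝ) : ℝ) : ℂ)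

lemma pairing_smul_right (c : ℝ) (v w : Spinor) : pairing v (c • w) = c • pairing v w :=
  map_smul _ _ _

lemma density_eq_pairing (z : E3) (v w : Spinor) :
    D.density z v w = pairing v ((D.γ 0 * D.slash (pt z)) *ᵥ w) := rfl

/-- The transformations `F_κ` and `F_κ^*` are adjoint to each other. -/
lemma integral_density_fourierStar {f : E3 → Spinor} (hf : f ∈ TestFun) (κ : ℝ)
    {g : E3 → Spinor} (hg : RapidDecay g) :
    ∫ x, D.density x (f x) (D.fourier κ g x) ∂hypMeasure
      = ∫ z, D.density z (D.fourierStar κ f z) (g z) ∂hypMeasure := by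
  have h := D.integral_pairing_field (ν := hypMeasure) (continuous_pt.const_smul κ) continuous_pt
    hf.1.continuous hf.2 hg
  have h1 := congrArg (fun c => ((κ / (2 * Real.pi)) ^ (3 / 2 : ℝ) : ℝ) • c) h
  simp only [← integral_smul] at h1
  convert h1 using 3 with x z
  · rw [fourier_eq, density_eq_pairing, Matrix.mulVec_smul, pairing_smul_right]; rfl
  · rw [fourierStar_eq_dual, density_eq_pairing, density_eq_pairing, map_smul]; rfl

lemma density_comm (z : E3) (v w : Spinor) : D.density z v w = star (D.density z w v) :=
  star_dotProduct_mulVec_comm (D.wt_conjTranspose z) w v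

lemma extends_adjoint_F {κ : ℝ} (hκ : 0 < κ) :
    D.Extends (D.fourierStar κ) (ContinuousLinearMap.adjoint (D.F κ)) := by
  intro f
  have hr := D.rapidDecay_fourierStar f.2 hκ.ne'
  have h1 : ContinuousLinearMap.adjoint (D.F κ) (D.emb f) = D.ofRapidDecay hr := by
    refine Hil.ext_inner_emb fun g => ?_
    rw [ContinuousLinearMap.adjoint_inner_right, Hil.inner_eq (D.extends_F hκ g) (D.fn_emb f),
      Hil.inner_eq (D.fn_emb g) (D.fn_ofRapidDecay hr)]
    have h2 := congrArg star (D.integral_density_fourierStar f.2 κ (rapidDecay_of_mem_testFun g.2))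
    simp only [Complex.star_def, ← integral_conj] at h2
    simp only [← Complex.star_def, ← density_comm] at h2
    exact h2
  rw [h1]
  exact D.fn_ofRapidDecay hr

lemma extends_Fstar {κ : ℝ} (hκ : 0 < κ) : D.Extends (D.fourierStar κ) (D.Fstar κ) :=
  D.extends_extension (D.extends_adjoint_F hκ)

lemma Fstar_eq_adjoint {κ : ℝ} (hκ : 0 < κ) : D.Fstar κ = ContinuousLinearMap.adjoint (D.F κ) :=
  Extends.unique D (D.extends_Fstar hκ) (D.extends_adjoint_F hκ)

lemma Fstar_emb {κ : ℝ} (hκ : 0 < κ) (f : TestFun) :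
    D.Fstar κ (D.emb f) = D.ofRapidDecay (D.rapidDecay_fourierStar f.2 hκ.ne') :=
  Hil.ext_fn ((D.extends_Fstar hκ f).trans (D.fn_ofRapidDecay _).symm)

lemma continuous_fourier {g : E3 → Spinor} (hg : RapidDecay g) (κ : ℝ) :
    Continuous (D.fourier κ g) := by
  rw [show D.fourier κ g = fun y => _ from funext fun y => D.fourier_eq κ g y]
  exact ((D.contDiff_field hg).continuous.comp
      (continuous_pt.const_smul κ)).const_smul ((κ / (2 * Real.pi)) ^ (3 / 2 : ℝ) : ℝ)

lemma density_sub_right (z : E3) (u v w : Spinor) :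
    D.density z u (v - w) = D.density z u v - D.density z u w := by
  rw [density, density, density, Matrix.mulVec_sub, dotProduct_sub]

end DiracMatrices

/-! ### Fields with given values on a plane, and locality -/

/-- Fourier inversion for smooth functions of compact support. -/
lemma integral_exp_spaceFourier {b : E3 → Spinor} (hb : b ∈ TestFun) (x : E3) :
    ∫ z, Complex.exp (Complex.I * (inner ℝ x z : ℝ)) • spaceFourier b z
      = ((2 * Real.pi) ^ 3 : ℝ) • b x := by
  have hpi := Real.pi_pos
  have hdec : RapidDecay fun z => spaceFourier b z := by
    have h := rapidDecay_waves hb one_ne_zero (s := 0) (by simp)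
    simpa only [zero_mul, one_smul, waves_event_zero] using h
  have hi : Integrable (𝓕 b) := by
    have h1 : 𝓕 b = fun x => spaceFourier b ((2 * Real.pi) • x) :=
      funext fun x => fourier_eq_spaceFourier b x
    rw [h1]
    exact hdec.integrable.comp_smul (by positivity)
  have h2 := (rapidDecay_of_mem_testFun hb).integrable.fourierInv_fourier_eq hi
    hb.1.continuous.continuousAt (v := x)
  rw [Real.fourierInv_eq'] at h2
  have h3 := Measure.integral_comp_smul_of_nonneg volume
    (fun z => Complex.exp (Complex.I * (inner ℝ x z : ℝ)) • spaceFourier b z) (2 * Real.pi)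
    (hR := by positivity)
  rw [finrank_euclideanSpace, Fintype.card_fin] at h3
  rw [← h2]
  have h4 : ∀ z, Complex.exp (2 * Real.pi * inner ℝ z x * Complex.I) • 𝓕 b z
      = Complex.exp (Complex.I * (inner ℝ x ((2 * Real.pi) • z) : ℝ))
        • spaceFourier b ((2 * Real.pi) • z) := by
    intro z
    rw [fourier_eq_spaceFourier, real_inner_smul_right, real_inner_comm]
    congr 2
    push_cast
    ring
  have h5 : ∀ z, Complex.exp (((2 * Real.pi * inner ℝ z x : ℝ) : ℂ) * Complex.I) • 𝓕 b z
      = Complex.exp (Complex.I * (inner ℝ x ((2 * Real.pi) • z) : ℝ))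
        • spaceFourier b ((2 * Real.pi) • z) := by
    intro z
    rw [← h4]
    push_cast
    rfl
  simp only [h5]
  rw [h3, smul_smul, mul_inv_cancel₀ (by positivity), one_smul]

namespace DiracMatrices
variable (D : DiracMatrices)

lemma slash_single_zero : D.slash (Pi.single 0 1) = D.γ 0 := by
  rw [slash, Fin.sum_univ_succ]
  simp [sgn]

/-- The amplitude of the field with values `χ` (up to a factor) on the plane `x⁰ = t`. -/
noncomputable def planeDual (t : ℝ) (χ : E3 → Spinor) : E3 → Spinor :=
  D.dual volume (event t) (fun _ => Pi.single 0 1) χ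

lemma continuous_event_const (t : ℝ) : Continuous (event t) :=
  continuous_event.comp (continuous_const.prodMk continuous_id)

lemma integral_exp_event (t : ℝ) (b : E3 → Spinor) (z : E3) :
    ∫ x, Complex.exp (Complex.I * (mdot (event t x) (pt z) : ℝ)) • b x
      = Complex.exp (Complex.I * (t * pt z 0 : ℝ)) • spaceFourier b z := by
  rw [spaceFourier, ← integral_smul]
  refine integral_congr_ae (Filter.Eventually.of_forall fun x => ?_)
  simp only [smul_smul]
  rw [← Complex.exp_add, mdot_event_pt, real_inner_comm]
  congr 2
  push_cast
  ring

lemma integral_exp_neg_event (t : ℝ) (b : E3 → Spinor) (z : E3) :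
    ∫ x, Complex.exp (Complex.I * (mdot (-event t x) (pt z) : ℝ)) • b x
      = Complex.exp (Complex.I * (-(t * pt z 0) : ℝ)) • spaceFourier b (-z) := by
  rw [spaceFourier, ← integral_smul]
  refine integral_congr_ae (Filter.Eventually.of_forall fun x => ?_)
  simp only [smul_smul]
  rw [← Complex.exp_add, mdot_neg_left, mdot_event_pt, real_inner_comm, inner_neg_left]
  congr 2
  push_cast
  ring

lemma planeDual_eq (t : ℝ) {χ : E3 → Spinor} (hχ : χ ∈ TestFun) (z : E3) :
    D.planeDual t χ z
      = (1 / 2 : ℂ) • (Complex.exp (Complex.I * (t * pt z 0 : ℝ))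
            • spaceFourier (fun x => D.γ 0 *ᵥ χ x) z
          + Complex.exp (Complex.I * (-(t * pt z 0) : ℝ))
            • spaceFourier (fun x => D.γ 0 *ᵥ χ x) (-z))
        + D.slash (pt z) *ᵥ ((1 / 2 : ℂ) • (Complex.exp (Complex.I * (t * pt z 0 : ℝ))
            • spaceFourier (fun x => D.γ 0 *ᵥ χ x) z
          - Complex.exp (Complex.I * (-(t * pt z 0) : ℝ))
            • spaceFourier (fun x => D.γ 0 *ᵥ χ x) (-z))) := by
  rw [planeDual, D.dual_eq (continuous_event_const t) continuous_const hχ.1.continuous hχ.2]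
  simp only [slash_single_zero]
  rw [integral_exp_event t (fun x => D.γ 0 *ᵥ χ x),
    integral_exp_neg_event t (fun x => D.γ 0 *ᵥ χ x)]

lemma γ_zero_mulVec_mem_testFun {χ : E3 → Spinor} (hχ : χ ∈ TestFun) :
    (fun x => D.γ 0 *ᵥ χ x) ∈ TestFun :=
  mulVec_mem_testFun (A := fun _ => D.γ 0) (fun _ _ => contDiff_const) hχ

lemma _root_.HypDirac.rapidDecay_spaceFourier {b : E3 → Spinor} (hb : b ∈ TestFun) :
    RapidDecay fun z => spaceFourier b z := by
  have h := rapidDecay_waves hb one_ne_zero (s := 0) (by simp)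
  simpa only [zero_mul, one_smul, waves_event_zero] using h

lemma rapidDecay_planeDual (t : ℝ) {χ : E3 → Spinor} (hχ : χ ∈ TestFun) :
    RapidDecay (D.planeDual t χ) := by
  have hS := rapidDecay_spaceFourier (D.γ_zero_mulVec_mem_testFun hχ)
  have he : ∀ {θ : E3 → ℝ} {a : E3 → Spinor}, Continuous θ → RapidDecay a →
      RapidDecay fun z => Complex.exp (Complex.I * (θ z : ℝ)) • a z := fun hθ ha =>
    ha.smul (by fun_prop) 1 0 fun z => by rw [norm_cexp_I_mul]; simp
  have hc : Continuous fun z : E3 => t * pt z 0 := continuous_const.mul continuous_pt_zero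
  refine D.rapidDecay_dual (continuous_event_const t) continuous_const hχ.1.continuous hχ.2 ?_ ?_
  · simp only [slash_single_zero]
    convert he hc hS using 2 with z
    exact integral_exp_event t (fun x => D.γ 0 *ᵥ χ x) z
  · simp only [slash_single_zero]
    convert he hc.neg hS.comp_neg using 2 with z
    exact integral_exp_neg_event t (fun x => D.γ 0 *ᵥ χ x) z

/-- The field with amplitude `planeDual t χ` takes the values `(2π)³ χ` on the plane `x⁰ = t`. -/
lemma field_planeDual (t : ℝ) {χ : E3 → Spinor} (hχ : χ ∈ TestFun) (x : E3) :
    D.field (D.planeDual t χ) (event t x) = ((2 * Real.pi) ^ 3 : ℝ) • χ x := by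
  obtain ⟨b, hb⟩ : ∃ b : E3 → Spinor, b = fun x => D.γ 0 *ᵥ χ x := ⟨_, rfl⟩
  have hbT : b ∈ TestFun := hb ▸ D.γ_zero_mulVec_mem_testFun hχ
  have hS := rapidDecay_spaceFourier hbT
  have hpart : ∀ s : ℂ, (s = 1 ∨ s = -1) → ∀ z, D.part s (D.planeDual t χ) z
      = ((1 / (2 * pt z 0) : ℝ) : ℂ) • Complex.exp (Complex.I * ((t * pt z 0 : ℝ) * s))
        • (D.slash (pt z) + s • 1) *ᵥ spaceFourier b (s.re • z) := by
    intro s hs z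
    rw [part, D.planeDual_eq t hχ, ← hb]
    congr 1
    simp only [Matrix.mulVec_add, Matrix.mulVec_smul, Matrix.mulVec_sub, Matrix.mulVec_mulVec,
      slash_pt_sq, Matrix.one_mulVec, Matrix.add_mulVec, Matrix.smul_mulVec]
    rcases hs with rfl | rfl
    · simp only [Complex.one_re, one_smul, mul_one]
      module
    · simp only [Complex.neg_re, Complex.one_re, neg_smul, one_smul, mul_neg, mul_one,
        Complex.ofReal_neg]
      module
  -- the substitution `z ↦ -z` brings this part to the same plane wave as the other one
  have hw1 : waves (D.part (-1) (D.planeDual t χ)) (event t x)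
      = ∫ z, Complex.exp (Complex.I * (inner ℝ x z : ℝ)) •
          (((1 / (2 * pt z 0) : ℝ) : ℂ) • (D.slash (pt (-z)) + (-1 : ℂ) • 1) *ᵥ spaceFourier b z) := by
    rw [waves, ← integral_neg_eq_self]
    refine integral_congr_ae (Filter.Eventually.of_forall fun z => ?_)
    simp only
    rw [hpart (-1) (Or.inr rfl), pt_zero_neg, mdot_event_pt, pt_zero_neg, inner_neg_right,
      smul_comm (((1 / (2 * pt z 0) : ℝ) : ℂ)), smul_smul, ← Complex.exp_add]
    congr 2
    · push_cast; ring
    · simp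
  have hw2 : waves (D.part 1 (D.planeDual t χ)) (-event t x)
      = ∫ z, Complex.exp (Complex.I * (inner ℝ x z : ℝ)) •
          (((1 / (2 * pt z 0) : ℝ) : ℂ) • (D.slash (pt z) + (1 : ℂ) • 1) *ᵥ spaceFourier b z) := by
    rw [waves]
    refine integral_congr_ae (Filter.Eventually.of_forall fun z => ?_)
    simp only
    rw [hpart 1 (Or.inl rfl), mdot_neg_left, mdot_event_pt,
      smul_comm (((1 / (2 * pt z 0) : ℝ) : ℂ)), smul_smul, ← Complex.exp_add]
    congr 2
    · push_cast; ring
    · simp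
  have hcp : Continuous fun z : E3 => ((1 / (2 * pt z 0) : ℝ) : ℂ) :=
    Complex.continuous_ofReal.comp (continuous_const.div
      (continuous_const.mul continuous_pt_zero) fun z => by
        have := pt_zero_pos z
        positivity)
  have hbd : ∀ z : E3, ‖((1 / (2 * pt z 0) : ℝ) : ℂ)‖ ≤ 1 * pt z 0 ^ 0 := by
    intro z
    have := one_le_pt_zero z
    rw [Complex.norm_real, Real.norm_of_nonneg (by positivity), div_le_iff₀ (by positivity)]
    simp; linarith
  have hdec2 : RapidDecay fun z => ((1 / (2 * pt z 0) : ℝ) : ℂ) •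
      (D.slash (pt z) + (1 : ℂ) • 1) *ᵥ spaceFourier b z := by
    simp only [Matrix.add_mulVec, Matrix.smul_mulVec, Matrix.one_mulVec]
    exact ((hS.slash_mulVec D).add (hS.const_smul 1)).smul hcp 1 0 hbd
  have hdec1 : RapidDecay fun z => ((1 / (2 * pt z 0) : ℝ) : ℂ) •
      (D.slash (pt (-z)) + (-1 : ℂ) • 1) *ᵥ spaceFourier b z := by
    simp only [Matrix.add_mulVec, Matrix.smul_mulVec, Matrix.one_mulVec]
    have h1 := (hS.comp_neg.slash_mulVec D).comp_neg
    simp only [neg_neg] at h1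
    exact (h1.add (hS.const_smul (-1))).smul hcp 1 0 hbd
  have he : ∀ {a : E3 → Spinor}, RapidDecay a → Integrable fun z =>
      Complex.exp (Complex.I * (inner ℝ x z : ℝ)) • a z := fun ha =>
    (ha.smul (by fun_prop) 1 0 fun z => by rw [norm_cexp_I_mul]; simp : RapidDecay _).integrable
  rw [D.field_eq_waves (D.rapidDecay_planeDual t hχ), hw1, hw2, ← integral_add (he hdec1) (he hdec2)]
  -- `(γ·z̃ - 1) + (γ·z + 1) = 2 z⁰ γ⁰` for the space reflection `z̃` of `z`
  have hsum : ∀ z, Complex.exp (Complex.I * (inner ℝ x z : ℝ)) •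
          (((1 / (2 * pt z 0) : ℝ) : ℂ) • (D.slash (pt (-z)) + (-1 : ℂ) • 1) *ᵥ spaceFourier b z)
        + Complex.exp (Complex.I * (inner ℝ x z : ℝ)) •
          (((1 / (2 * pt z 0) : ℝ) : ℂ) • (D.slash (pt z) + (1 : ℂ) • 1) *ᵥ spaceFourier b z)
      = D.γ 0 *ᵥ (Complex.exp (Complex.I * (inner ℝ x z : ℝ)) • spaceFourier b z) := by
    intro z
    have h1 := D.slash_pt_add_neg z
    have hp : (pt z 0 : ℂ) ≠ 0 := by exact_mod_cast (pt_zero_pos z).ne'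
    have h2 : D.slash (pt (-z)) + (-1 : ℂ) • 1 + (D.slash (pt z) + (1 : ℂ) • 1)
        = (2 * pt z 0 : ℂ) • D.γ 0 := by
      rw [← h1]; module
    have h3 : ((1 / (2 * pt z 0) : ℝ) : ℂ) * (2 * pt z 0 : ℂ) = 1 := by
      push_cast; field_simp
    rw [← smul_add, ← smul_add, ← Matrix.add_mulVec, h2, Matrix.smul_mulVec,
      smul_smul ((1 / (2 * pt z 0) : ℝ) : ℂ), h3, one_smul, Matrix.mulVec_smul]
  simp only [hsum]
  rw [mulVec_integral _ (he hS), integral_exp_spaceFourier hbT, Matrix.mulVec_smul, hb]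
  simp only [Matrix.mulVec_mulVec, γ_zero_sq, Matrix.one_mulVec]

lemma density_zero_left (z : E3) (w : Spinor) : D.density z 0 w = 0 := by
  simp [density]

/-- Locality: the field with amplitude `F_κ^* f` vanishes at all points that are spacelike to the
support of `f` on the hyperboloid `x² = κ²`. By duality this is the finite propagation speed of
fields with initial values near the point. -/
lemma field_fourierStar_eq_zero {f : E3 → Spinor} (hf : f ∈ TestFun) {κ : ℝ} (hκ : κ ≠ 0)
    {t₀ : ℝ} {y₀ : E3} (h : ∀ v ∈ tsupport f, |t₀ - κ * pt v 0| < ‖y₀ - κ • v‖) :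
    D.field (D.fourierStar κ f) (event t₀ y₀) = 0 := by
  have hr := D.rapidDecay_fourierStar hf hκ
  obtain ⟨ε, hε, hsp⟩ : ∃ ε > 0, ∀ v ∈ tsupport f,
      |t₀ - κ * pt v 0| + 2 * ε ≤ ‖y₀ - κ • v‖ := by
    have hc : ContinuousOn (fun v : E3 => ‖y₀ - κ • v‖ - |t₀ - κ * pt v 0|) (tsupport f) := by
      have := continuous_pt_zero
      fun_prop
    obtain ⟨δ, hδ, hδ'⟩ := IsCompact.exists_forall_le' (a := 0) hf.2 hc
      fun v hv => sub_pos.2 (h v hv)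
    exact ⟨δ / 2, by linarith, fun v hv => by linarith [hδ' v hv]⟩
  have hcont : Continuous fun y => D.field (D.fourierStar κ f) (event t₀ y) :=
    (D.contDiff_field hr).continuous.comp (continuous_event_const t₀)
  -- the field is orthogonal to all functions supported in a small ball around the point
  have key : ∀ χ ∈ TestFun, tsupport χ ⊆ Metric.ball y₀ ε →
      ∫ x, pairing (χ x) (D.field (D.fourierStar κ f) (event t₀ x)) = 0 := by
    intro χ hχ hs
    have h1 := D.integral_pairing_field (ν := volume) (continuous_event_const t₀)
      (continuous_const (y := (Pi.single 0 1 : Mink))) hχ.1.continuous hχ.2 hr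
    simp only [slash_single_zero, γ_zero_sq, Matrix.one_mulVec] at h1
    rw [h1]
    have hT := D.rapidDecay_planeDual t₀ hχ
    have h2 := congrArg star (D.integral_density_fourierStar hf κ hT)
    simp only [Complex.star_def, ← integral_conj] at h2
    simp only [← Complex.star_def, ← density_comm] at h2
    refine h2.symm.trans (integral_eq_zero_of_ae (Filter.Eventually.of_forall fun x => ?_))
    change D.density x (D.fourier κ (D.planeDual t₀ χ) x) (f x) = 0
    by_cases hx : x ∈ tsupport f
    · have hx1 := hsp x hx
      have h3 : D.field (D.planeDual t₀ χ) (event (κ * pt x 0) (κ • x)) = 0 := by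
        refine (D.isGlobalSolution_field hT).eq_zero_of_initial D (t₀ := t₀)
          (R := |t₀ - κ * pt x 0| + ε) (by rw [abs_sub_comm]; linarith) fun y hy => ?_
        rw [D.field_planeDual t₀ hχ, image_eq_zero_of_notMem_tsupport (f := χ), smul_zero]
        intro hy'
        have h4 := hs hy'
        rw [Metric.mem_ball, dist_eq_norm] at hy h4
        have h5 : ‖y₀ - κ • x‖ ≤ ‖y - κ • x‖ + ‖y - y₀‖ := by
          rw [norm_sub_rev y y₀, add_comm]
          exact norm_sub_le_norm_sub_add_norm_sub _ _ _
        linarith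
      rw [fourier_eq, pt_eq_event, smul_event, h3, smul_zero, density_zero_left]
    · rw [image_eq_zero_of_notMem_tsupport hx, density, Matrix.mulVec_zero, dotProduct_zero]
  -- so it vanishes almost everywhere in the ball, and at its centre by continuity
  have hi : ∀ i : Fin 4, D.field (D.fourierStar κ f) (event t₀ y₀) i = 0 := by
    intro i
    have hci : Continuous fun y => D.field (D.fourierStar κ f) (event t₀ y) i :=
      (continuous_apply i).comp hcont
    have h1 := (Metric.isOpen_ball (x := y₀) (ε := ε)).ae_eq_zero_of_integral_contDiff_smul_eq_zero
      (μ := volume) (hci.locallyIntegrable.locallyIntegrableOn _) fun g hg hgc hgs => by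
      have h2 := key (fun x => (g x : ℂ) • (Pi.single i 1 : Spinor))
        ⟨ContDiff.smul (Complex.ofRealCLM.contDiff.comp hg) contDiff_const,
          HasCompactSupport.intro hgc fun x hx => by
            simp [image_eq_zero_of_notMem_tsupport hx]⟩
        ((closure_mono fun x hx => by
          contrapose! hx
          simp [Function.notMem_support.1 hx]).trans hgs)
      rw [← h2]
      refine integral_congr_ae (Filter.Eventually.of_forall fun x => ?_)
      simp only [pairing_apply]
      rw [star_smul, smul_dotProduct, ← Pi.single_star]
      simp
    by_contra hne
    have h3 : ∀ᶠ y in nhds y₀, D.field (D.fourierStar κ f) (event t₀ y) i ≠ 0 ∧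
        y ∈ Metric.ball y₀ ε :=
      (hci.continuousAt.eventually_ne hne).and (Metric.ball_mem_nhds y₀ hε)
    have h4 : ∃ᵐ y ∂(volume : Measure E3), D.field (D.fourierStar κ f) (event t₀ y) i ≠ 0 ∧
        y ∈ Metric.ball y₀ ε := by
      intro h5
      exact (Measure.measure_pos_of_mem_nhds volume h3).ne' (by
        rw [ae_iff] at h5
        simpa using h5)
    exact h4 (h1.mono fun y hy hy' => hy'.1 (hy hy'.2))
  ext i
  exact hi i

/-- The points `κ₂ u` and `κ₁ v` are spacelike to each other iff `κ₁² + κ₂² < 2 κ₁ κ₂ u·v`. -/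
lemma _root_.HypDirac.spacelike_iff {κ₁ κ₂ : ℝ} (u v : E3) :
    |κ₂ * pt u 0 - κ₁ * pt v 0| < ‖κ₂ • u - κ₁ • v‖
      ↔ κ₁ ^ 2 + κ₂ ^ 2 < 2 * κ₁ * κ₂ * (pt u 0 * pt v 0 - inner ℝ u v) := by
  rw [← abs_norm (κ₂ • u - κ₁ • v), ← sq_lt_sq, norm_sub_sq_real, norm_smul, norm_smul, mul_pow,
    mul_pow, real_inner_smul_left, real_inner_smul_right]
  simp only [Real.norm_eq_abs, sq_abs]
  have h1 := pt_zero_sq u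
  have h2 := pt_zero_sq v
  constructor <;> intro h <;> nlinarith

/-- `1 < u·v` for different points of the hyperboloid. -/
lemma _root_.HypDirac.one_lt_of_ne {u v : E3} (h : u ≠ v) :
    1 < pt u 0 * pt v 0 - inner ℝ u v := by
  have h1 := pt_zero_sq u
  have h2 := pt_zero_sq v
  have h3 := pt_zero_pos u
  have h4 := pt_zero_pos v
  have h5 : 0 < ‖u - v‖ ^ 2 := by
    have := norm_pos_iff.2 (sub_ne_zero.2 h)
    positivity
  have h6 := real_inner_mul_inner_self_le u v
  rw [real_inner_self_eq_norm_sq, real_inner_self_eq_norm_sq] at h6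
  rw [norm_sub_sq_real] at h5
  have h7 : (1 + inner ℝ u v) ^ 2 < (pt u 0 * pt v 0) ^ 2 := by
    rw [mul_pow, h1, h2]
    nlinarith
  have h8 := lt_of_pow_lt_pow_left₀ 2 (by positivity) h7
  linarith

/-! ### Unitarity -/

lemma integrable_density_test (f : TestFun) {h : E3 → Spinor} (hh : Continuous h) :
    Integrable (fun x => D.density x (f.1 x) (h x)) hypMeasure :=
  (D.continuous_density f.2.1.continuous hh).integrable_of_hasCompactSupport
    (HasCompactSupport.intro f.2.2 fun x hx => by
      rw [image_eq_zero_of_notMem_tsupport hx, density_zero_left])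

/-- The extension `F_κ` is given by the integral on rapidly decaying functions as well. -/
lemma fn_F_ofRapidDecay {κ : ℝ} (hκ : 0 < κ) {g : E3 → Spinor} (hg : RapidDecay g) :
    (D.F κ (D.ofRapidDecay hg)).fn =ᵐ[hypMeasure] D.fourier κ g := by
  obtain ⟨G, hG⟩ : ∃ G, G = D.F κ (D.ofRapidDecay hg) := ⟨_, rfl⟩
  rw [← hG]
  have hc := D.continuous_fourier hg κ
  have hi : ∀ f : TestFun, Integrable (fun x => D.density x (f.1 x) (G.fn x)) hypMeasure := by
    intro f
    refine (Hil.integrable_density (D.emb f) G).congr ?_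
    filter_upwards [D.fn_emb f] with x hx
    rw [hx]
  have h1 := D.ae_eq_zero_on isOpen_univ (h := fun x => G.fn x - D.fourier κ g x)
    (fun f => by
      simp only [density_sub_right]
      exact (hi f).sub (D.integrable_density_test f hc))
    (fun f _ => by
      simp only [density_sub_right]
      rw [integral_sub (hi f) (D.integrable_density_test f hc), sub_eq_zero,
        D.integral_density_fourierStar f.2 κ hg,
        ← Hil.inner_eq (D.extends_Fstar hκ f) (D.fn_ofRapidDecay hg), Fstar_eq_adjoint D hκ,
        ContinuousLinearMap.adjoint_inner_left, ← hG,
        Hil.inner_eq (D.fn_emb f) Filter.EventuallyEq.rfl])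
  filter_upwards [h1] with x hx
  exact sub_eq_zero.1 (hx (mem_univ x))

lemma fn_F_Fstar_emb {κ κ' : ℝ} (hκ : 0 < κ) (hκ' : 0 < κ') (f : TestFun) :
    (D.F κ' (D.Fstar κ (D.emb f))).fn =ᵐ[hypMeasure] D.fourier κ' (D.fourierStar κ f) := by
  rw [D.Fstar_emb hκ]
  exact D.fn_F_ofRapidDecay hκ' _

lemma fourier_fourierStar_eq_zero {κ : ℝ} (hκ : 0 < κ) {f : E3 → Spinor} (hf : f ∈ TestFun) {u : E3}
    (hu : u ∉ tsupport f) : D.fourier κ (D.fourierStar κ f) u = 0 := by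
  rw [fourier_eq, pt_eq_event, smul_event, D.field_fourierStar_eq_zero hf hκ.ne', smul_zero]
  intro v hv
  rw [spacelike_iff]
  have h1 := one_lt_of_ne (u := u) (v := v) fun h => hu (h ▸ hv)
  have h2 : 0 < κ ^ 2 := by positivity
  nlinarith

lemma adjoint_F_Fstar {κ : ℝ} (hκ : 0 < κ) (f g : D.Hil) :
    inner ℂ f (D.F κ (D.Fstar κ g)) = inner ℂ (D.F κ (D.Fstar κ f)) g := by
  rw [D.Fstar_eq_adjoint hκ]
  exact (ContinuousLinearMap.adjoint_inner_left (D.F κ) _ _).symm.trans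
    (ContinuousLinearMap.adjoint_inner_right (D.F κ) _ _)

/-- The operator `F_κ F_κ^*` does not enlarge supports. -/
lemma F_Fstar_local {κ : ℝ} (hκ : 0 < κ) {O : Set E3} (hO : IsOpen O) (h : D.Hil)
    (H : ∀ᵐ x ∂hypMeasure, x ∈ O → h.fn x = 0) :
    ∀ᵐ x ∂hypMeasure, x ∈ O → (D.F κ (D.Fstar κ h)).fn x = 0 := by
  refine Hil.ae_eq_zero_on hO _ fun f hf => ?_
  rw [D.adjoint_F_Fstar hκ, Hil.inner_eq (D.fn_F_Fstar_emb hκ hκ f) Filter.EventuallyEq.rfl]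
  refine integral_eq_zero_of_ae ?_
  filter_upwards [H] with x hx
  by_cases hxO : x ∈ O
  · rw [hx hxO, density, Matrix.mulVec_zero, dotProduct_zero]; rfl
  · rw [D.fourier_fourierStar_eq_zero hκ f.2 fun h => hxO (hf h), density_zero_left]; rfl

lemma density_indicator (h : E3 → Spinor) (A : Set E3) (x : E3) (v : Spinor) :
    D.density x v (A.indicator h x) = A.indicator (fun x => D.density x v (h x)) x := by
  by_cases hx : x ∈ A
  · simp [hx]
  · simp [hx, density]

variable {D} in
/-- The restriction of an element of the Hilbert space to a measurable set. -/
noncomputable def Hil.restrict (h : D.Hil) {A : Set E3} (hA : MeasurableSet A) : D.Hil :=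
  ⟨AEEqFun.mk (A.indicator h.fn) (h.fn.aestronglyMeasurable.indicator hA), by
    refine ((Hil.integrable_density h h).indicator hA).congr ?_
    filter_upwards [AEEqFun.coeFn_mk (μ := hypMeasure) (A.indicator h.fn)
      (h.fn.aestronglyMeasurable.indicator hA)] with x hx
    rw [hx]
    by_cases hxA : x ∈ A
    · simp [hxA]
    · simp [hxA, density]⟩

variable {D} in
lemma Hil.fn_restrict (h : D.Hil) {A : Set E3} (hA : MeasurableSet A) :
    (h.restrict hA).fn =ᵐ[hypMeasure] A.indicator h.fn := AEEqFun.coeFn_mk _ _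

variable {D} in
lemma Hil.restrict_add_compl (h : D.Hil) {A : Set E3} (hA : MeasurableSet A) :
    h.restrict hA + h.restrict hA.compl = h := by
  refine Hil.ext_fn ?_
  filter_upwards [Hil.fn_add (h.restrict hA) (h.restrict hA.compl), h.fn_restrict hA,
    h.fn_restrict hA.compl] with x h1 h2 h3
  rw [h1, Pi.add_apply, h2, h3]
  exact congrFun (indicator_self_add_compl A h.fn) x

/-- The restrictions to open sets of an element of the kernel of `F_κ^*` are in the kernel, since
`F_κ F_κ^*` is local. -/
lemma Fstar_restrict_eq_zero {κ : ℝ} (hκ : 0 < κ) {h : D.Hil} (hh : D.Fstar κ h = 0) {A : Set E3}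
    (hA : IsOpen A) : D.Fstar κ (h.restrict hA.measurableSet) = 0 := by
  have hm := hA.measurableSet
  have h1 := D.F_Fstar_local hκ hA (h.restrict hm.compl) (by
    filter_upwards [h.fn_restrict hm.compl] with x hx hxA
    rw [hx]; simp [hxA])
  have h2 : D.F κ (D.Fstar κ (h.restrict hm)) = (-1 : ℂ) • D.F κ (D.Fstar κ (h.restrict hm.compl)) := by
    have h3 := congrArg (fun g => D.F κ (D.Fstar κ g)) (h.restrict_add_compl hm)
    simp only [map_add, hh, map_zero] at h3
    rw [neg_one_smul]
    exact eq_neg_of_add_eq_zero_left h3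
  -- `F_κ F_κ^* (1_A h) = -F_κ F_κ^* (1_{Aᶜ} h)` vanishes on `A`, so `‖F_κ^* (1_A h)‖² = 0`
  have h4 : inner ℂ (h.restrict hm) (D.F κ (D.Fstar κ (h.restrict hm))) = 0 := by
    rw [Hil.inner_eq (h.fn_restrict hm) Filter.EventuallyEq.rfl]
    refine integral_eq_zero_of_ae ?_
    have h5 := Hil.fn_smul (-1 : ℂ) (D.F κ (D.Fstar κ (h.restrict hm.compl)))
    rw [← h2] at h5
    filter_upwards [h1, h5] with x hx hx'
    by_cases hxA : x ∈ A
    · rw [hx', Pi.smul_apply, hx hxA, smul_zero, density, Matrix.mulVec_zero, dotProduct_zero]; rfl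
    · simp [hxA, density]
  rw [← ContinuousLinearMap.adjoint_inner_left, ← D.Fstar_eq_adjoint hκ, inner_self_eq_zero] at h4
  exact h4

/-- Delta sequences recover the kernel of the transformation. -/
lemma tendsto_field_bump (φ : ℕ → ContDiffBump (0 : E3))
    (hφ : Filter.Tendsto (fun n => (φ n).rOut) Filter.atTop (nhds 0)) (x : Mink) (v : Spinor) :
    Filter.Tendsto (fun n => D.field (fun z => ((φ n).normed volume z : ℂ) • v) x) Filter.atTop
      (nhds (D.ker x 0 *ᵥ v)) := by
  have hc : Continuous fun z : E3 => (1 / pt (-z) 0) • (D.ker x (-z) *ᵥ v) :=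
    (continuous_inv_pt_zero.comp continuous_neg).smul ((D.continuous_ker.comp
      (continuous_const.prodMk continuous_neg)).matrix_mulVec continuous_const)
  have h1 := ContDiffBump.convolution_tendsto_right_of_continuous (μ := volume) hφ hc 0
  have h2 : ∀ n, D.field (fun z => ((φ n).normed volume z : ℂ) • v) x
      = MeasureTheory.convolution ((φ n).normed volume)
        (fun z : E3 => (1 / pt (-z) 0) • (D.ker x (-z) *ᵥ v)) (ContinuousLinearMap.lsmul ℝ ℝ)
        volume 0 := by
    intro n
    rw [field, integral_hypMeasure, convolution_def]
    refine integral_congr_ae (Filter.Eventually.of_forall fun z => ?_)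
    simp only [zero_sub, neg_neg, ContinuousLinearMap.lsmul_apply, Complex.coe_smul,
      Matrix.mulVec_smul]
    rw [smul_comm]
  simp only [h2]
  have h3 : (1 / pt (-(0 : E3)) 0) • (D.ker x (-0) *ᵥ v) = D.ker x 0 *ᵥ v := by
    simp [pt_zero]
  rw [h3] at h1
  exact h1

/-- The kernel of `F_κ^*` is trivial. -/
lemma eq_zero_of_Fstar_eq_zero {κ : ℝ} (hκ : 0 < κ) {h : D.Hil} (hh : D.Fstar κ h = 0) : h = 0 := by
  have hset : ∀ (f : TestFun) (A : Set E3), IsOpen A →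
      ∫ x in A, D.density x (D.fourier κ f x) (h.fn x) ∂hypMeasure = 0 := by
    intro f A hA
    have h1 : inner ℂ (D.emb f) (D.Fstar κ (h.restrict hA.measurableSet)) = 0 := by
      rw [D.Fstar_restrict_eq_zero hκ hh hA, inner_zero_right]
    rw [D.Fstar_eq_adjoint hκ, ContinuousLinearMap.adjoint_inner_right,
      Hil.inner_eq (D.extends_F hκ f) (h.fn_restrict hA.measurableSet)] at h1
    simp only [density_indicator] at h1
    rw [← integral_indicator hA.measurableSet]
    refine Eq.trans ?_ h1
    refine integral_congr_ae (Filter.Eventually.of_forall fun x => ?_)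
    by_cases hx : x ∈ A <;> simp [hx]
  -- the densities of `F_κ f` and `h` integrate to zero over all open, hence all closed sets
  have hae : ∀ f : TestFun, ∀ᵐ x ∂hypMeasure, D.density x (D.fourier κ f x) (h.fn x) = 0 := by
    intro f
    have hi : Integrable (fun x => D.density x (D.fourier κ f x) (h.fn x)) hypMeasure := by
      refine (Hil.integrable_density (D.F κ (D.emb f)) h).congr ?_
      filter_upwards [D.extends_F hκ f] with x hx
      rw [hx]
    refine ae_eq_zero_of_forall_setIntegral_isClosed_eq_zero hi fun s hs => ?_
    have h1 := integral_add_compl hs.measurableSet hi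
    have h2 := hset f univ isOpen_univ
    rw [setIntegral_univ] at h2
    rwa [hset f sᶜ hs.isOpen_compl, add_zero, h2] at h1
  -- let `f` run through a sequence that concentrates at the origin
  obtain ⟨φ, hφ⟩ : ∃ φ : ℕ → ContDiffBump (0 : E3),
      Filter.Tendsto (fun n => (φ n).rOut) Filter.atTop (nhds 0) := by
    refine ⟨fun n => ⟨1 / ((n : ℝ) + 1) / 2, 1 / ((n : ℝ) + 1), by positivity,
      half_lt_self (by positivity)⟩, ?_⟩
    exact tendsto_one_div_add_atTop_nhds_zero_nat
  have htest : ∀ (n : ℕ) (i : Fin 4),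
      (fun z => ((φ n).normed volume z : ℂ) • (Pi.single i 1 : Spinor)) ∈ TestFun := fun n i =>
    ⟨ContDiff.smul (Complex.ofRealCLM.contDiff.comp (φ n).contDiff_normed) contDiff_const,
      HasCompactSupport.intro ((φ n).hasCompactSupport_normed (μ := volume)) fun x hx => by
        simp [image_eq_zero_of_notMem_tsupport hx]⟩
  have hall : ∀ᵐ x ∂hypMeasure, ∀ (n : ℕ) (i : Fin 4),
      D.density x (D.fourier κ (fun z => ((φ n).normed volume z : ℂ) • (Pi.single i 1 : Spinor)) x)
        (h.fn x) = 0 := by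
    rw [ae_all_iff]; intro n
    rw [ae_all_iff]; intro i
    exact hae ⟨_, htest n i⟩
  refine Hil.ext_fn ?_
  have h0 : (0 : D.Hil).fn =ᵐ[hypMeasure] 0 := AEEqFun.coeFn_zero
  filter_upwards [hall, h0] with x hx h0
  rw [h0, Pi.zero_apply]
  have hker : ∀ i : Fin 4, D.density x (D.ker (κ • pt x) 0 *ᵥ Pi.single i 1) (h.fn x) = 0 := by
    intro i
    have h1 := D.tendsto_field_bump φ hφ (κ • pt x) (Pi.single i 1)
    have h2 : Continuous fun v => D.density x v (h.fn x) := by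
      unfold density
      exact (continuous_star.dotProduct continuous_const)
    refine tendsto_nhds_unique ((h2.tendsto _).comp h1) ?_
    refine tendsto_const_nhds.congr fun n => ?_
    have h3 := hx n i
    have hpi := Real.pi_pos
    have hc : ((κ / (2 * Real.pi)) ^ (3 / 2 : ℝ) : ℝ) ≠ 0 := by positivity
    rw [fourier_eq, density_eq_pairing, map_smul, smul_apply, smul_eq_zero] at h3
    exact (h3.resolve_left hc).symm
  refine D.eq_zero_of_wt_mulVec (x := x) ?_
  have h4 : (D.ker (κ • pt x) 0)ᴴ *ᵥ (D.wt x *ᵥ h.fn x) = 0 := by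
    ext i
    have h5 := hker i
    rw [density, ← wt, Matrix.star_mulVec, ← Matrix.dotProduct_mulVec, ← Pi.single_star] at h5
    simpa using h5
  generalize D.wt x *ᵥ h.fn x = w at h4 ⊢
  -- the matrix `ker` is invertible
  have h6 : D.slash (pt 0) * D.kerAdj (κ • pt x) 0 * D.ker (κ • pt x) 0 = 1 := by
    rw [mul_assoc, kerAdj_mul_ker, slash_pt_sq]
  have h7 := congrArg Matrix.conjTranspose h6
  rw [Matrix.conjTranspose_mul, Matrix.conjTranspose_one] at h7
  have h8 := mul_eq_one_comm.1 h7
  have h9 := congrArg (fun v => (D.slash (pt 0) * D.kerAdj (κ • pt x) 0)ᴴ *ᵥ v) h4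
  simpa only [Matrix.mulVec_mulVec, h8, Matrix.one_mulVec, Matrix.mulVec_zero] using h9

lemma Fstar_comp_F {κ : ℝ} (hκ : 0 < κ) :
    D.Fstar κ ∘L D.F κ = ContinuousLinearMap.id ℂ D.Hil := by
  rw [D.Fstar_eq_adjoint hκ, D.adjoint_F_comp_F hκ]

lemma Fstar_F {κ : ℝ} (hκ : 0 < κ) (f : D.Hil) : D.Fstar κ (D.F κ f) = f :=
  congrArg (fun T => T f) (D.Fstar_comp_F hκ)

/-- `F_κ F_κ^* f - f` is in the kernel of `F_κ^*`. -/
lemma F_Fstar {κ : ℝ} (hκ : 0 < κ) (f : D.Hil) : D.F κ (D.Fstar κ f) = f := by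
  rw [← sub_eq_zero]
  refine D.eq_zero_of_Fstar_eq_zero hκ ?_
  rw [map_sub, D.Fstar_F hκ, sub_self]

lemma F_comp_Fstar {κ : ℝ} (hκ : 0 < κ) :
    D.F κ ∘L D.Fstar κ = ContinuousLinearMap.id ℂ D.Hil :=
  ContinuousLinearMap.ext (D.F_Fstar hκ)

lemma norm_Fstar {κ : ℝ} (hκ : 0 < κ) (f : D.Hil) : ‖D.Fstar κ f‖ = ‖f‖ := by
  rw [← D.norm_F hκ, D.F_Fstar hκ]

end DiracMatrices

/-! ### The derivative in the mass parameter -/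

lemma RapidDecay.hasDerivAt_waves_smul {a : E3 → Spinor} (ha : RapidDecay a) (X : Mink) (κ : ℝ) :
    HasDerivAt (fun κ : ℝ => waves a (κ • X))
      (waves (fun z => (Complex.I * (mdot X (pt z) : ℝ)) • a z) (κ • X)) κ := by
  have h1 := (ha.hasFDerivAt_waves (κ • X)).comp_hasDerivAt κ ((hasDerivAt_id κ).smul_const X)
  refine h1.congr_deriv ?_
  simp only [one_smul, _root_.sum_apply, ContinuousLinearMap.smulRight_apply,
    ContinuousLinearMap.proj_apply]
  have h2 : (fun z => (Complex.I * (mdot X (pt z) : ℝ)) • a z)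
      = fun z => ∑ b, (X b : ℂ) • HypDirac.momentum b a z := by
    ext1 z
    simp only [HypDirac.momentum, smul_smul, ← Finset.sum_smul, mdot]
    congr 1
    push_cast
    rw [Finset.mul_sum]
    exact Finset.sum_congr rfl fun b _ => by ring
  rw [h2, waves_sum _ fun b => (ha.momentum b).smul continuous_const ‖(X b : ℂ)‖ 0 fun z => by simp]
  simp only [waves_smul]
  simp only [Complex.coe_smul]

/-- Integration by parts in a superposition of plane waves. -/
lemma waves_fderiv {h : E3 → Spinor} (hh : h ∈ TestFun) (t : ℝ) (y : E3) (j : Fin 3) :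
    waves (fun z => fderiv ℝ h z (unitVec j)) (event t y)
      = -waves (fun z => (Complex.I * (t * z j / pt z 0 - y j : ℝ)) • h z) (event t y) := by
  have he : ∀ z : E3, HasFDerivAt (fun z => Complex.exp (Complex.I * (mdot (event t y) (pt z) : ℝ)))
      ((Complex.exp (Complex.I * (mdot (event t y) (pt z) : ℝ)) * Complex.I) •
        Complex.ofRealCLM.comp (t • (pt z 0)⁻¹ • innerSL ℝ z - innerSL ℝ y)) z := by
    intro z
    simp only [mdot_event_pt]
    have h1 : HasFDerivAt (fun z : E3 => t * pt z 0 - inner ℝ y z)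
        (t • (pt z 0)⁻¹ • innerSL ℝ z - innerSL ℝ y) z :=
      ((hasFDerivAt_pt_zero z).const_mul t).sub (innerSL ℝ y).hasFDerivAt
    have h2 := ((Complex.ofRealCLM.hasFDerivAt.comp z h1).const_mul Complex.I).cexp
    refine h2.congr_fderiv ?_
    ext v
    simp
    ring
  have hc := continuous_wave (event t y)
  have hd : ∀ z, fderiv ℝ (fun z => Complex.exp (Complex.I * (mdot (event t y) (pt z) : ℝ))) z
      (unitVec j) • h z = Complex.exp (Complex.I * (mdot (event t y) (pt z) : ℝ)) •
        (Complex.I * (t * z j / pt z 0 - y j : ℝ)) • h z := by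
    intro z
    rw [(he z).fderiv, smul_smul _ _ (h z)]
    congr 1
    simp [EuclideanSpace.inner_single_right]
    ring
  have hcont : Continuous fun z : E3 => (Complex.I * (t * z j / pt z 0 - y j : ℝ) : ℂ) := by
    have h1 : Continuous fun z : E3 => t * z j / pt z 0 - y j :=
      ((by fun_prop : Continuous fun z : E3 => t * z j).div continuous_pt_zero
        fun z => (pt_zero_pos z).ne').sub continuous_const
    fun_prop
  have hfc : Continuous fun z => fderiv ℝ h z (unitVec j) :=
    (hh.1.continuous_fderiv (by simp)).clm_apply continuous_const
  have ibp := integral_smul_fderiv_eq_neg_fderiv_smul_of_integrable (μ := volume)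
    (f := fun z => Complex.exp (Complex.I * (mdot (event t y) (pt z) : ℝ))) (g := h)
    (v := unitVec j) (by
      simp only [hd]
      exact (hc.smul (hcont.smul hh.1.continuous)).integrable_of_hasCompactSupport
        (HasCompactSupport.intro hh.2 fun z hz => by
          simp [image_eq_zero_of_notMem_tsupport hz]))
    ((hc.smul hfc).integrable_of_hasCompactSupport (HasCompactSupport.intro hh.2 fun z hz => by
      have h2 : fderiv ℝ h z = 0 :=
        image_eq_zero_of_notMem_tsupport fun h' => hz (tsupport_fderiv_subset ℝ h')
      simp [h2]))
    ((hc.smul hh.1.continuous).integrable_of_hasCompactSupport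
      (HasCompactSupport.intro hh.2 fun z hz => by
        simp [image_eq_zero_of_notMem_tsupport hz]))
    (fun z _ => (he z).differentiableAt) (fun z _ => hh.1.differentiable (by simp) z)
  simp only [hd] at ibp
  exact ibp

namespace DiracMatrices
variable (D : DiracMatrices)

/-- The tangential Dirac operator `γ_T^a δ_a`, in the coordinates of the hyperboloid. -/
noncomputable def tangDirac (f : E3 → Spinor) (x : E3) : Spinor :=
  ∑ j : Fin 3, D.γT x j.succ *ᵥ fderiv ℝ f x (unitVec j)

lemma sum_γT (x : E3) : ∑ a, ((sgn a * pt x a : ℝ) : ℂ) • D.γT x a = 0 := by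
  simp only [γT, smul_sub, smul_smul, Finset.sum_sub_distrib, ← Finset.sum_smul]
  have h : ∑ a, ((sgn a * pt x a : ℝ) : ℂ) * (pt x a : ℂ) = 1 := by
    have := mdot_pt x
    unfold mdot at this
    exact_mod_cast this
  rw [h, one_smul, slash, sub_self]

lemma sum_γT_tderiv (f : E3 → Spinor) (x : E3) :
    ∑ a, D.γT x a *ᵥ tderiv a f x = D.tangDirac f x := by
  have h1 : ∀ a, tderiv a f x = ∑ j : Fin 3, (tangProj x a j.succ) • fderiv ℝ f x (unitVec j) := by
    intro a
    have h2 : (WithLp.toLp 2 fun j : Fin 3 => tangProj x a j.succ : E3)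
        = ∑ j, tangProj x a j.succ • unitVec j := by
      ext i
      simp [Pi.single_apply]
    rw [tderiv, h2, map_sum]
    simp only [map_smul]
  simp only [h1, Matrix.mulVec_sum, tangDirac]
  rw [Finset.sum_comm]
  refine Finset.sum_congr rfl fun j _ => ?_
  have h3 := congrArg (fun A => A *ᵥ fderiv ℝ f x (unitVec j)) (D.sum_γT x)
  simp only [Matrix.sum_mulVec, Matrix.smul_mulVec, Matrix.zero_mulVec] at h3
  have h4 : ∀ a, D.γT x a *ᵥ (tangProj x a j.succ • fderiv ℝ f x (unitVec j))
      = (if a = j.succ then D.γT x a *ᵥ fderiv ℝ f x (unitVec j) else 0)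
        - (pt x j.succ : ℂ) • ((sgn a * pt x a : ℝ) : ℂ) •
          (D.γT x a *ᵥ fderiv ℝ f x (unitVec j)) := by
    intro a
    rw [← Complex.coe_smul, Matrix.mulVec_smul, tangProj]
    split_ifs with h
    · push_cast; module
    · push_cast; module
  simp only [h4, Finset.sum_sub_distrib, ← Finset.smul_sum, h3, smul_zero, sub_zero]
  simp

lemma γ_mul_slash (a : Fin 4) (v : Mink) :
    D.γ a * D.slash v = (2 * v a : ℂ) • 1 - D.slash v * D.γ a := by
  rw [eq_sub_iff_add_eq]
  simp only [slash, Finset.sum_mul, Finset.mul_sum, smul_mul_assoc, mul_smul_comm,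
    ← Finset.sum_add_distrib, ← smul_add, D.clifford, smul_smul, ← Finset.sum_smul]
  congr 1
  rw [Finset.sum_eq_single a]
  · have : (sgn a : ℂ) * sgn a = 1 := by
      unfold sgn; split_ifs <;> simp
    rw [if_pos rfl]
    push_cast
    linear_combination (2 * v a : ℂ) * this
  · intro b _ hb
    simp [Ne.symm hb]
  · simp

/-- The matrices `γ_T^a` anticommute with `γ·z`. -/
lemma γT_mul_slash (x : E3) (a : Fin 4) :
    D.γT x a * D.slash (pt x) = -(D.slash (pt x) * D.γT x a) := by
  rw [γT, sub_mul, mul_sub, smul_mul_assoc, mul_smul_comm, slash_pt_sq, γ_mul_slash]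
  module

lemma sum_sgn_γT_mul_γT (x : E3) : ∑ a, (sgn a : ℂ) • (D.γT x a * D.γT x a) = (3 : ℂ) • 1 := by
  have h1 : ∀ a, (sgn a : ℂ) • (D.γT x a * D.γT x a)
      = (1 : Matrix (Fin 4) (Fin 4) ℂ) - ((sgn a * pt x a : ℝ) * (pt x a : ℂ)) • 1 := by
    intro a
    have h2 := D.clifford a a
    rw [if_pos rfl, ← two_smul ℂ] at h2
    have h3 : D.γ a * D.γ a = (sgn a : ℂ) • 1 := by
      refine smul_right_injective _ (two_ne_zero (α := ℂ)) ?_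
      simp only [h2, smul_smul]
    have hs : (sgn a : ℂ) * sgn a = 1 := by
      unfold sgn; split_ifs <;> simp
    have h4 : D.γT x a * D.γT x a
        = D.γ a * D.γ a - ((pt x a : ℂ) * pt x a) • 1 := by
      rw [γT, sub_mul, mul_sub, mul_sub, smul_mul_assoc, smul_mul_smul_comm, mul_smul_comm,
        slash_pt_sq, γ_mul_slash]
      module
    rw [h4, h3, smul_sub, smul_smul, smul_smul, hs, one_smul]
    push_cast
    module
  simp only [h1, Finset.sum_sub_distrib, ← Finset.sum_smul]
  have h : ∑ a, ((sgn a * pt x a : ℝ) : ℂ) * (pt x a : ℂ) = 1 := by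
    have := mdot_pt x
    unfold mdot at this
    exact_mod_cast this
  rw [h]
  simp only [Finset.sum_const, Finset.card_univ, Fintype.card_fin]
  module

lemma sum_γT_pOp (f : E3 → Spinor) (x : E3) :
    ∑ a, D.γT x a *ᵥ D.pOp a f x
      = Complex.I • (D.tangDirac f x - (3 / 2 : ℂ) • (D.slash (pt x) *ᵥ f x)) := by
  have h1 : ∀ a, D.γT x a *ᵥ D.pOp a f x = Complex.I • (D.γT x a *ᵥ tderiv a f x
      + (-(1 / 2 : ℂ)) • ((D.slash (pt x) * ((sgn a : ℂ) • (D.γT x a * D.γT x a))) *ᵥ f x)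
      - (3 / 2 : ℂ) • ((((sgn a * pt x a : ℝ) : ℂ) • D.γT x a) *ᵥ f x)) := by
    intro a
    rw [pOp, Matrix.mulVec_smul, Matrix.mulVec_sub, Matrix.mulVec_add, Matrix.mulVec_smul,
      Matrix.mulVec_smul, Matrix.mulVec_mulVec, ← mul_assoc, γT_mul_slash]
    congr 2
    · congr 1
      rw [neg_mul, Matrix.neg_mulVec, smul_neg, neg_smul, mul_smul_comm, mul_smul_comm, mul_assoc]
    · rw [Matrix.smul_mulVec, smul_smul]
      push_cast
      rfl
  simp only [h1, ← Finset.smul_sum, Finset.sum_sub_distrib, Finset.sum_add_distrib,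
    ← Matrix.sum_mulVec, ← Finset.mul_sum]
  rw [D.sum_γT_tderiv, D.sum_γT, D.sum_sgn_γT_mul_γT, Matrix.zero_mulVec, mul_smul_comm, mul_one,
    Matrix.smul_mulVec]
  module

/-- The amplitude of `F_κ^* H_κ f`. -/
lemma source_hamFun (κ : ℝ) (f : E3 → Spinor) (z : E3) :
    Complex.I • D.source (D.hamFun κ f) z
      = ((1 / pt z 0 : ℝ) : ℂ) • ((κ : ℂ)⁻¹ • (D.tangDirac f z
          - (3 / 2 : ℂ) • (D.slash (pt z) *ᵥ f z)) + Complex.I • f z) := by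
  have hI : Complex.I * Complex.I = -1 := Complex.I_mul_I
  rw [source, hamFun, Matrix.mulVec_mulVec, slash_pt_sq, Matrix.one_mulVec, sum_γT_pOp,
    smul_comm Complex.I]
  congr 1
  rw [smul_add, smul_neg, smul_comm Complex.I, smul_smul Complex.I Complex.I, hI]
  module

/-- The tangential amplitude `γ_T^j f / z⁰`, whose divergence is taken. -/
noncomputable def tangAmplitude (f : E3 → Spinor) (j : Fin 3) (x : E3) : Spinor :=
  ((1 / pt x 0 : ℝ) : ℂ) • (D.γT x j.succ *ᵥ f x)

lemma tangAmplitude_mem_testFun {f : E3 → Spinor} (hf : f ∈ TestFun) (j : Fin 3) :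
    D.tangAmplitude f j ∈ TestFun :=
  smul_mem_testFun contDiff_inv_pt_zero (mulVec_mem_testFun (D.contDiff_γT j.succ) hf)

lemma slash_pt_mulVec (x : E3) (v : Spinor) :
    D.slash (pt x) *ᵥ v = pt x 0 • (D.γ 0 *ᵥ v) - ∑ k : Fin 3, x k • (D.γ k.succ *ᵥ v) := by
  rw [slash_mulVec, Fin.sum_univ_succ, sub_eq_add_neg, ← Finset.sum_neg_distrib]
  simp [sgn, pt_succ]

lemma tangAmplitude_eq (f : E3 → Spinor) (j : Fin 3) (x : E3) :
    D.tangAmplitude f j x = (pt x 0)⁻¹ • (D.γ j.succ *ᵥ f x) - x j • (D.γ 0 *ᵥ f x)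
      + ∑ k : Fin 3, (x j * x k * (pt x 0)⁻¹) • (D.γ k.succ *ᵥ f x) := by
  have hp := (pt_zero_pos x).ne'
  rw [tangAmplitude, γT, Matrix.sub_mulVec, Matrix.smul_mulVec, slash_pt_mulVec, Complex.coe_smul,
    Complex.coe_smul, pt_succ, smul_sub, smul_sub, smul_sub, Finset.smul_sum, Finset.smul_sum,
    sub_sub_eq_add_sub, smul_smul, smul_smul, one_div]
  simp only [smul_smul]
  have h1 : (pt x 0)⁻¹ * x j * pt x 0 = x j := by field_simp
  have h2 : ∀ k, (pt x 0)⁻¹ * (x j * x k) = x j * x k * (pt x 0)⁻¹ := fun k => by ring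
  simp only [← mul_assoc] at h2 ⊢
  simp only [h1, h2]
  abel

/-- The divergence of the tangential amplitude: besides `γ_T^a δ_a f` there is a curvature term, the
contraction `-3 z_a` of the derivative of the projection onto the tangent space with `γ^a`. -/
lemma sum_fderiv_tangAmplitude {f : E3 → Spinor} (hf : ContDiff ℝ ∞ f) (x : E3) :
    ∑ j, fderiv ℝ (D.tangAmplitude f j) x (unitVec j)
      = ((1 / pt x 0 : ℝ) : ℂ) • (D.tangDirac f x - (3 : ℂ) • (D.slash (pt x) *ᵥ f x)) := by
  have hp := pt_zero_pos x
  have hsq := pt_zero_sq x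
  obtain ⟨q, hq⟩ : ∃ q : ℝ, q = (pt x 0)⁻¹ := ⟨_, rfl⟩
  have hf' := (hf.differentiable (by simp) x).hasFDerivAt
  have hterm : ∀ {c : E3 → ℝ} {c' : E3 →L[ℝ] ℝ} (A : Matrix (Fin 4) (Fin 4) ℂ),
      HasFDerivAt c c' x → HasFDerivAt (fun x => c x • (A *ᵥ f x))
        (c x • (((mulVecL A).restrictScalars ℝ).comp (fderiv ℝ f x))
          + c'.smulRight (A *ᵥ f x)) x := fun A hc =>
    hc.smul (((mulVecL A).restrictScalars ℝ).hasFDerivAt.comp x hf')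
  have hinv : HasFDerivAt (fun x : E3 => (pt x 0)⁻¹) (-(q ^ 3) • innerSL ℝ x) x := by
    refine ((hasDerivAt_inv hp.ne').comp_hasFDerivAt x (hasFDerivAt_pt_zero x)).congr_fderiv ?_
    rw [hq, smul_smul]
    congr 1
    field_simp
  have hcoord : ∀ k : Fin 3, HasFDerivAt (fun x : E3 => x k)
      (EuclideanSpace.proj k : E3 →L[ℝ] ℝ) x := fun k =>
    (EuclideanSpace.proj k : E3 →L[ℝ] ℝ).hasFDerivAt
  have hproj : ∀ (k : Fin 3) (y : E3), (EuclideanSpace.proj k : E3 →L[ℝ] ℝ) y = y k := fun _ _ => rfl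
  have hfd : ∀ j, fderiv ℝ (D.tangAmplitude f j) x (unitVec j)
      = ((1 / pt x 0 : ℝ) : ℂ) • (D.γT x j.succ *ᵥ fderiv ℝ f x (unitVec j))
        + ((-(q ^ 3) * x j) • (D.γ j.succ *ᵥ f x) - D.γ 0 *ᵥ f x
          + ∑ k : Fin 3, (x k * q + (if j = k then x j * q else 0) - x j * x j * x k * q ^ 3)
            • (D.γ k.succ *ᵥ f x)) := by
    intro j
    have h1 := ((hterm (D.γ j.succ) hinv).sub (hterm (D.γ 0) (hcoord j))).add
      (HasFDerivAt.fun_sum (u := Finset.univ) fun k _ =>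
        hterm (D.γ k.succ) (((hcoord j).mul (hcoord k)).mul hinv))
    have h2 : HasFDerivAt (D.tangAmplitude f j) _ x :=
      h1.congr_of_eventuallyEq (Filter.Eventually.of_forall fun y => D.tangAmplitude_eq f j y)
    have h3 := D.tangAmplitude_eq (fun _ => fderiv ℝ f x (unitVec j)) j x
    rw [tangAmplitude] at h3
    rw [h2.fderiv, h3]
    simp only [Pi.mul_apply, _root_.add_apply, _root_.sub_apply, _root_.sum_apply, _root_.smul_apply,
      ContinuousLinearMap.comp_apply, ContinuousLinearMap.smulRight_apply,
      ContinuousLinearMap.coe_restrictScalars', mulVecL_apply, innerSL_apply_apply,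
      hproj, EuclideanSpace.inner_single_right, ← hq]
    simp only [smul_eq_mul, PiLp.single_apply, if_true, mul_one, one_mul, Finset.sum_add_distrib,
      conj_trivial]
    have h4 : ∀ k : Fin 3, (x k * q + (if j = k then x j * q else 0) - x j * x j * x k * q ^ 3)
        = (x j * x k * (-q ^ 3 * x j) + q * (x j * (if k = j then 1 else 0) + x k)) := by
      intro k
      by_cases h : j = k
      · subst h; simp; ring
      · simp [h, Ne.symm h]; ring
    simp only [h4]
    module
  have hx : x 0 ^ 2 + x 1 ^ 2 + x 2 ^ 2 = pt x 0 ^ 2 - 1 := by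
    rw [hsq, EuclideanSpace.norm_sq_eq, Fin.sum_univ_three]; simp
  have hqp : q * pt x 0 = 1 := by rw [hq]; exact inv_mul_cancel₀ hp.ne'
  have hxq : (x 0 ^ 2 + x 1 ^ 2 + x 2 ^ 2) * q ^ 2 = 1 - q ^ 2 := by
    rw [hx]
    linear_combination (q * pt x 0 + 1) * hqp
  simp only [hfd, Finset.sum_add_distrib]
  rw [smul_sub, tangDirac, Finset.smul_sum, sub_eq_add_neg]
  congr 1
  rw [slash_pt_mulVec, Complex.coe_smul, one_div, ← hq]
  simp only [Fin.sum_univ_three]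
  generalize D.γ 0 *ᵥ f x = A₀
  generalize D.γ (Fin.succ 0) *ᵥ f x = A₁
  generalize D.γ (Fin.succ 1) *ᵥ f x = A₂
  generalize D.γ (Fin.succ 2) *ᵥ f x = A₃
  ext i
  have hqpC : (q : ℂ) * (pt x 0 : ℂ) = 1 := by exact_mod_cast hqp
  have hxqC : ((x 0 : ℂ) ^ 2 + (x 1 : ℂ) ^ 2 + (x 2 : ℂ) ^ 2) * (q : ℂ) ^ 2 = 1 - (q : ℂ) ^ 2 := by
    have h := congrArg (fun r : ℝ => (r : ℂ)) hxq
    push_cast at h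
    exact h
  simp only [Pi.add_apply, Pi.sub_apply, Pi.neg_apply, Pi.smul_apply, Complex.real_smul,
    smul_eq_mul, show ((0 : Fin 3) = 1) = False by decide, show ((0 : Fin 3) = 2) = False by decide,
    show ((1 : Fin 3) = 0) = False by decide, show ((1 : Fin 3) = 2) = False by decide,
    show ((2 : Fin 3) = 0) = False by decide, show ((2 : Fin 3) = 1) = False by decide, if_true,
    if_false]
  push_cast
  linear_combination 3 * A₀ i * hqpC - q * (x 0 * A₁ i + x 1 * A₂ i + x 2 * A₃ i) * hxqC

/-- The projection `(1 + s γ·u)/2`, for `s = ±1`. -/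
noncomputable def frequencyProj (s : ℝ) (u : E3) : Matrix (Fin 4) (Fin 4) ℂ :=
  (1 / 2 : ℂ) • (1 + (s : ℂ) • D.slash (pt u))

lemma frequencyProj_mul_slash {s : ℝ} (hs : s * s = 1) (u : E3) :
    D.frequencyProj s u * D.slash (pt u) = (s : ℂ) • D.frequencyProj s u := by
  have hs' : (s : ℂ) * s = 1 := by exact_mod_cast hs
  rw [frequencyProj, smul_mul_assoc, add_mul, one_mul, smul_mul_assoc, slash_pt_sq,
    smul_comm (s : ℂ), smul_add (s : ℂ), smul_smul (s : ℂ), hs', one_smul, add_comm]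

lemma fourierStar_eq_waves {f : E3 → Spinor} (hf : f ∈ TestFun) (κ : ℝ) (u : E3) :
    D.fourierStar κ f u = ((κ / (2 * Real.pi)) ^ (3 / 2 : ℝ) : ℝ) •
      (D.frequencyProj 1 u *ᵥ waves (D.source f) (κ • (1 : ℝ) • pt u)
        + D.frequencyProj (-1) u *ᵥ waves (D.source f) (κ • (-1 : ℝ) • pt u)) := by
  have h1 := D.dual_eq (ν := hypMeasure) (p := fun x => κ • pt x) (continuous_pt.const_smul κ)
    continuous_pt hf.1.continuous hf.2 u
  have h2 := D.integral_exp_source κ f u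
  have h3 := D.integral_exp_source (-κ) f u
  simp only [neg_smul] at h3
  rw [fourierStar_eq_dual, h1]
  congr 1
  refine (congrArg₂ (fun a b : Spinor => (1 / 2 : ℂ) • (a + b)
    + D.slash (pt u) *ᵥ ((1 / 2 : ℂ) • (a - b))) h2 h3).trans ?_
  simp only [frequencyProj, one_smul, neg_smul, smul_neg, Matrix.smul_mulVec, Matrix.add_mulVec,
    Matrix.one_mulVec, Matrix.mulVec_smul, Matrix.mulVec_sub, Complex.ofReal_one,
    Complex.ofReal_neg, Matrix.neg_mulVec]
  module

lemma tangDirac_mem_testFun {f : E3 → Spinor} (hf : f ∈ TestFun) : D.tangDirac f ∈ TestFun := by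
  refine ⟨ContDiff.sum fun j _ => contDiff_mulVec (D.contDiff_γT j.succ)
    ((hf.1.fderiv_right (by simp)).clm_apply contDiff_const),
    HasCompactSupport.intro hf.2 fun z hz => ?_⟩
  have h2 : fderiv ℝ f z = 0 :=
    image_eq_zero_of_notMem_tsupport fun h' => hz (tsupport_fderiv_subset ℝ h')
  simp [tangDirac, h2]

/-- The contraction of the gradient of `u·z` with `γ_T` is `γ·u - (u·z) γ·z`. -/
lemma sum_gradient_γT (u z : E3) :
    ∑ j : Fin 3, ((pt u 0 * z j / pt z 0 - u j : ℝ) : ℂ) • D.γT z j.succ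
      = D.slash (pt u) - ((mdot (pt u) (pt z) : ℝ) : ℂ) • D.slash (pt z) := by
  have hp : (pt z 0 : ℂ) ≠ 0 := by exact_mod_cast (pt_zero_pos z).ne'
  have h1 := D.sum_γT z
  rw [Fin.sum_univ_succ] at h1
  simp only [sgn, if_true, Fin.succ_ne_zero, if_false, pt_succ, one_mul, neg_one_mul,
    Complex.ofReal_neg, neg_smul, Finset.sum_neg_distrib] at h1
  have h2 : ∑ j : Fin 3, (z j : ℂ) • D.γT z j.succ = (pt z 0 : ℂ) • D.γT z 0 :=
    (sub_eq_zero.1 (by rw [sub_eq_add_neg]; exact h1)).symm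
  have h3 : ∑ a, ((sgn a * pt u a : ℝ) : ℂ) • D.γT z a
      = D.slash (pt u) - ((mdot (pt u) (pt z) : ℝ) : ℂ) • D.slash (pt z) := by
    simp only [γT, smul_sub, smul_smul, Finset.sum_sub_distrib, ← Finset.sum_smul]
    refine congrArg₂ _ rfl (congrArg (fun c : ℂ => c • D.slash (pt z)) ?_)
    unfold mdot
    push_cast
    rfl
  rw [← h3, Fin.sum_univ_succ (n := 3)]
  simp only [sgn, if_true, Fin.succ_ne_zero, if_false, pt_succ, one_mul, neg_one_mul]
  have h4 : ∀ j : Fin 3, ((pt u 0 * z j / pt z 0 - u j : ℝ) : ℂ) • D.γT z j.succ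
      = (pt u 0 / pt z 0 : ℂ) • (z j : ℂ) • D.γT z j.succ + ((-u j : ℝ) : ℂ) • D.γT z j.succ := by
    intro j
    rw [smul_smul, ← add_smul]
    congr 1
    push_cast
    ring
  simp only [h4, Finset.sum_add_distrib]
  rw [← Finset.smul_sum, h2, smul_smul, div_mul_cancel₀ _ hp]

/-- Integration by parts in the plane wave integrals of `F_κ^*`. By `sum_gradient_γT` the gradient of
the phase contributes `γ·u f` and `u·z γ·z f`; the latter is the amplitude of the radial
derivative. -/
lemma waves_tangDirac {f : E3 → Spinor} (hf : f ∈ TestFun) (c : ℝ) (u : E3) :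
    waves (fun z => ((1 / pt z 0 : ℝ) : ℂ) • (D.tangDirac f z - (3 : ℂ) • (D.slash (pt z) *ᵥ f z)))
        (c • pt u)
      = (-Complex.I * c) • (D.slash (pt u) *ᵥ waves (fun z => ((1 / pt z 0 : ℝ) : ℂ) • f z) (c • pt u))
        + (c : ℂ) • waves (fun z => (Complex.I * (mdot (pt u) (pt z) : ℝ)) • D.source f z)
          (c • pt u) := by
  have hT := fun j => D.tangAmplitude_mem_testFun hf j
  have hq : (fun z => ((1 / pt z 0 : ℝ) : ℂ) • f z) ∈ TestFun := smul_mem_testFun contDiff_inv_pt_zero hf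
  have hs := rapidDecay_of_mem_testFun (D.source_mem_testFun hf)
  have hfd : ∀ j : Fin 3, RapidDecay fun z => fderiv ℝ (D.tangAmplitude f j) z (unitVec j) := fun j =>
    RapidDecay.of_hasCompactSupport (((hT j).1.continuous_fderiv (by simp)).clm_apply continuous_const)
      ((hT j).2.fderiv_apply ℝ (unitVec j))
  have hcoef : ∀ j : Fin 3, Continuous fun z : E3 =>
      (Complex.I * (c * pt u 0 * z j / pt z 0 - (c • u) j : ℝ) : ℂ) := fun j => by
    have h1 : Continuous fun z : E3 => c * pt u 0 * z j / pt z 0 - (c • u) j :=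
      ((by fun_prop : Continuous fun z : E3 => c * pt u 0 * z j).div continuous_pt_zero
        fun z => (pt_zero_pos z).ne').sub continuous_const
    fun_prop
  have hg : ∀ j : Fin 3, RapidDecay fun z : E3 =>
      (Complex.I * (c * pt u 0 * z j / pt z 0 - (c • u) j : ℝ) : ℂ) • D.tangAmplitude f j z := fun j =>
    RapidDecay.of_hasCompactSupport ((hcoef j).smul (hT j).1.continuous)
      (HasCompactSupport.intro (hT j).2 fun z hz => by
        rw [image_eq_zero_of_notMem_tsupport hz, smul_zero])
  have hmd : RapidDecay fun z => (Complex.I * (mdot (pt u) (pt z) : ℝ)) • D.source f z :=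
    RapidDecay.of_hasCompactSupport
      ((by have := continuous_mdot_pt (pt u); fun_prop :
        Continuous fun z : E3 => (Complex.I * (mdot (pt u) (pt z) : ℝ) : ℂ)).smul hs.1)
      (HasCompactSupport.intro (D.source_mem_testFun hf).2 fun z hz => by
        rw [image_eq_zero_of_notMem_tsupport hz, smul_zero])
  simp only [← D.sum_fderiv_tangAmplitude hf.1]
  rw [waves_sum _ hfd, ← waves_smul, ← waves_mulVec (rapidDecay_of_mem_testFun hq), ← waves_smul,
    ← waves_add (((rapidDecay_of_mem_testFun hq).mulVec _).const_smul _) (hmd.const_smul _)]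
  have h1 : ∀ j, waves (fun z => fderiv ℝ (D.tangAmplitude f j) z (unitVec j)) (c • pt u)
      = waves (fun z => (-1 : ℂ) • (Complex.I * (c * pt u 0 * z j / pt z 0 - (c • u) j : ℝ) : ℂ)
          • D.tangAmplitude f j z) (c • pt u) := by
    intro j
    rw [pt_eq_event, smul_event, waves_fderiv (hT j), waves_smul, neg_one_smul, event_zero]
  simp only [h1]
  rw [← waves_sum _ fun j => (hg j).const_smul _]
  congr 1
  ext1 z
  have h2 := congrArg (fun A => A *ᵥ f z) (D.sum_gradient_γT u z)
  simp only [Matrix.sum_mulVec, Matrix.smul_mulVec, Matrix.sub_mulVec] at h2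
  have h3 : ∀ j : Fin 3, (-1 : ℂ) • (Complex.I * (c * pt u 0 * z j / pt z 0 - (c • u) j : ℝ) : ℂ)
          • D.tangAmplitude f j z
      = (-Complex.I * c * (1 / pt z 0 : ℝ)) • ((pt u 0 * z j / pt z 0 - u j : ℝ) : ℂ) •
        (D.γT z j.succ *ᵥ f z) := by
    intro j
    rw [tangAmplitude, smul_smul, smul_smul, smul_smul]
    congr 1
    simp only [PiLp.smul_apply, smul_eq_mul]
    push_cast
    ring
  simp only [h3, ← Finset.smul_sum, h2]
  rw [source, Matrix.mulVec_smul]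
  module

/-- The derivative of `F_κ^* f` in `κ`, pointwise. The derivatives of the plane waves and of the factor
`κ^{3/2}` give the terms with `κ⁻¹` of `H_κ`; the term `Γ f` comes from `γ·u`, which the frequency
projections turn into the sign of the frequency. -/
lemma hasDerivAt_fourierStar {f : E3 → Spinor} (hf : f ∈ TestFun) {κ : ℝ} (hκ : 0 < κ) (u : E3) :
    HasDerivAt (fun k => D.fourierStar k f u)
      (Complex.I • D.fourierStar κ (D.hamFun κ f) u) κ := by
  have hs := rapidDecay_of_mem_testFun (D.source_mem_testFun hf)
  have hpi := Real.pi_pos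
  have hH : D.hamFun κ f ∈ TestFun := D.hamFun_mem κ ⟨f, hf⟩
  have hq : (fun z => ((1 / pt z 0 : ℝ) : ℂ) • f z) ∈ TestFun := smul_mem_testFun contDiff_inv_pt_zero hf
  have hd : (fun z => ((1 / pt z 0 : ℝ) : ℂ) • (D.tangDirac f z - (3 : ℂ) • (D.slash (pt z) *ᵥ f z)))
      ∈ TestFun :=
    smul_mem_testFun contDiff_inv_pt_zero (TestFun.sub_mem (D.tangDirac_mem_testFun hf)
      (TestFun.smul_mem _ (mulVec_mem_testFun D.contDiff_slash hf)))
  have hκC : (κ : ℂ) ≠ 0 := by exact_mod_cast hκ.ne'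
  have hc : HasDerivAt (fun k : ℝ => (k / (2 * Real.pi)) ^ (3 / 2 : ℝ))
      ((κ / (2 * Real.pi)) ^ (3 / 2 : ℝ) * (3 / (2 * κ))) κ := by
    have h1 := ((hasDerivAt_id κ).div_const (2 * Real.pi)).rpow_const (p := 3 / 2)
      (Or.inl (by simp only [id]; positivity))
    refine h1.congr_deriv ?_
    simp only [id]
    rw [Real.rpow_sub_one (by positivity)]
    field_simp
  have hw : ∀ s : ℝ, s * s = 1 → HasDerivAt
      (fun k : ℝ => D.frequencyProj s u *ᵥ waves (D.source f) (k • s • pt u))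
      (D.frequencyProj s u *ᵥ (waves (fun z => Complex.I • D.source (D.hamFun κ f) z) (κ • s • pt u)
        - (3 / (2 * κ) : ℂ) • waves (D.source f) (κ • s • pt u))) κ := by
    intro s hs'
    have h1 := ((mulVecL (D.frequencyProj s u)).restrictScalars ℝ).hasFDerivAt.comp_hasDerivAt κ
      (hs.hasDerivAt_waves_smul (s • pt u) κ)
    refine h1.congr_deriv ?_
    have h2 := D.waves_tangDirac hf (κ * s) u
    rw [mul_smul] at h2
    obtain ⟨X, hX⟩ : ∃ X : Mink, X = κ • s • pt u := ⟨_, rfl⟩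
    have h3 : waves (fun z => (Complex.I * (mdot (s • pt u) (pt z) : ℝ)) • D.source f z) X
        = (s : ℂ) • waves (fun z => (Complex.I * (mdot (pt u) (pt z) : ℝ)) • D.source f z) X := by
      rw [← waves_smul]
      congr 1
      ext1 z
      rw [smul_smul, mdot_smul_left]
      congr 1
      push_cast
      ring
    have h4 : waves (fun z => Complex.I • D.source (D.hamFun κ f) z) X
        = (κ : ℂ)⁻¹ • waves (fun z => ((1 / pt z 0 : ℝ) : ℂ) •
            (D.tangDirac f z - (3 : ℂ) • (D.slash (pt z) *ᵥ f z))) X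
          + (3 / (2 * κ) : ℂ) • waves (D.source f) X
          + Complex.I • waves (fun z => ((1 / pt z 0 : ℝ) : ℂ) • f z) X := by
      rw [← waves_smul, ← waves_smul, ← waves_smul,
        ← waves_add ((rapidDecay_of_mem_testFun hd).const_smul _) (hs.const_smul _),
        ← waves_add (((rapidDecay_of_mem_testFun hd).const_smul _).add (hs.const_smul _))
          ((rapidDecay_of_mem_testFun hq).const_smul _)]
      congr 1
      ext1 z
      rw [D.source_hamFun, source, show (3 / (2 * κ) : ℂ) = 3 / 2 * (κ : ℂ)⁻¹ by field_simp]
      module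
    rw [← hX] at h2 ⊢
    have h5 : D.frequencyProj s u *ᵥ ((-Complex.I * (κ * s : ℝ)) • (D.slash (pt u) *ᵥ
        waves (fun z => ((1 / pt z 0 : ℝ) : ℂ) • f z) X))
        = (-Complex.I * κ) • (D.frequencyProj s u *ᵥ
          waves (fun z => ((1 / pt z 0 : ℝ) : ℂ) • f z) X) := by
      have hs2 : (s : ℂ) * s = 1 := by exact_mod_cast hs'
      rw [Matrix.mulVec_smul, Matrix.mulVec_mulVec, D.frequencyProj_mul_slash hs',
        Matrix.smul_mulVec, smul_smul]
      congr 1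
      push_cast
      linear_combination (-Complex.I * κ) * hs2
    change D.frequencyProj s u *ᵥ waves _ X = _
    rw [h3, h4, h2]
    simp only [Matrix.mulVec_sub, Matrix.mulVec_add, Matrix.mulVec_smul] at h5 ⊢
    rw [h5]
    generalize D.frequencyProj s u *ᵥ waves (fun z => ((1 / pt z 0 : ℝ) : ℂ) • f z) X = A
    generalize D.frequencyProj s u *ᵥ waves (D.source f) X = B
    generalize D.frequencyProj s u *ᵥ
      waves (fun z => (Complex.I * (mdot (pt u) (pt z) : ℝ)) • D.source f z) X = C
    have h6 : (κ : ℂ)⁻¹ * (-Complex.I * κ) = -Complex.I := by field_simp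
    have h7 : (κ : ℂ)⁻¹ * ((κ * s : ℝ) : ℂ) = s := by push_cast; field_simp
    rw [smul_add, smul_smul, smul_smul, h6, h7]
    module
  have h1 := hc.smul ((hw 1 (by norm_num)).add (hw (-1) (by norm_num)))
  have h2 : HasDerivAt (fun k => D.fourierStar k f u) _ κ :=
    h1.congr_of_eventuallyEq (Filter.Eventually.of_forall fun k => D.fourierStar_eq_waves hf k u)
  refine h2.congr_deriv ?_
  rw [D.fourierStar_eq_waves hH, ← Complex.coe_smul, ← Complex.coe_smul, ← Complex.coe_smul]
  simp only [waves_smul, Matrix.mulVec_sub, Matrix.mulVec_smul, Pi.add_apply]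
  push_cast
  rw [show (3 / (2 * κ) : ℂ) = 3 / 2 * (κ : ℂ)⁻¹ by field_simp]
  module

/-! ### Strong continuity and strong derivatives -/

variable {D} in
lemma Hil.norm_le_of_inner_emb {h : D.Hil} {C : ℝ} (hC : 0 ≤ C)
    (H : ∀ f : TestFun, ‖inner ℂ (D.emb f) h‖ ≤ C * ‖D.emb f‖) : ‖h‖ ≤ C := by
  have h1 : ‖inner ℂ h h‖ ≤ C * ‖h‖ :=
    D.denseRange_emb.induction_on (p := fun g => ‖inner ℂ g h‖ ≤ C * ‖g‖) h
      (isClosed_le (by fun_prop) (by fun_prop)) H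
  rw [inner_self_eq_norm_sq_to_K] at h1
  simp only [norm_pow, RCLike.norm_ofReal, abs_norm] at h1
  by_cases h0 : ‖h‖ = 0
  · rw [h0]; exact hC
  · have h2 : 0 < ‖h‖ := lt_of_le_of_ne (norm_nonneg _) (Ne.symm h0)
    nlinarith

variable {D} in
/-- The mean value inequality, from derivatives in the weak sense. -/
lemma Hil.norm_sub_le_of_weak_deriv {φ φ' : ℝ → D.Hil} {s : Set ℝ} (hs : Convex ℝ s)
    (H : ∀ f : TestFun, ∀ k ∈ s, HasDerivAt (fun k => inner ℂ (D.emb f) (φ k))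
      (inner ℂ (D.emb f) (φ' k)) k) {C : ℝ} (hC : 0 ≤ C) (hb : ∀ k ∈ s, ‖φ' k‖ ≤ C) {a b : ℝ}
    (ha : a ∈ s) (hb' : b ∈ s) : ‖φ b - φ a‖ ≤ C * ‖b - a‖ := by
  refine Hil.norm_le_of_inner_emb (by positivity) fun f => ?_
  rw [inner_sub_right]
  have h1 := hs.norm_image_sub_le_of_norm_hasDerivWithin_le
    (f := fun k => inner ℂ (D.emb f) (φ k)) (C := C * ‖D.emb f‖)
    (fun k hk => (H f k hk).hasDerivWithinAt) (fun k hk => by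
      rw [mul_comm]
      exact (norm_inner_le_norm _ _).trans (by gcongr; exact hb k hk)) ha hb'
  calc _ ≤ _ := h1
    _ = _ := by ring

variable {D} in
/-- A weak derivative that is strongly continuous is a strong derivative. -/
lemma Hil.hasDerivAt_of_weak_deriv {φ φ' : ℝ → D.Hil} {κ : ℝ}
    {O : Set ℝ} (hO : O ∈ nhds κ)
    (H : ∀ f : TestFun, ∀ k ∈ O, HasDerivAt (fun k => inner ℂ (D.emb f) (φ k))
      (inner ℂ (D.emb f) (φ' k)) k) (hc : ContinuousAt φ' κ) : HasDerivAt φ (φ' κ) κ := by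
  rw [hasDerivAt_iff_isLittleO, Asymptotics.isLittleO_iff]
  intro ε hε
  obtain ⟨δ, hδ, hδ'⟩ := Metric.mem_nhds_iff.1
    (Filter.inter_mem hO (hc (Metric.closedBall_mem_nhds (φ' κ) hε)))
  filter_upwards [Metric.ball_mem_nhds κ hδ] with k hk
  have h1 := Hil.norm_sub_le_of_weak_deriv (φ := fun k => φ k - k • φ' κ)
    (φ' := fun k => φ' k - φ' κ) (convex_ball κ δ) (fun f k hk => by
      simp only [inner_sub_right, inner_smul_right_eq_smul]
      have h2 := (hasDerivAt_id k).smul_const (inner ℂ (D.emb f) (φ' κ))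
      simp only [one_smul, id] at h2
      exact (H f k (hδ' hk).1).sub h2) hε.le
    (fun k hk => by
      have h3 := (hδ' hk).2
      simpa [dist_eq_norm] using h3) (Metric.mem_ball_self hδ) hk
  convert h1 using 2
  rw [sub_smul]
  abel

variable {D} in
/-- Strong convergence of isometries may be applied to convergent vectors. -/
lemma Hil.tendsto_clm_apply {α : Type*} {l : Filter α} {A : α → D.Hil →L[ℂ] D.Hil} {v : α → D.Hil}
    {v₀ w₀ : D.Hil} (hA : ∀ᶠ a in l, ∀ w, ‖A a w‖ = ‖w‖)
    (h1 : Filter.Tendsto (fun a => A a v₀) l (nhds w₀)) (h2 : Filter.Tendsto v l (nhds v₀)) :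
    Filter.Tendsto (fun a => A a (v a)) l (nhds w₀) := by
  have h3 : Filter.Tendsto (fun a => A a (v a - v₀)) l (nhds 0) := by
    refine squeeze_zero_norm' (a := fun a => ‖v a - v₀‖) ?_ ?_
    · filter_upwards [hA] with a ha
      rw [ha]
    · have := (h2.sub_const v₀).norm
      simpa using this
  have h4 := h1.add h3
  rw [add_zero] at h4
  refine h4.congr fun a => ?_
  rw [map_sub]
  abel

lemma source_add (f g : E3 → Spinor) : D.source (f + g) = fun z => D.source f z + D.source g z := by
  ext1 z
  simp only [source, Pi.add_apply, Matrix.mulVec_add, smul_add]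

lemma source_smul (c : ℂ) (f : E3 → Spinor) : D.source (c • f) = fun z => c • D.source f z := by
  ext1 z
  simp only [source, Pi.smul_apply, Matrix.mulVec_smul]
  rw [smul_comm]

lemma fourierStar_add_smul (f g : TestFun) (c : ℂ) (κ : ℝ) (u : E3) :
    D.fourierStar κ (f + c • g : TestFun).1 u
      = D.fourierStar κ f.1 u + c • D.fourierStar κ g.1 u := by
  have h1 := rapidDecay_of_mem_testFun (D.source_mem_testFun f.2)
  have h2 := rapidDecay_of_mem_testFun (D.source_mem_testFun (c • g : TestFun).2)
  rw [D.fourierStar_eq_waves (f + c • g).2, D.fourierStar_eq_waves f.2, D.fourierStar_eq_waves g.2]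
  have h3 : ∀ x, waves (D.source (f + c • g : TestFun).1) x
      = waves (D.source f.1) x + c • waves (D.source g.1) x := by
    intro x
    have h4 : (f + c • g : TestFun).1 = f.1 + (c • g : TestFun).1 := rfl
    have h5 : (c • g : TestFun).1 = c • g.1 := rfl
    rw [h4, source_add, waves_add h1 h2, h5, source_smul, waves_smul]
  simp only [h3, Matrix.mulVec_add, Matrix.mulVec_smul]
  rw [← Complex.coe_smul, ← Complex.coe_smul, ← Complex.coe_smul]
  module

lemma continuous_fourierStar {f : E3 → Spinor} (hf : f ∈ TestFun) :
    Continuous fun p : ℝ × E3 => D.fourierStar p.1 f p.2 := by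
  have hw := (rapidDecay_of_mem_testFun (D.source_mem_testFun hf)).contDiff_waves.continuous
  have hX : ∀ s : ℝ, Continuous fun p : ℝ × E3 => p.1 • s • pt p.2 := fun s =>
    continuous_fst.smul ((continuous_pt.comp continuous_snd).const_smul s)
  have hP : ∀ s : ℝ, Continuous fun p : ℝ × E3 => D.frequencyProj s p.2 := fun s =>
    ((continuous_const.add ((D.continuous_slash_pt.comp continuous_snd).const_smul (s : ℂ))
      ).const_smul (1 / 2 : ℂ))
  rw [show (fun p : ℝ × E3 => D.fourierStar p.1 f p.2) = fun p => _ from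
    funext fun p => D.fourierStar_eq_waves hf p.1 p.2]
  have hc : Continuous fun p : ℝ × E3 => (p.1 / (2 * Real.pi)) ^ (3 / 2 : ℝ) :=
    (Real.continuous_rpow_const (by norm_num)).comp (by fun_prop)
  exact hc.smul (((hP 1).matrix_mulVec (hw.comp (hX 1))).add
    ((hP (-1)).matrix_mulVec (hw.comp (hX (-1)))))

/-- The part of `H_κ f` that is proportional to `κ⁻¹`. -/
noncomputable def kinetic (f : TestFun) : TestFun := D.ham 1 f - D.ham 0 f

lemma ham_eq (κ : ℝ) (f : TestFun) : D.ham κ f = D.ham 0 f + (κ : ℂ)⁻¹ • D.kinetic f := by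
  refine Subtype.ext (funext fun x => ?_)
  change D.hamFun κ f x = D.hamFun 0 f x + (κ : ℂ)⁻¹ • (D.hamFun 1 f x - D.hamFun 0 f x)
  simp only [hamFun, Complex.ofReal_zero, Complex.ofReal_one, inv_zero, inv_one, zero_smul, one_smul,
    Matrix.mulVec_add, Matrix.mulVec_neg, Matrix.mulVec_smul, Matrix.mulVec_zero, neg_zero]
  module

lemma emb_ham (κ : ℝ) (f : TestFun) :
    D.emb (D.ham κ f) = D.emb (D.ham 0 f) + (κ : ℂ)⁻¹ • D.emb (D.kinetic f) := by
  rw [ham_eq, emb_add, emb_smul]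

lemma continuousAt_emb_ham {κ : ℝ} (hκ : 0 < κ) (f : TestFun) :
    ContinuousAt (fun k : ℝ => D.emb (D.ham k f)) κ := by
  have h1 : ContinuousAt (fun k : ℝ => (k : ℂ)⁻¹) κ :=
    Complex.continuous_ofReal.continuousAt.inv₀ (by exact_mod_cast hκ.ne')
  rw [show (fun k : ℝ => D.emb (D.ham k f)) = fun k => _ from funext fun k => D.emb_ham k f]
  exact continuousAt_const.add (h1.smul continuousAt_const)

lemma continuousOn_density {α : Type*} [TopologicalSpace α] {s : Set α} {y : α → E3}
    {g v : α → Spinor} (hy : ContinuousOn y s) (hg : ContinuousOn g s) (hv : ContinuousOn v s) :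
    ContinuousOn (fun p => D.density (y p) (g p) (v p)) s := by
  rw [continuousOn_iff_continuous_domRestrict] at *
  exact (hg.star).dotProduct ((D.continuous_wt.comp hy).matrix_mulVec hv)

/-- The derivative of `F_κ^* f` in the weak sense. -/
lemma hasDerivAt_inner_Fstar (f g : TestFun) {κ : ℝ} (hκ : 0 < κ) :
    HasDerivAt (fun k : ℝ => inner ℂ (D.emb g) (D.Fstar k (D.emb f)))
      (inner ℂ (D.emb g) (Complex.I • D.Fstar κ (D.emb (D.ham κ f)))) κ := by
  -- the splitting of `H_k` shows the dependence of the derivative on `k`, for its continuity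
  have hder : ∀ k x, D.fourierStar k (D.hamFun k f) x
      = D.fourierStar k (D.ham 0 f).1 x + (k : ℂ)⁻¹ • D.fourierStar k (D.kinetic f).1 x := by
    intro k x
    rw [← fourierStar_add_smul, ← ham_eq]
    rfl
  have hcont : ContinuousOn (fun p : ℝ × E3 =>
      D.density p.2 (g.1 p.2) (Complex.I • D.fourierStar p.1 (D.hamFun p.1 f) p.2))
      (Ioi 0 ×ˢ univ) := by
    have h1 := D.continuous_fourierStar (D.ham 0 f).2
    have h2 := D.continuous_fourierStar (D.kinetic f).2
    have h3 : ContinuousOn (fun p : ℝ × E3 => (p.1 : ℂ)⁻¹) (Ioi 0 ×ˢ univ) :=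
      (by fun_prop : Continuous fun p : ℝ × E3 => (p.1 : ℂ)).continuousOn.inv₀ fun p hp => by
        have : 0 < p.1 := hp.1
        exact_mod_cast this.ne'
    refine D.continuousOn_density continuousOn_snd
      (g.2.1.continuous.comp continuous_snd).continuousOn (ContinuousOn.const_smul ?_ Complex.I)
    exact (h1.continuousOn.add (h3.smul h2.continuousOn)).congr fun p _ => hder p.1 p.2
  have hK : IsCompact (Icc (κ / 2) (2 * κ) ×ˢ tsupport g.1) := isCompact_Icc.prod g.2.2
  obtain ⟨B, hB⟩ := hK.exists_bound_of_continuousOn (hcont.mono (prod_mono (fun k hk =>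
    lt_of_lt_of_le (by positivity) hk.1) (subset_univ _)))
  have hcontx : ∀ k, Continuous fun x => D.density x (g.1 x) (D.fourierStar k f.1 x) := fun k =>
    D.continuous_density g.2.1.continuous ((D.continuous_fourierStar f.2).comp
      (by fun_prop : Continuous fun x : E3 => (k, x)))
  have key := hasDerivAt_integral_of_dominated_loc_of_deriv_le (μ := hypMeasure) (x₀ := κ)
    (F := fun k x => D.density x (g.1 x) (D.fourierStar k f.1 x))
    (F' := fun k x => D.density x (g.1 x) (Complex.I • D.fourierStar k (D.hamFun k f) x))
    (bound := (tsupport g.1).indicator fun _ => B) (s := Icc (κ / 2) (2 * κ))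
    (Icc_mem_nhds (by linarith) (by linarith))
    (Filter.Eventually.of_forall fun k => (hcontx k).aestronglyMeasurable)
    (D.integrable_density_test g ((D.continuous_fourierStar f.2).comp
      (by fun_prop : Continuous fun x : E3 => (κ, x))))
    (Continuous.aestronglyMeasurable (by
      refine continuousOn_univ.1 ?_
      exact hcont.comp (f := fun x : E3 => (κ, x)) (by fun_prop) fun x _ => ⟨hκ, mem_univ x⟩))
    (Filter.Eventually.of_forall fun x k hk => by
      by_cases hx : x ∈ tsupport g.1
      · rw [indicator_of_mem hx]
        exact hB (k, x) ⟨hk, hx⟩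
      · rw [indicator_of_notMem hx, image_eq_zero_of_notMem_tsupport hx, density_zero_left, norm_zero])
    ((integrable_indicator_iff (isClosed_tsupport _).measurableSet).2
      (integrableOn_const (IsCompact.measure_lt_top g.2.2).ne))
    (Filter.Eventually.of_forall fun x k hk => by
      have hk0 : 0 < k := lt_of_lt_of_le (by positivity) hk.1
      simp only [density_eq_pairing]
      exact (((pairing (g.1 x)).comp
        ((mulVecL (D.γ 0 * D.slash (pt x))).restrictScalars ℝ)).hasFDerivAt).comp_hasDerivAt k
          (D.hasDerivAt_fourierStar f.2 hk0 x))
  have h1 : inner ℂ (D.emb g) (Complex.I • D.Fstar κ (D.emb (D.ham κ f)))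
      = ∫ x, D.density x (g.1 x) (Complex.I • D.fourierStar κ (D.hamFun κ f) x) ∂hypMeasure := by
    refine Hil.inner_eq (D.fn_emb g) ?_
    filter_upwards [Hil.fn_smul Complex.I (D.Fstar κ (D.emb (D.ham κ f))),
      D.extends_Fstar hκ (D.ham κ f)] with x h1 h2
    rw [h1, Pi.smul_apply, h2]
    rfl
  rw [h1]
  refine key.2.congr_of_eventuallyEq ?_
  filter_upwards [lt_mem_nhds hκ] with k hk
  exact Hil.inner_eq (D.fn_emb g) (D.extends_Fstar hk f)

lemma continuousAt_Fstar_emb (f : TestFun) {κ : ℝ} (hκ : 0 < κ) :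
    ContinuousAt (fun k => D.Fstar k (D.emb f)) κ := by
  obtain ⟨δ, hδ, hδ'⟩ := Metric.mem_nhds_iff.1 (Filter.inter_mem (lt_mem_nhds hκ)
    ((D.continuousAt_emb_ham hκ f).norm.eventually_lt_const (lt_add_one _)))
  obtain ⟨C, hC⟩ : ∃ C, C = ‖D.emb (D.ham κ f)‖ + 1 := ⟨_, rfl⟩
  rw [← hC] at hδ'
  have hC0 : 0 ≤ C := by rw [hC]; positivity
  have h1 : ∀ k ∈ Metric.ball κ δ, ‖D.Fstar k (D.emb f) - D.Fstar κ (D.emb f)‖ ≤ C * ‖k - κ‖ := by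
    intro k hk
    refine Hil.norm_sub_le_of_weak_deriv (φ := fun k => D.Fstar k (D.emb f))
      (φ' := fun k => Complex.I • D.Fstar k (D.emb (D.ham k f))) (convex_ball κ δ)
      (fun g k hk => D.hasDerivAt_inner_Fstar f g (hδ' hk).1) hC0 (fun k hk => ?_)
      (Metric.mem_ball_self hδ) hk
    rw [norm_smul, Complex.norm_I, one_mul, D.norm_Fstar (hδ' hk).1]
    exact (le_of_lt (hδ' hk).2)
  refine tendsto_iff_norm_sub_tendsto_zero.2 (squeeze_zero' (g := fun k => C * ‖k - κ‖)
    (Filter.Eventually.of_forall fun k => norm_nonneg _) ?_ ?_)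
  · filter_upwards [Metric.ball_mem_nhds κ hδ] with k hk using h1 k hk
  · have : Continuous fun k : ℝ => C * ‖k - κ‖ := by fun_prop
    simpa using this.tendsto κ

lemma continuousAt_Fstar (h : D.Hil) {κ : ℝ} (hκ : 0 < κ) :
    ContinuousAt (fun k => D.Fstar k h) κ := by
  rw [Metric.continuousAt_iff']
  intro ε hε
  obtain ⟨f, hf⟩ := Metric.denseRange_iff.1 D.denseRange_emb h (ε / 3) (by positivity)
  filter_upwards [Metric.continuousAt_iff'.1 (D.continuousAt_Fstar_emb f hκ) (ε / 3) (by positivity),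
    lt_mem_nhds hκ] with k hk hk0
  have h1 : dist (D.Fstar k h) (D.Fstar k (D.emb f)) < ε / 3 := by
    rwa [dist_eq_norm, ← map_sub, D.norm_Fstar hk0, ← dist_eq_norm]
  have h2 : dist (D.Fstar κ (D.emb f)) (D.Fstar κ h) < ε / 3 := by
    rwa [dist_comm, dist_eq_norm, ← map_sub, D.norm_Fstar hκ, ← dist_eq_norm]
  calc _ ≤ dist (D.Fstar k h) (D.Fstar k (D.emb f)) + dist (D.Fstar k (D.emb f))
        (D.Fstar κ (D.emb f)) + dist (D.Fstar κ (D.emb f)) (D.Fstar κ h) := dist_triangle4 _ _ _ _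
    _ < ε := by linarith

/-- The derivative of `F_κ^* f` in `κ`. -/
lemma hasDerivAt_Fstar (f : TestFun) {κ : ℝ} (hκ : 0 < κ) :
    HasDerivAt (fun k => D.Fstar k (D.emb f))
      (Complex.I • D.Fstar κ (D.emb (D.ham κ f))) κ := by
  refine Hil.hasDerivAt_of_weak_deriv
    (φ' := fun k => Complex.I • D.Fstar k (D.emb (D.ham k f))) (Ioi_mem_nhds hκ)
    (fun g k hk => D.hasDerivAt_inner_Fstar f g hk) ?_
  refine ContinuousAt.const_smul ?_ Complex.I
  refine Hil.tendsto_clm_apply ?_ (D.continuousAt_Fstar _ hκ) (D.continuousAt_emb_ham hκ f)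
  filter_upwards [lt_mem_nhds hκ] with k hk
  exact D.norm_Fstar hk

/-- The difference `F_k h - F_κ h` is `F_k (F_κ^* - F_k^*) F_κ h`. -/
lemma continuousAt_F (h : D.Hil) {κ : ℝ} (hκ : 0 < κ) : ContinuousAt (fun k => D.F k h) κ := by
  have h1 : Filter.Tendsto (fun k => D.F κ h + D.F k (D.Fstar κ (D.F κ h) - D.Fstar k (D.F κ h)))
      (nhds κ) (nhds (D.F κ h + 0)) := by
    refine tendsto_const_nhds.add ?_
    refine Hil.tendsto_clm_apply (v₀ := 0) ?_ (by simp) ?_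
    · filter_upwards [lt_mem_nhds hκ] with k hk
      exact D.norm_F hk
    · have := (D.continuousAt_Fstar (D.F κ h) hκ).tendsto.const_sub (D.Fstar κ (D.F κ h))
      simpa using this
  rw [add_zero] at h1
  refine h1.congr' ?_
  filter_upwards [lt_mem_nhds hκ] with k hk
  rw [D.Fstar_F hκ, map_sub, D.F_Fstar hk]
  abel

/-- The derivative of the evolution `F_k F_κ^* g` at `k = κ`: the difference quotients are the images
under `F_k` of those of `-F_k^* g`. -/
lemma hasDerivAt_F_Fstar (g : TestFun) {κ : ℝ} (hκ : 0 < κ) :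
    HasDerivAt (fun k => D.F k (D.Fstar κ (D.emb g)))
      (-Complex.I • D.emb (D.ham κ g)) κ := by
  rw [hasDerivAt_iff_tendsto_slope]
  have h1 := (hasDerivAt_iff_tendsto_slope.1 (D.hasDerivAt_Fstar g hκ)).neg
  have h2 : Filter.Tendsto (fun k => D.F k (-slope (fun k => D.Fstar k (D.emb g)) κ k))
      (nhdsWithin κ {κ}ᶜ) (nhds (D.F κ (-(Complex.I • D.Fstar κ (D.emb (D.ham κ g)))))) := by
    refine Hil.tendsto_clm_apply ?_ ((D.continuousAt_F _ hκ).mono_left nhdsWithin_le_nhds) h1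
    filter_upwards [nhdsWithin_le_nhds (lt_mem_nhds hκ)] with k hk
    exact D.norm_F hk
  rw [map_neg, map_smul, D.F_Fstar hκ, ← neg_smul] at h2
  refine h2.congr' ?_
  filter_upwards [nhdsWithin_le_nhds (lt_mem_nhds hκ)] with k hk
  rw [slope_def_module, slope_def_module, map_neg, ← Complex.coe_smul, ← Complex.coe_smul, map_smul,
    ← smul_neg, map_sub, D.F_Fstar hk, D.F_Fstar hκ, neg_sub]

lemma continuousAt_U₀ {m : ℝ} (hm : 0 < m) (f : D.Hil) {p : ℝ × ℝ} (h₂ : 0 < p.1) (h₁ : 0 < p.2) :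
    ContinuousAt (fun p : ℝ × ℝ => D.U₀ m p.1 p.2 f) p := by
  have h3 : ContinuousAt (fun p : ℝ × ℝ => D.Fstar (m * p.2) f) p :=
    ContinuousAt.comp (g := fun k => D.Fstar k f) (f := fun p : ℝ × ℝ => m * p.2)
      (D.continuousAt_Fstar f (by positivity)) (by fun_prop)
  refine Hil.tendsto_clm_apply (A := fun p : ℝ × ℝ => D.F (m * p.1)) ?_ ?_ h3
  · filter_upwards [(continuous_fst.tendsto p).eventually (lt_mem_nhds h₂)] with q hq
    exact D.norm_F (by positivity)
  · exact ContinuousAt.comp (g := fun k => D.F k _) (f := fun p : ℝ × ℝ => m * p.1)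
      (D.continuousAt_F _ (by positivity)) (by fun_prop)

end DiracMatrices

/-! ### The free evolution between hyperboloids -/

/-- `u·v` grows at least linearly in `u`, uniformly for `v` in a compact set. -/
lemma exists_pos_le_mdot {K : Set E3} (hK : IsCompact K) :
    ∃ δ : ℝ, 0 < δ ∧ ∀ v ∈ K, ∀ u : E3, δ * ‖u‖ ≤ pt u 0 * pt v 0 - inner ℝ u v := by
  have hc : Continuous fun v : E3 => pt v 0 - ‖v‖ :=
    ((continuous_apply 0).comp continuous_pt).sub continuous_norm
  obtain ⟨δ, hδ, h⟩ := hK.exists_forall_le' hc.continuousOn (a := 0) fun v _ =>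
    sub_pos.2 (norm_lt_pt_zero v)
  refine ⟨δ, hδ, fun v hv u => ?_⟩
  have h1 := h v hv
  have h2 := real_inner_le_norm u v
  have h3 := norm_lt_pt_zero u
  have h4 := norm_nonneg u
  nlinarith [pt_zero_pos v, norm_nonneg v]

namespace DiracMatrices
variable (D : DiracMatrices)

lemma contDiff_fourier {g : E3 → Spinor} (hg : RapidDecay g) (κ : ℝ) :
    ContDiff ℝ ∞ (D.fourier κ g) := by
  rw [show D.fourier κ g = fun u => _ from funext fun u => D.fourier_eq κ g u]
  exact ((D.contDiff_field hg).comp (contDiff_pt.const_smul κ)).const_smul _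

/-- By finite propagation speed, the evolution from one hyperboloid to another preserves compact
supports. -/
lemma hasCompactSupport_fourier_fourierStar {κ₁ κ₂ : ℝ} (h₁ : 0 < κ₁) (h₂ : 0 < κ₂)
    {f : E3 → Spinor} (hf : f ∈ TestFun) :
    HasCompactSupport (D.fourier κ₂ (D.fourierStar κ₁ f)) := by
  obtain ⟨δ, hδ, h⟩ := exists_pos_le_mdot hf.2
  refine HasCompactSupport.intro
    (isCompact_closedBall (0 : E3) ((κ₁ ^ 2 + κ₂ ^ 2) / (2 * κ₁ * κ₂ * δ))) fun u hu => ?_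
  rw [mem_closedBall_zero_iff, not_le, div_lt_iff₀ (by positivity)] at hu
  rw [fourier_eq, pt_eq_event, smul_event, D.field_fourierStar_eq_zero hf h₁.ne', smul_zero]
  intro v hv
  rw [spacelike_iff]
  calc _ < _ := hu
    _ = 2 * κ₁ * κ₂ * (δ * ‖u‖) := by ring
    _ ≤ _ := by gcongr; exact h v hv u

/-- The function `F_{κ₂} F_{κ₁}^* f`, as an element of `C₀^∞`. -/
noncomputable def transport {κ₁ κ₂ : ℝ} (h₁ : 0 < κ₁) (h₂ : 0 < κ₂) (f : TestFun) : TestFun :=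
  ⟨D.fourier κ₂ (D.fourierStar κ₁ f.1),
    D.contDiff_fourier (D.rapidDecay_fourierStar f.2 h₁.ne') κ₂,
    D.hasCompactSupport_fourier_fourierStar h₁ h₂ f.2⟩

lemma F_Fstar_emb {κ₁ κ₂ : ℝ} (h₁ : 0 < κ₁) (h₂ : 0 < κ₂) (f : TestFun) :
    D.F κ₂ (D.Fstar κ₁ (D.emb f)) = D.emb (D.transport h₁ h₂ f) := by
  obtain ⟨g, hg⟩ : ∃ g, g = D.transport h₁ h₂ f := ⟨_, rfl⟩
  have h3 : g.1 = D.fourier κ₂ (D.fourierStar κ₁ f.1) := congrArg Subtype.val hg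
  rw [← hg]
  refine Hil.ext_fn ?_
  filter_upwards [D.fn_F_Fstar_emb h₁ h₂ f, D.fn_emb g] with x h4 h5
  rw [h4, h5, h3]

/-- On test functions the inversion formula `F_κ F_κ^* f = f` holds pointwise. -/
lemma fourier_fourierStar {κ : ℝ} (hκ : 0 < κ) {f : E3 → Spinor} (hf : f ∈ TestFun) :
    D.fourier κ (D.fourierStar κ f) = f := by
  have h1 := D.fn_F_Fstar_emb hκ hκ ⟨f, hf⟩
  rw [D.F_Fstar hκ] at h1
  have h2 := h1.symm.trans (D.fn_emb ⟨f, hf⟩)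
  exact (Continuous.ae_eq_iff_eq volume
    (D.continuous_fourier (D.rapidDecay_fourierStar hf hκ.ne') κ) hf.1.continuous).1
    (volume_absolutelyContinuous.ae_le h2)

lemma hasDerivAt_U₀_left {m l₂ l₁ : ℝ} (hm : 0 < m) (h₂ : 0 < l₂) (h₁ : 0 < l₁) (f : TestFun) :
    HasDerivAt (fun l => D.U₀ m l l₁ (D.emb f))
      (-Complex.I • (m : ℂ) • D.emb (D.ham (m * l₂)
        (D.transport (mul_pos hm h₁) (mul_pos hm h₂) f))) l₂ := by
  -- `U₀(l, l₁) f = F_{ml} F_{ml₂}^* U₀(l₂, l₁) f`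
  have h3 : D.Fstar (m * l₁) (D.emb f) = D.Fstar (m * l₂)
      (D.emb (D.transport (mul_pos hm h₁) (mul_pos hm h₂) f)) := by
    rw [← F_Fstar_emb, D.Fstar_F (mul_pos hm h₂)]
  have h4 := (D.hasDerivAt_F_Fstar (D.transport (mul_pos hm h₁) (mul_pos hm h₂) f)
    (mul_pos hm h₂)).scomp l₂ ((hasDerivAt_id l₂).const_mul m)
  rw [← h3, mul_one, ← Complex.coe_smul m, smul_comm] at h4
  exact h4

lemma hasDerivAt_U₀_right {m l₂ l₁ : ℝ} (hm : 0 < m) (h₁ : 0 < l₁) (f : TestFun) :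
    HasDerivAt (fun l => D.U₀ m l₂ l (D.emb f))
      (Complex.I • D.U₀ m l₂ l₁ ((m : ℂ) • D.emb (D.ham (m * l₁) f))) l₁ := by
  have h3 := (D.hasDerivAt_Fstar f (mul_pos hm h₁)).scomp l₁ ((hasDerivAt_id l₁).const_mul m)
  have h4 := ((D.F (m * l₂)).restrictScalars ℝ).hasFDerivAt.comp_hasDerivAt l₁ h3
  rw [mul_one, ← Complex.coe_smul m, smul_comm, ContinuousLinearMap.coe_restrictScalars',
    map_smul, ← map_smul (D.Fstar (m * l₁))] at h4
  exact h4

lemma IsGlobalSolution.isDiracSolution {m : ℝ} {ψ : Mink → Spinor} (h : D.IsGlobalSolution m ψ) :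
    D.IsDiracSolution m ψ :=
  ⟨h.1.contDiffOn, fun x _ _ => sub_eq_zero.2 (h.2 x)⟩

/-- The wave function `(m/2π)^{3/2} ∫ e^{-i m x·z γ·z} (γ·z) g(z) dμ(z)`, whose restriction to the
hyperboloid of radius `l` is `F_{ml} g`, up to the factor `l^{3/2}`. -/
noncomputable def waveFun (m : ℝ) (g : E3 → Spinor) (x : Mink) : Spinor :=
  D.field ((((m / (2 * Real.pi)) ^ (3 / 2 : ℝ) : ℝ) : ℂ) • g) (m • x)

lemma isDiracSolution_waveFun (m : ℝ) {g : E3 → Spinor} (hg : RapidDecay g) :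
    D.IsDiracSolution m (D.waveFun m g) := by
  have h := IsGlobalSolution.comp_smul D
    (D.isGlobalSolution_field (hg.const_smul (((m / (2 * Real.pi)) ^ (3 / 2 : ℝ) : ℝ) : ℂ))) m
  rw [mul_one] at h
  exact IsGlobalSolution.isDiracSolution D h

lemma fourier_eq_waveFun {m l : ℝ} (hm : 0 < m) (hl : 0 < l) (g : E3 → Spinor) (u : E3) :
    D.fourier (m * l) g u = l ^ (3 / 2 : ℝ) • D.waveFun m g (l • pt u) := by
  rw [fourier_eq, waveFun, field_smul, smul_smul m l, Complex.coe_smul, smul_smul,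
    ← Real.mul_rpow hl.le (by positivity), show m * l / (2 * Real.pi) = l * (m / (2 * Real.pi)) by ring]

end DiracMatrices

end HypDirac

open HypDirac in
theorem proposition4p2 (D : DiracMatrices) (m : ℝ) (hm : 0 < m) :
    -- the operators are the extensions of the two integral transformations
    (∀ κ : ℝ, 0 < κ →
      D.Extends (D.fourier κ) (D.F κ) ∧ D.Extends (D.fourierStar κ) (D.Fstar κ) ∧
      D.Fstar κ = ContinuousLinearMap.adjoint (D.F κ) ∧
      D.F κ ∘L D.Fstar κ = ContinuousLinearMap.id ℂ D.Hil ∧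
      D.Fstar κ ∘L D.F κ = ContinuousLinearMap.id ℂ D.Hil) ∧
    -- strong continuity
    (∀ f : D.Hil,
      ContinuousOn (fun κ : ℝ => D.F κ f) (Set.Ioi 0) ∧
      ContinuousOn (fun κ : ℝ => D.Fstar κ f) (Set.Ioi 0) ∧
      ContinuousOn (fun p : ℝ × ℝ => D.U₀ m p.1 p.2 f) (Set.Ioi 0 ×ˢ Set.Ioi 0)) ∧
    -- the derivative of `F_κ^* f`
    (∀ (f : TestFun) (κ : ℝ), 0 < κ →
      DifferentiableAt ℝ (fun k : ℝ => D.Fstar k (D.emb f)) κ ∧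
      -Complex.I • deriv (fun k : ℝ => D.Fstar k (D.emb f)) κ
        = D.Fstar κ (D.emb (D.ham κ f))) ∧
    -- the derivative of `U₀(l₂, l₁) f` in `l₂`; `U₀(l₂, l₁) f` is in the domain of `H_{m l₂}`
    (∀ (f : TestFun) (l₂ l₁ : ℝ), 0 < l₂ → 0 < l₁ →
      DifferentiableAt ℝ (fun l : ℝ => D.U₀ m l l₁ (D.emb f)) l₂ ∧
      ∃ g : TestFun, D.U₀ m l₂ l₁ (D.emb f) = D.emb g ∧
        Complex.I • deriv (fun l : ℝ => D.U₀ m l l₁ (D.emb f)) l₂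
          = (m : ℂ) • D.emb (D.ham (m * l₂) g)) ∧
    -- the derivative of `U₀(l₂, l₁) f` in `l₁`
    (∀ (f : TestFun) (l₂ l₁ : ℝ), 0 < l₂ → 0 < l₁ →
      DifferentiableAt ℝ (fun l : ℝ => D.U₀ m l₂ l (D.emb f)) l₁ ∧
      -Complex.I • deriv (fun l : ℝ => D.U₀ m l₂ l (D.emb f)) l₁
        = D.U₀ m l₂ l₁ ((m : ℂ) • D.emb (D.ham (m * l₁) f))) ∧
    -- `U₀` is the free Dirac evolution between the hyperboloids `x² = l²`
    (∀ (f : TestFun) (l₁ : ℝ), 0 < l₁ →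
      ∃ ψ : Mink → Spinor, D.IsDiracSolution m ψ ∧
        (∀ x : E3, ψ (l₁ • pt x) = l₁ ^ (-(3 / 2) : ℝ) • f.1 x) ∧
        ∀ l : ℝ, 0 < l →
          (D.U₀ m l l₁ (D.emb f)).fn =ᵐ[hypMeasure]
            fun x => l ^ (3 / 2 : ℝ) • ψ (l • pt x)) := by

  refine ⟨fun κ hκ => ⟨D.extends_F hκ, D.extends_Fstar hκ, D.Fstar_eq_adjoint hκ,
    D.F_comp_Fstar hκ, D.Fstar_comp_F hκ⟩, fun f => ⟨fun κ hκ => ?_, fun κ hκ => ?_, fun p hp => ?_⟩,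
    fun f κ hκ => ?_, fun f l₂ l₁ h₂ h₁ => ?_, fun f l₂ l₁ h₂ h₁ => ?_, fun f l₁ h₁ => ?_⟩
  · exact (D.continuousAt_F f hκ).continuousWithinAt
  · exact (D.continuousAt_Fstar f hκ).continuousWithinAt
  · exact (D.continuousAt_U₀ hm f hp.1 hp.2).continuousWithinAt
  · have h := D.hasDerivAt_Fstar f hκ
    refine ⟨h.differentiableAt, ?_⟩
    rw [h.deriv, smul_smul, neg_mul, Complex.I_mul_I, neg_neg, one_smul]
  · have h := D.hasDerivAt_U₀_left hm h₂ h₁ f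
    refine ⟨h.differentiableAt, _, D.F_Fstar_emb (mul_pos hm h₁) (mul_pos hm h₂) f, ?_⟩
    rw [h.deriv, smul_smul, mul_neg, Complex.I_mul_I, neg_neg, one_smul]
  · have h := D.hasDerivAt_U₀_right (l₂ := l₂) hm h₁ f
    refine ⟨h.differentiableAt, ?_⟩
    rw [h.deriv, smul_smul, neg_mul, Complex.I_mul_I, neg_neg, one_smul]
  · have hg := D.rapidDecay_fourierStar f.2 (mul_pos hm h₁).ne'
    refine ⟨D.waveFun m (D.fourierStar (m * l₁) f.1), D.isDiracSolution_waveFun m hg,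
      fun x => ?_, fun l hl => ?_⟩
    · have h := congrFun (D.fourier_fourierStar (mul_pos hm h₁) f.2) x
      rw [D.fourier_eq_waveFun hm h₁] at h
      rw [← h, smul_smul, ← Real.rpow_add h₁, neg_add_cancel, Real.rpow_zero, one_smul]
    · filter_upwards [D.fn_F_Fstar_emb (mul_pos hm h₁) (mul_pos hm hl) f] with x hx
      rw [← D.fourier_eq_waveFun hm hl, ← hx]
      rfl
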